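/- **Model.** Let $\{P_\theta:\theta\in\Theta\}$, $\Theta\subseteq\mathbb R$ open, have densities $p(\cdot;\theta)$ with respect to a $\sigma$-finite measure $\mu$, and put $s(\theta)=\sqrt{p(\cdot;\theta)}\in L_2(\mu)$. Assume that at every $\theta\in\Theta$ there are $\dot s(\theta),\ddot s(\theta),\dddot s(\theta),\ddddot s(\theta)\in L_2(\mu)$, which we also write $s^{(1)},\dots,s^{(4)}$, such that for $r=2,3,4$, all $\delta_n>0$ with $\delta_n\to0$ and all bounded $t_n$, $$\Big\|\delta_n^{-r}\Big(s(\theta+\delta_nt_n)-s(\theta)-\sum_{k=1}^{r}\tfrac{(\delta_nt_n)^k}{k!}s^{(k)}(\theta)\Big)\Big\|_{L_2(\mu)}\to0 ;$$ that $\theta\mapsto\dot s(\theta)$ and $\theta\mapsto\ddddot s(\theta)$ are continuous from $\Theta$ to $L_2(\mu)$; and that, with $\mathbf I_k(\theta)=2\frac{s^{(k)}(\theta)}{s(\theta)}\mathbf 1_{\{s(\theta)>0\}}$, for all $\theta\in\Theta$: $E_\theta|\mathbf I_1|^6$, $E_\theta|\mathbf I_2|^3$, $E_\theta|\mathbf I_3|^2$,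 $E_\theta|\mathbf I_4|$ are finite and $\mathcal I(\theta)=E_\theta\mathbf I_1^2$, $E_\theta\mathbf I_1^4$, $E_\theta\mathbf I_2^2$ are non-zero. **Estimator.** Let $\theta_0\in\Theta$, let $Y_1,\dots,Y_n$ be i.i.d. from $P_{\theta_0}$, and let $\mathbf l(\theta)=\sum_{i\le n}\log p(Y_i;\theta)$. Let $J>1$ be a fixed integer and let $m=m(n)$ satisfy $m/\sqrt n\to\infty$ and $m/n\to0$. Let $\widetilde\theta_n$ be a $\sqrt n$-consistent estimator computed from the data and $\theta_n^*$ the midpoint of the interval containing $\widetilde\theta_n$ in a grid of points of $\mathbb R$ spaced $n^{-1/2}$ apart. Put $\theta^*_{j,n}=\theta^*_n+jn^{-1/4}$, $-J\le j\le J$. For values $L_j$ at the points $\theta^*_{j,n}$, let $\widehat\beta=(X^TX)^{-1}X^TL$ be the least-squares coefficients of the cubic regression, $X$ having the rows $(1,x_j,x_j^2,x_j^3)$, $x_j=jn^{-1/4}$. The maximum cubic log-likelihood estimator (MCLE) from $L$ is $\theta_n^*+n^{-1/4}\widehat\chi$, where $\widehat\chi$ maximizes $\widehat\beta_1\chi n^{-1/4}+\widehat\beta_2(\chi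 n^{-1/4})^2+\widehat\beta_3(\chi n^{-1/4})^3$ over $\chi\in[-J,J]$. **Monte Carlo model.** Evaluations $\overline{\mathbf l}(\theta^*_{j,n})$ of the log-likelihood obey the Monte Carlo model with a function $\gamma=\gamma_n$ and constants $C_\gamma\in\mathbb R$, $\tau>0$ if $\overline{\mathbf l}(\theta^*_{j,n})=\mathbf l(\theta^*_{j,n})+\gamma(\theta^*_{j,n})+\epsilon_{j,n}$, where $\big(\sqrt{m/n}\,\epsilon_{j,n}\big)_{-J\le j\le J}$ converges in distribution to a vector of independent $N(0,\tau^2)$ variables (as is the case if the $\epsilon_{j,n}$ are i.i.d. over $j$ and $\sqrt{m/n}\,\epsilon_{j,n}$ converges in distribution to $N(0,\tau^2)$), and $\gamma(\theta^*_{j,n})=\gamma(\theta^*_n)+C_\gamma\frac nm jn^{-1/4}+o_P\big(\frac nm n^{-1/4}\big)$. **Theorem.** (a) If the evaluations obey the Monte Carlo model, then their MCLE $\widehat\theta_n$ is efficient, and its Monte Carlo error is negligible. Precisely, let $\widehat\theta^{\gamma}_n$ and $\widehat\theta^{0}_n$ be the MCLEs computed from $\mathbf l+\gamma$ and from $\mathbf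 l$. Then: 1. $\sqrt n(\widehat\theta_n-\theta_0)-\mathcal I(\theta_0)^{-1}n^{-1/2}\sum_{i\le n}\mathbf I_1(\theta_0)(Y_i)\to0$ in probability, and $\sqrt n(\widehat\theta_n-\theta_0)\to N(0,1/\mathcal I(\theta_0))$ in distribution. 2. With $\mathrm{SE}_{\rm stat}^2=\frac1{n\mathcal I(\theta_0)}$ and $\mathrm{SE}_{\rm MC}^2=\frac{n}{m}\,\tau^2\,\frac{[(X^TX)^{-1}]_{22}}{(n\mathcal I(\theta_0))^2}$, both $(\widehat\theta^{0}_n-\theta_0)/\mathrm{SE}_{\rm stat}$ and $(\widehat\theta_n-\widehat\theta^{\gamma}_n)/\mathrm{SE}_{\rm MC}$ converge in distribution to $N(0,1)$; $m\sqrt n\,\mathrm{SE}_{\rm MC}^2$ converges to a positive constant; and $\mathrm{SE}_{\rm MC}^2/\mathrm{SE}_{\rm stat}^2\to0$. 3. The Monte Carlo bias satisfies $m(\widehat\theta^{\gamma}_n-\widehat\theta^{0}_n)\to C_\gamma/\mathcal I(\theta_0)$ and $(\widehat\theta^{\gamma}_n-\widehat\theta^{0}_n)/\mathrm{SE}_{\rm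 stat}\to0$ in probability. (b) Importance sampling obeys the Monte Carlo model, so that the conclusions of (a) hold for it. That is, let $p(y;\theta)=\int p_{Y|X}(y|x;\theta)p_X(x;\theta)\,dx$, let $q(\cdot;\theta)$ be probability densities that are positive where $p_{Y|X}p_X$ is, and let, given the data, $X_{i,j}^{(l)}$ ($l\le m$) be independent draws from $q(\cdot;\theta^*_{j,n})$ and $$\overline{\mathbf l}(\theta^*_{j,n})=\sum_{i=1}^n\log\Big(\frac1m\sum_{l=1}^m w(Y_i,X_{i,j}^{(l)};\theta^*_{j,n})\Big),\qquad w(y,x;\theta)=p_{Y|X}(y|x;\theta)\frac{p_X(x;\theta)}{q(x;\theta)}.$$ Assume that for $Y\sim P_{\theta_0}$ and, given $Y$, $X\sim q(\cdot;\theta)$, the relative weight $w(Y,X;\theta)/p(Y;\theta)$ has fourth moment bounded for $\theta$ near $\theta_0$, and that $\Psi(\theta)=E_{\theta_0}\big[\mathrm{Var}\big(w(Y,X;\theta)/p(Y;\theta)\mid Y\big)\big]$ is differentiable at $\theta_0$ with $\Psi(\theta_0)>0$. Then the Monte Carlo model holds with $\gamma(\theta)=-\frac n{2m}\Psi(\theta)$,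 $C_\gamma=-\Psi'(\theta_0)/2$ and $\tau^2=\Psi(\theta_0)$. -/

import Mathlib

open MeasureTheory ProbabilityTheory Filter Topology
open scoped NNReal ENNReal

noncomputable section

/-! ### Parametric models and their regularity -/

/-- A dominated parametric model `{P_θ : θ ∈ Θ}`, with `Θ ⊆ ℝ` open, given by the densities
`p θ` of `P_θ` with respect to a fixed σ-finite measure `μ`. Outside `Θ` the function `p θ` is an
arbitrary measurable nonnegative function. -/
structure ParametricModel (𝒴 : Type*) [MeasurableSpace 𝒴] where
  μ : Measure 𝒴
  sigmaFinite : SigmaFinite μ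
  Θ : Set ℝ
  isOpen : IsOpen Θ
  p : ℝ → 𝒴 → ℝ
  measurable_p : ∀ θ, Measurable (p θ)
  nonneg_p : ∀ θ y, 0 ≤ p θ y
  lintegral_p : ∀ θ ∈ Θ, ∫⁻ y, ENNReal.ofReal (p θ y) ∂μ = 1

namespace ParametricModel

variable {𝒴 : Type*} [MeasurableSpace 𝒴] (M : ParametricModel 𝒴)

/-- The distribution `P_θ`. -/
def P (θ : ℝ) : Measure 𝒴 := M.μ.withDensity fun y => ENNReal.ofReal (M.p θ y)

/-- The law of an i.i.d. sample `(Y₁, …, Yₙ)` from `P_θ`. -/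
def sampleLaw (θ : ℝ) (n : ℕ) : Measure (Fin n → 𝒴) := Measure.pi fun _ : Fin n => M.P θ

/-- The square root density `s(θ) = √p(θ)`. -/
def s (θ : ℝ) (y : 𝒴) : ℝ := √(M.p θ y)

/-- The log-likelihood `∑ᵢ log p(Yᵢ; θ)` of a sample. -/
def logLik {n : ℕ} (y : Fin n → 𝒴) (θ : ℝ) : ℝ := ∑ i, Real.log (M.p θ (y i))

/-- Candidates for the derivatives of `θ ↦ s(θ) ∈ L²(μ)`: `ds k θ` is the one of order `k + 1`. -/
abbrev Derivs : Type _ := Fin 4 → ℝ → Lp ℝ 2 M.μ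

variable (ds : M.Derivs)

/-- The variables `2 (s⁽ᵏ⁺¹⁾(θ) / s(θ)) 1{s(θ) > 0}`; `k = 0` is the score. -/
def dotI (k : Fin 4) (θ : ℝ) (y : 𝒴) : ℝ :=
  if 0 < M.s θ y then 2 * (ds k θ y / M.s θ y) else 0

/-- The Fisher information `𝓘(θ) = E_θ [İ(θ)²]`. -/
def fisher (θ : ℝ) : ℝ := ∫ y, (M.dotI ds 0 θ y) ^ 2 ∂(M.P θ)

/-- The Taylor remainder of order `r`:
`s(θ + h) - s(θ) - ∑_{k = 1}^{r} (h ^ k / k!) s⁽ᵏ⁾(θ)`. -/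
def taylorRem (r : ℕ) (θ h : ℝ) (y : 𝒴) : ℝ :=
  M.s (θ + h) y - M.s θ y
    - ∑ k : Fin 4, if (k : ℕ) < r then
        h ^ ((k : ℕ) + 1) / (Nat.factorial ((k : ℕ) + 1) : ℝ) * ds k θ y else 0

/-- `θ₀` is a fourth-order regular point of the parametrization. -/
structure IsFourthOrderRegular (θ₀ : ℝ) : Prop where
  mem_interior : θ₀ ∈ interior M.Θ
  taylor : ∀ r ∈ ({2, 3, 4} : Finset ℕ), ∀ δ t : ℕ → ℝ, (∀ n, 0 < δ n) →
    Tendsto δ atTop (𝓝 0) → (∃ B, ∀ n, |t n| ≤ B) →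
    Tendsto (fun n => eLpNorm (fun y => M.taylorRem ds r θ₀ (δ n * t n) y / δ n ^ r) 2 M.μ)
      atTop (𝓝 0)
  second_moment_dotI : ∫ y, (M.dotI ds 0 θ₀ y) ^ 2 ∂(M.P θ₀) ≠ 0
  fourth_moment_dotI : ∫ y, (M.dotI ds 0 θ₀ y) ^ 4 ∂(M.P θ₀) ≠ 0
  second_moment_ddotI : ∫ y, (M.dotI ds 1 θ₀ y) ^ 2 ∂(M.P θ₀) ≠ 0

/-- The regularity assumption on the model, with the derivatives of the square root density made
explicit. (The first item is continuity of the first derivative, part of the usual notion of a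
regular parametric model.) -/
structure IsRegular : Prop where
  continuousOn_first : ContinuousOn (ds 0) M.Θ
  regular : ∀ θ ∈ M.Θ, M.IsFourthOrderRegular ds θ
  continuousOn_fourth : ContinuousOn (ds 3) M.Θ
  moment_one : ∀ θ ∈ M.Θ, MemLp (M.dotI ds 0 θ) 6 (M.P θ)
  moment_two : ∀ θ ∈ M.Θ, MemLp (M.dotI ds 1 θ) 3 (M.P θ)
  moment_three : ∀ θ ∈ M.Θ, MemLp (M.dotI ds 2 θ) 2 (M.P θ)
  moment_four : ∀ θ ∈ M.Θ, MemLp (M.dotI ds 3 θ) 1 (M.P θ)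

/-- The normalized score `S_n(θ) = n^{-1/2} ∑ᵢ İ(Yᵢ; θ)`. -/
def scoreSum {n : ℕ} (θ : ℝ) (y : Fin n → 𝒴) : ℝ :=
  (√(n : ℝ))⁻¹ * ∑ i, M.dotI ds 0 θ (y i)

/-- `√n`-consistency at `θ₀` of an estimator computed from the sample. -/
def IsRootConsistent (pilot : ∀ n : ℕ, (Fin n → 𝒴) → ℝ) (θ₀ : ℝ) : Prop :=
  ∀ ε : ℝ≥0∞, 0 < ε → ∃ B : ℝ, ∀ᶠ n : ℕ in atTop,
    M.sampleLaw θ₀ n {y | B < √(n : ℝ) * |pilot n y - θ₀|} ≤ ε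

end ParametricModel

/-! ### The grid, the cubic fit and the estimator -/

/-- The scale `n^{-1/4}`. -/
def gridScale (n : ℕ) : ℝ := (n : ℝ) ^ (-(1 / 4) : ℝ)

/-- The grid index `j ∈ {-J, …, J}`, as a real number. -/
def gridIndex (J : ℕ) (j : Fin (2 * J + 1)) : ℝ := (j : ℝ) - (J : ℝ)

/-- The evaluation point `θ*_{j,n} = θ*_n + j n^{-1/4}`. -/
def gridPoint (J n : ℕ) (θs : ℝ) (j : Fin (2 * J + 1)) : ℝ := θs + gridIndex J j * gridScale n

/-- For the grid of points `a + k n^{-1/2}`, `k ∈ ℤ`, the midpoint of the interval that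
contains `x`. -/
def gridMidpoint (a : ℝ) (n : ℕ) (x : ℝ) : ℝ :=
  a + ((⌊(x - a) * √(n : ℝ)⌋ : ℝ) + 1 / 2) / √(n : ℝ)

/-- The design matrix of the cubic regression; its rows are `(1, x, x², x³)`, `x = j n^{-1/4}`. -/
def designMatrix (J n : ℕ) : Matrix (Fin (2 * J + 1)) (Fin 4) ℝ :=
  fun j k => (gridIndex J j * gridScale n) ^ (k : ℕ)

/-- The least-squares coefficients `(XᵀX)⁻¹ Xᵀ L`. -/
def lsCoeff (J n : ℕ) (L : Fin (2 * J + 1) → ℝ) : Fin 4 → ℝ :=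
  Matrix.mulVec (((designMatrix J n).transpose * designMatrix J n)⁻¹ * (designMatrix J n).transpose)
    L

/-- The fitted cubic, without its constant term, at `χ n^{-1/4}`. -/
def fittedCubic (J n : ℕ) (L : Fin (2 * J + 1) → ℝ) (χ : ℝ) : ℝ :=
  lsCoeff J n L 1 * (χ * gridScale n) + lsCoeff J n L 2 * (χ * gridScale n) ^ 2
    + lsCoeff J n L 3 * (χ * gridScale n) ^ 3

/-- `t` is a maximum cubic log-likelihood estimate computed from the evaluations `L` on the grid
around `θs`: it maximizes the fitted cubic over the range `[θs - J n^{-1/4}, θs + J n^{-1/4}]`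
of the grid. -/
def IsMCLE (J n : ℕ) (θs : ℝ) (L : Fin (2 * J + 1) → ℝ) (t : ℝ) : Prop :=
  ∃ χ ∈ Set.Icc (-(J : ℝ)) (J : ℝ),
    IsMaxOn (fittedCubic J n L) (Set.Icc (-(J : ℝ)) (J : ℝ)) χ ∧ t = θs + gridScale n * χ

/-! ### Monte Carlo evaluations of the log-likelihood -/

/-- Convergence in probability to a constant, along a sequence of probability spaces. -/
def TendstoInProb {Ω : ℕ → Type*} [∀ n, MeasurableSpace (Ω n)] (Pr : ∀ n, Measure (Ω n))
    (X : ∀ n, Ω n → ℝ) (c : ℝ) : Prop :=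
  ∀ ε : ℝ, 0 < ε → Tendsto (fun n => Pr n {ω | ε ≤ |X n ω - c|}) atTop (𝓝 0)

section Evaluations

variable {𝒴 : Type*} [MeasurableSpace 𝒴] (M : ParametricModel 𝒴) (J : ℕ) (m : ℕ → ℕ)
  {Ω : ℕ → Type*} [∀ n, MeasurableSpace (Ω n)] (Pr : ∀ n, Measure (Ω n))
  [∀ n, IsProbabilityMeasure (Pr n)] (Y : ∀ n, Ω n → Fin n → 𝒴) (θs : ∀ n, Ω n → ℝ)

/-- The Monte Carlo model for the log-likelihood evaluations `Lbar n j` at `θ*_{j,n}`, with `m n`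
simulations per observation. They are `𝐥(θ*_{j,n}) + γ(θ*_{j,n}) + ε_{j,n}`, where the
`√(m/n) ε_{j,n}` are asymptotically independent over `j` and normal with mean zero and variance
`τ² > 0` (in particular this holds if the `ε_{j,n}` are i.i.d. over `j` and `√(m/n) ε_{j,n}` has
that normal limit), and where
`γ(θ*_{j,n}) = γ(θ*_n) + C (n/m) j n^{-1/4} + o((n/m) n^{-1/4})`. -/
structure MonteCarloModel (Lbar : ∀ n, Fin (2 * J + 1) → Ω n → ℝ) (γ : ℕ → ℝ → ℝ)
    (C τ : ℝ) : Prop where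
  pos : 0 < τ
  noise : TendstoInDistribution
    (fun n ω (j : Fin (2 * J + 1)) => √((m n : ℝ) / n) *
      (Lbar n j ω - M.logLik (Y n ω) (gridPoint J n (θs n ω) j)
        - γ n (gridPoint J n (θs n ω) j)))
    atTop (fun z : Fin (2 * J + 1) → ℝ => z) Pr
    (Measure.pi fun _ : Fin (2 * J + 1) => gaussianReal 0 (Real.toNNReal (τ ^ 2)))
  bias : ∀ j : Fin (2 * J + 1), TendstoInProb Pr
    (fun n ω => (γ n (gridPoint J n (θs n ω) j) - γ n (θs n ω)) /
      ((n : ℝ) / m n * gridScale n))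
    (C * gridIndex J j)

variable (ds : M.Derivs) (θ₀ : ℝ)

/-- The statistical standard error: `SE_stat² = 1 / (n 𝓘(θ₀))`. -/
def seStat (n : ℕ) : ℝ := √(1 / (n * M.fisher ds θ₀))

/-- The Monte Carlo standard error: `SE_MC² = (n/m) τ² (XᵀX)⁻¹₂₂ / (n 𝓘(θ₀))²`, in the
numbering of entries from one. -/
def seMC (τ : ℝ) (n : ℕ) : ℝ :=
  √((n : ℝ) / m n * τ ^ 2 *
    (((designMatrix J n).transpose * designMatrix J n)⁻¹ 1 1) / (n * M.fisher ds θ₀) ^ 2)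

/-- Efficiency of the estimator computed from the evaluations `Lbar`. Here `est` is the maximum
cubic log-likelihood estimator computed from `Lbar`, `estBias` the one computed from the exact
log-likelihood plus the Monte Carlo bias `γ` only, and `estExact` the one computed from the exact
log-likelihood. So `est - estBias` is the error due to Monte Carlo noise, and
`estBias - estExact` is the bias due to Monte Carlo; the maximizers are arbitrary measurable
selections. -/
def IsEfficientMCLE (Lbar : ∀ n, Fin (2 * J + 1) → Ω n → ℝ) (γ : ℕ → ℝ → ℝ) (C τ : ℝ) : Prop :=
  ∀ est estBias estExact : ∀ n, Ω n → ℝ,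
    (∀ n, AEMeasurable (est n) (Pr n)) → (∀ n, AEMeasurable (estBias n) (Pr n)) →
    (∀ n, AEMeasurable (estExact n) (Pr n)) →
    (∀ n ω, IsMCLE J n (θs n ω) (fun j => Lbar n j ω) (est n ω)) →
    (∀ n ω, IsMCLE J n (θs n ω)
      (fun j => M.logLik (Y n ω) (gridPoint J n (θs n ω) j) + γ n (gridPoint J n (θs n ω) j))
      (estBias n ω)) →
    (∀ n ω, IsMCLE J n (θs n ω)
      (fun j => M.logLik (Y n ω) (gridPoint J n (θs n ω) j)) (estExact n ω)) →
    -- the estimator is asymptotically linear in the efficient influence function,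
    TendstoInProb Pr
      (fun (n : ℕ) ω => √(n : ℝ) * (est n ω - θ₀) - M.scoreSum ds θ₀ (Y n ω) / M.fisher ds θ₀) 0 ∧
    -- and asymptotically normal with the inverse Fisher information as its variance;
    TendstoInDistribution (fun (n : ℕ) ω => √(n : ℝ) * (est n ω - θ₀)) atTop (fun z : ℝ => z) Pr
      (gaussianReal 0 (Real.toNNReal (1 / M.fisher ds θ₀))) ∧
    -- `seStat` is the asymptotic standard error without Monte Carlo error;
    TendstoInDistribution (fun n ω => (estExact n ω - θ₀) / seStat M ds θ₀ n) atTop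
      (fun z : ℝ => z) Pr (gaussianReal 0 1) ∧
    -- `seMC` is the asymptotic standard error due to Monte Carlo noise, of squared size
    -- `n^{1/2} / (m n)`;
    TendstoInDistribution (fun n ω => (est n ω - estBias n ω) / seMC M J m ds θ₀ τ n) atTop
      (fun z : ℝ => z) Pr (gaussianReal 0 1) ∧
    (∃ K : ℝ, 0 < K ∧
      Tendsto (fun n : ℕ => (m n * √(n : ℝ)) * seMC M J m ds θ₀ τ n ^ 2) atTop (𝓝 K)) ∧
    -- it is negligible relative to the statistical standard error;
    Tendsto (fun n => seMC M J m ds θ₀ τ n ^ 2 / seStat M ds θ₀ n ^ 2) atTop (𝓝 0) ∧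
    -- the Monte Carlo bias is of order `1 / m` and negligible as well.
    TendstoInProb Pr (fun n ω => m n * (estBias n ω - estExact n ω)) (C / M.fisher ds θ₀) ∧
    TendstoInProb Pr (fun n ω => (estBias n ω - estExact n ω) / seStat M ds θ₀ n) 0

end Evaluations

/-! ### Importance sampling -/

/-- A latent variable representation `p(y; θ) = ∫ p_{Y|X}(y|x; θ) p_X(x; θ) dx` of the model
together with proposal densities `q(·; θ)` for importance sampling. For `θ ∉ Θ` the functions are
arbitrary measurable extensions, with `q(·; θ)` still a probability density so that one can always
simulate. -/
structure ImportanceSampler {𝒴 : Type*} [MeasurableSpace 𝒴] (M : ParametricModel 𝒴)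
    (𝒳 : Type*) [MeasurableSpace 𝒳] where
  lam : Measure 𝒳
  sigmaFinite : SigmaFinite lam
  pYX : ℝ → 𝒳 → 𝒴 → ℝ
  pX : ℝ → 𝒳 → ℝ
  q : ℝ → 𝒳 → ℝ
  measurable_pYX : ∀ θ, Measurable (Function.uncurry (pYX θ))
  measurable_pX : ∀ θ, Measurable (pX θ)
  measurable_q : ∀ θ, Measurable (q θ)
  nonneg_pYX : ∀ θ x y, 0 ≤ pYX θ x y
  nonneg_pX : ∀ θ x, 0 ≤ pX θ x
  nonneg_q : ∀ θ x, 0 ≤ q θ x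
  lintegral_pYX : ∀ θ ∈ M.Θ, ∀ᵐ x ∂lam, 0 < pX θ x → ∫⁻ y, ENNReal.ofReal (pYX θ x y) ∂M.μ = 1
  lintegral_pX : ∀ θ ∈ M.Θ, ∫⁻ x, ENNReal.ofReal (pX θ x) ∂lam = 1
  lintegral_q : ∀ θ, ∫⁻ x, ENNReal.ofReal (q θ x) ∂lam = 1
  marginal : ∀ θ ∈ M.Θ, ∀ᵐ y ∂M.μ,
    ∫⁻ x, ENNReal.ofReal (pYX θ x y * pX θ x) ∂lam = ENNReal.ofReal (M.p θ y)
  support : ∀ θ ∈ M.Θ, ∀ᵐ y ∂M.μ, ∀ᵐ x ∂lam, q θ x = 0 → pYX θ x y * pX θ x = 0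

namespace ImportanceSampler

variable {𝒴 : Type*} [MeasurableSpace 𝒴] {M : ParametricModel 𝒴} {𝒳 : Type*} [MeasurableSpace 𝒳]
  (S : ImportanceSampler M 𝒳)

/-- The proposal distribution with density `q(·; θ)`. -/
def proposal (θ : ℝ) : Measure 𝒳 := S.lam.withDensity fun x => ENNReal.ofReal (S.q θ x)

/-- The importance weight `p_{Y|X}(y|x; θ) p_X(x; θ) / q(x; θ)`. -/
def weight (θ : ℝ) (y : 𝒴) (x : 𝒳) : ℝ := S.pYX θ x y * (S.pX θ x / S.q θ x)

/-- The importance sampling evaluation `p̄(y; θ)` of the density. -/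
def pbar {k : ℕ} (θ : ℝ) (y : 𝒴) (x : Fin k → 𝒳) : ℝ := (1 / (k : ℝ)) * ∑ i, S.weight θ y (x i)

/-- The estimated log-likelihood `∑ᵢ log p̄(Yᵢ; θ)`. -/
def logLikBar {n k : ℕ} (θ : ℝ) (y : Fin n → 𝒴) (x : Fin n → Fin k → 𝒳) : ℝ :=
  ∑ i, Real.log (S.pbar θ (y i) (x i))

/-- For `Y ∼ P_{θ₀}`, the mean over `Y` of the variance of the weight relative to `p(Y; θ)`. -/
def relVar (θ₀ θ : ℝ) : ℝ :=
  ∫ y, variance (fun x => S.weight θ y x / M.p θ y) (S.proposal θ) ∂(M.P θ₀)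

/-- Regularity of the sampler near `θ₀`: the relative weights have locally bounded fourth moment,
and their mean variance is differentiable and does not vanish. -/
structure IsRegularAt (θ₀ : ℝ) : Prop where
  fourth_moment : ∃ B : ℝ≥0, ∀ᶠ θ in 𝓝 θ₀,
    ∫⁻ y, ∫⁻ x, ENNReal.ofReal ((S.weight θ y x / M.p θ y) ^ 4) ∂(S.proposal θ) ∂(M.P θ₀) ≤ B
  differentiableAt_relVar : DifferentiableAt ℝ (S.relVar θ₀) θ₀
  relVar_pos : 0 < S.relVar θ₀ θ₀

/-- The data `Y` have law `law`, and, given the data, the `X j i l` are independent and `X j i l`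
is drawn from the proposal distribution at the grid point `θ*_{j,n}`; here `θ*_n = θs Y`. -/
structure IsMonteCarloDraw (J n k : ℕ) (law : Measure (Fin n → 𝒴)) (θs : (Fin n → 𝒴) → ℝ)
    {Ω : Type*} [MeasurableSpace Ω] (Pr : Measure Ω) (Y : Ω → Fin n → 𝒴)
    (X : Fin (2 * J + 1) → Fin n → Fin k → Ω → 𝒳) : Prop where
  measurable : ∀ j i l, Measurable (X j i l)
  joint : ∀ A : Set (Fin n → 𝒴), MeasurableSet A →
    ∀ B : Fin (2 * J + 1) → Fin n → Fin k → Set 𝒳, (∀ j i l, MeasurableSet (B j i l)) →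
    Pr {ω | Y ω ∈ A ∧ ∀ j i l, X j i l ω ∈ B j i l} =
      ∫⁻ y in A, ∏ j, ∏ i, ∏ l, S.proposal (gridPoint J n (θs y) j) (B j i l) ∂law

end ImportanceSampler

end

/-!
The theorem rests on an expansion of the log-likelihood at the scale `n^{-1/4}` of the grid. With
`h` of that order, a likelihood ratio is `∏ (1 + w)²`, where `w` is the relative increment of the
square root density. Quadratic mean differentiability to second order and the moment assumptions
let one expand `2 log (1 + w)` with an error `o(n^{1/4})` in the sum over the sample:
`𝐥(θ₀ + h) - 𝐥(θ₀) = h ∑ 𝐈₁ - n 𝓘 h² / 2 + n c h³ + o_P(n^{1/4})` for a constant `c`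
(`isLittleOP_logLik_sub_localCubic`). The means of the terms come from the expansion of the squared
Hellinger distance to third order (`hellinger_expansion`), since `∫ s(θ)² dμ = 1` for all `θ`.

In grid units the quadratic term `n^{1/2} 𝓘 x² / 2` dominates. The cubic regression reproduces
cubics and is linear in the evaluations, so that it fits a cubic whose maximizer is near zero and
satisfies the first-order condition. This gives asymptotic linearity in the score
(`HasQuadraticFit.isLittleOP_maximizer_sub`), and shows that a perturbation of the evaluations
moves the maximizer by `n^{-1/2} / 𝓘` times the change of the linear coefficient, up to a
negligible relative error (`HasQuadraticFit.isLittleOP_maximizer_diff`). Under the Monte Carlo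
model the changes are `C n / m n^{-1/4}` from the bias and a normal combination of order
`√(n / m)` from the noise; both are `o(n^{1/4})` since `√n / m → 0`, and part (a) follows
(`MonteCarloModel.isEfficientMCLE`).

The centre of the grid is random, but it takes a bounded number of values in each window of width
of order `n^{-1/2}` around `θ₀`. Hence it is enough to prove asymptotic statements at deterministic
points of the windows (`AsympSure.of_window`). For importance sampling this is combined with the
fact that, on the event that the centre has a given value, the draws are those for a fixed
parameter, independent of the data (`AsympSure.of_draws`).

For part (b), the error of the estimated log-density is `log (1 + w̄)` with `w̄` an average of `m`
conditionally centred relative errors. As fourth moments are bounded, `∑ w̄² / 2` may be replaced by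
its mean `n Ψ / (2 m)`, which is the bias `-γ`, and the rest is the sum of the relative errors, up
to `o(√(n / m))` (`isLittleOP_sum_log`). Given the data, the latter is a sum of independent terms,
and its characteristic function converges to the normal one in probability
(`isLittleOP_conditional_charFun`); integrating over the data gives the joint normal limit at the
points of the grid. Differentiability of `Ψ` at `θ₀` gives the expansion of `γ`. -/

/-! ### Stochastic orders along a family of probability spaces -/

section StochasticOrder

variable {ι : Type*} {Ω : ι → Type*} [∀ i, MeasurableSpace (Ω i)]

/-- The event `p i` has probability tending to one along `l`. No measurability is asked for: the
outer measure of the complement tends to zero. -/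
def AsympSure (l : Filter ι) (Pr : ∀ i, Measure (Ω i)) (p : ∀ i, Ω i → Prop) : Prop :=
  Tendsto (fun i => Pr i {ω | ¬ p i ω}) l (𝓝 0)

/-- `X = o_P(1)` along `l`. -/
def IsLittleOP (l : Filter ι) (Pr : ∀ i, Measure (Ω i)) (X : ∀ i, Ω i → ℝ) : Prop :=
  ∀ ε : ℝ, 0 < ε → Tendsto (fun i => Pr i {ω | ε ≤ |X i ω|}) l (𝓝 0)

/-- `X = O_P(1)` along `l`, i.e. `X` is asymptotically tight. -/
def IsBigOP (l : Filter ι) (Pr : ∀ i, Measure (Ω i)) (X : ∀ i, Ω i → ℝ) : Prop :=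
  ∀ ε : ℝ≥0∞, 0 < ε → ∃ B : ℝ, ∀ᶠ i in l, Pr i {ω | B < |X i ω|} ≤ ε

variable {l : Filter ι} {Pr : ∀ i, Measure (Ω i)} {X Y : ∀ i, Ω i → ℝ} {p q : ∀ i, Ω i → Prop}

theorem AsympSure.mono (hp : AsympSure l Pr p) (h : ∀ᶠ i in l, ∀ ω, p i ω → q i ω) :
    AsympSure l Pr q := by
  refine tendsto_of_tendsto_of_tendsto_of_le_of_le' tendsto_const_nhds hp
    (Eventually.of_forall fun _ => zero_le) ?_
  filter_upwards [h] with i hi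
  exact measure_mono fun ω hω hpω => hω (hi ω hpω)

theorem AsympSure.and (hp : AsympSure l Pr p) (hq : AsympSure l Pr q) :
    AsympSure l Pr fun i ω => p i ω ∧ q i ω := by
  have := hp.add hq
  rw [add_zero] at this
  refine tendsto_of_tendsto_of_tendsto_of_le_of_le tendsto_const_nhds this
    (fun _ => zero_le) fun i => ?_
  refine (measure_mono ?_).trans (measure_union_le _ _)
  intro ω hω
  by_cases h : p i ω
  · exact Or.inr fun h' => hω ⟨h, h'⟩
  · exact Or.inl h

theorem AsympSure.of_forall (h : ∀ᶠ i in l, ∀ ω, p i ω) : AsympSure l Pr p := by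
  refine tendsto_const_nhds.congr' ?_
  filter_upwards [h] with i hi
  simp [hi]

theorem AsympSure.of_ae (h : ∀ᶠ i in l, ∀ᵐ ω ∂Pr i, p i ω) : AsympSure l Pr p := by
  refine tendsto_const_nhds.congr' ?_
  filter_upwards [h] with i hi
  exact (ae_iff.1 hi).symm

theorem isLittleOP_iff :
    IsLittleOP l Pr X ↔ ∀ ε : ℝ, 0 < ε → AsympSure l Pr fun i ω => |X i ω| < ε := by
  simp only [IsLittleOP, AsympSure, not_lt]

theorem IsLittleOP.asympSure_lt (h : IsLittleOP l Pr X) {ε : ℝ} (hε : 0 < ε) :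
    AsympSure l Pr fun i ω => |X i ω| < ε := isLittleOP_iff.1 h ε hε

theorem IsLittleOP.of_abs_le (hY : IsLittleOP l Pr Y)
    (h : AsympSure l Pr fun i ω => |X i ω| ≤ |Y i ω|) : IsLittleOP l Pr X :=
  isLittleOP_iff.2 fun _ hε => (h.and (hY.asympSure_lt hε)).mono
    (Eventually.of_forall fun _ _ hω => hω.1.trans_lt hω.2)

theorem IsLittleOP.congr (hY : IsLittleOP l Pr Y)
    (h : AsympSure l Pr fun i ω => X i ω = Y i ω) : IsLittleOP l Pr X :=
  hY.of_abs_le (h.mono (Eventually.of_forall fun _ _ hω => by rw [hω]))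

theorem IsLittleOP.congr_eq (hY : IsLittleOP l Pr Y) (h : ∀ᶠ i in l, ∀ ω, X i ω = Y i ω) :
    IsLittleOP l Pr X := hY.congr (.of_forall h)

theorem IsBigOP.congr (hY : IsBigOP l Pr Y)
    (h : ∀ᶠ i in l, ∀ ω, X i ω = Y i ω) : IsBigOP l Pr X := by
  intro ε hε
  obtain ⟨B, hB⟩ := hY ε hε
  refine ⟨B, ?_⟩
  filter_upwards [hB, h] with i hi hX
  simpa only [hX] using hi

theorem IsLittleOP.add (hX : IsLittleOP l Pr X) (hY : IsLittleOP l Pr Y) :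
    IsLittleOP l Pr fun i ω => X i ω + Y i ω :=
  isLittleOP_iff.2 fun _ hε =>
    ((hX.asympSure_lt (half_pos hε)).and (hY.asympSure_lt (half_pos hε))).mono
      (Eventually.of_forall fun i ω hω =>
        (abs_add_le _ _).trans_lt (by linarith [hω.1, hω.2]))

theorem IsLittleOP.neg (hX : IsLittleOP l Pr X) : IsLittleOP l Pr fun i ω => -X i ω := by
  intro ε hε
  simpa only [abs_neg] using hX ε hε

theorem IsLittleOP.sub (hX : IsLittleOP l Pr X) (hY : IsLittleOP l Pr Y) :
    IsLittleOP l Pr fun i ω => X i ω - Y i ω := by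
  simpa only [sub_eq_add_neg] using hX.add hY.neg

theorem isLittleOP_of_tendsto {c : ι → ℝ} (h : Tendsto c l (𝓝 0)) :
    IsLittleOP l Pr fun i _ => c i :=
  isLittleOP_iff.2 fun ε hε => .of_forall <| by
    filter_upwards [h (Metric.ball_mem_nhds 0 hε)] with i hi _
    simpa [Real.dist_eq] using hi

theorem isBigOP_of_bounded {c : ι → ℝ} {K : ℝ} (h : ∀ᶠ i in l, |c i| ≤ K) :
    IsBigOP l Pr fun i _ => c i := by
  intro ε _
  refine ⟨K, ?_⟩
  filter_upwards [h] with i hi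
  simp [not_lt.2 hi]

theorem isBigOP_const (c : ℝ) : IsBigOP l Pr fun _ _ => c :=
  isBigOP_of_bounded (Eventually.of_forall fun _ => le_rfl)

theorem IsLittleOP.isBigOP (hX : IsLittleOP l Pr X) : IsBigOP l Pr X := by
  intro ε hε
  refine ⟨1, ?_⟩
  filter_upwards [ENNReal.tendsto_nhds_zero.1 (hX 1 one_pos) ε hε] with i hi
  exact (measure_mono fun ω (hω : 1 < |X i ω|) => hω.le).trans hi

theorem IsBigOP.add (hX : IsBigOP l Pr X) (hY : IsBigOP l Pr Y) :
    IsBigOP l Pr fun i ω => X i ω + Y i ω := by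
  intro ε hε
  obtain ⟨A, hA⟩ := hX (ε / 2) (ENNReal.half_pos hε.ne')
  obtain ⟨B, hB⟩ := hY (ε / 2) (ENNReal.half_pos hε.ne')
  refine ⟨A + B, ?_⟩
  filter_upwards [hA, hB] with i hAi hBi
  calc Pr i {ω | A + B < |X i ω + Y i ω|}
      ≤ Pr i ({ω | A < |X i ω|} ∪ {ω | B < |Y i ω|}) := by
        refine measure_mono fun ω (hω : A + B < _) => ?_
        by_contra hcon
        simp only [Set.mem_union, Set.mem_ofPred_eq, not_or, not_lt] at hcon
        linarith [abs_add_le (X i ω) (Y i ω)]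
    _ ≤ ε / 2 + ε / 2 := (measure_union_le _ _).trans (add_le_add hAi hBi)
    _ = ε := ENNReal.add_halves ε

theorem IsBigOP.neg (hX : IsBigOP l Pr X) : IsBigOP l Pr fun i ω => -X i ω := by
  intro ε hε
  simpa only [abs_neg] using hX ε hε

theorem IsBigOP.sub (hX : IsBigOP l Pr X) (hY : IsBigOP l Pr Y) :
    IsBigOP l Pr fun i ω => X i ω - Y i ω := by
  simpa only [sub_eq_add_neg] using hX.add hY.neg

theorem IsBigOP.mul (hX : IsBigOP l Pr X) (hY : IsBigOP l Pr Y) :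
    IsBigOP l Pr fun i ω => X i ω * Y i ω := by
  intro ε hε
  obtain ⟨A, hA⟩ := hX (ε / 2) (ENNReal.half_pos hε.ne')
  obtain ⟨B, hB⟩ := hY (ε / 2) (ENNReal.half_pos hε.ne')
  refine ⟨|A| * |B|, ?_⟩
  filter_upwards [hA, hB] with i hAi hBi
  calc Pr i {ω | |A| * |B| < |X i ω * Y i ω|}
      ≤ Pr i ({ω | A < |X i ω|} ∪ {ω | B < |Y i ω|}) := by
        refine measure_mono fun ω (hω : |A| * |B| < _) => ?_
        by_contra hcon
        simp only [Set.mem_union, Set.mem_ofPred_eq, not_or, not_lt] at hcon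
        rw [abs_mul] at hω
        exact hω.not_ge (mul_le_mul (hcon.1.trans (le_abs_self A))
          (hcon.2.trans (le_abs_self B)) (abs_nonneg _) (abs_nonneg _))
    _ ≤ ε / 2 + ε / 2 := (measure_union_le _ _).trans (add_le_add hAi hBi)
    _ = ε := ENNReal.add_halves ε

theorem IsLittleOP.mul_isBigOP (hX : IsLittleOP l Pr X) (hY : IsBigOP l Pr Y) :
    IsLittleOP l Pr fun i ω => X i ω * Y i ω := by
  intro ε hε
  refine ENNReal.tendsto_nhds_zero.2 fun η hη => ?_
  obtain ⟨B, hB⟩ := hY (η / 2) (ENNReal.half_pos hη.ne')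
  have hB' : 0 < |B| + 1 := by positivity
  filter_upwards [hB, ENNReal.tendsto_nhds_zero.1 (hX (ε / (|B| + 1)) (by positivity)) (η / 2)
    (ENNReal.half_pos hη.ne')] with i hBi hXi
  calc Pr i {ω | ε ≤ |X i ω * Y i ω|}
      ≤ Pr i ({ω | ε / (|B| + 1) ≤ |X i ω|} ∪ {ω | B < |Y i ω|}) := by
        refine measure_mono fun ω (hω : ε ≤ _) => ?_
        by_contra hcon
        simp only [Set.mem_union, Set.mem_ofPred_eq, not_or, not_lt, not_le] at hcon
        rw [abs_mul] at hω
        have h1 : |X i ω| * |Y i ω| ≤ |X i ω| * (|B| + 1) :=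
          mul_le_mul_of_nonneg_left (hcon.2.trans ((le_abs_self B).trans (by linarith)))
            (abs_nonneg _)
        have h2 := (lt_div_iff₀ hB').1 hcon.1
        linarith
    _ ≤ η / 2 + η / 2 := (measure_union_le _ _).trans (add_le_add hXi hBi)
    _ = η := ENNReal.add_halves η

theorem IsBigOP.mul_isLittleOP (hX : IsBigOP l Pr X) (hY : IsLittleOP l Pr Y) :
    IsLittleOP l Pr fun i ω => X i ω * Y i ω := by
  simpa only [mul_comm] using hY.mul_isBigOP hX

theorem IsLittleOP.const_mul (hX : IsLittleOP l Pr X) (c : ℝ) :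
    IsLittleOP l Pr fun i ω => c * X i ω := (isBigOP_const c).mul_isLittleOP hX

theorem IsBigOP.const_mul (hX : IsBigOP l Pr X) (c : ℝ) :
    IsBigOP l Pr fun i ω => c * X i ω := (isBigOP_const c).mul hX

theorem IsLittleOP.sum {κ : Type*} (s : Finset κ) {X : κ → ∀ i, Ω i → ℝ}
    (h : ∀ k ∈ s, IsLittleOP l Pr (X k)) : IsLittleOP l Pr fun i ω => ∑ k ∈ s, X k i ω := by
  classical
  induction s using Finset.induction_on with
  | empty => simpa using isLittleOP_of_tendsto (c := fun _ : ι => 0) tendsto_const_nhds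
  | insert k s hk ih =>
    simp only [Finset.sum_insert hk]
    exact (h k (by simp)).add (ih fun j hj => h j (by simp [hj]))

theorem IsLittleOP.inv {c : ℝ} (hc : c ≠ 0) (hX : IsLittleOP l Pr fun i ω => X i ω - c) :
    IsLittleOP l Pr fun i ω => (X i ω)⁻¹ - c⁻¹ := by
  have hc' : 0 < |c| := abs_pos.2 hc
  refine (hX.const_mul (2 / c ^ 2)).of_abs_le ((hX.asympSure_lt (half_pos hc')).mono
    (Eventually.of_forall fun i ω hω => ?_))
  have h1 : |c| / 2 ≤ |X i ω| := by
    have := abs_sub_abs_le_abs_sub c (X i ω)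
    rw [abs_sub_comm] at this
    linarith
  have h2 : X i ω ≠ 0 := abs_pos.1 (lt_of_lt_of_le (half_pos hc') h1)
  have h3 : |2 / c ^ 2| = 2 / |c| ^ 2 := by rw [abs_div, abs_pow, abs_two]
  rw [inv_sub_inv h2 hc, abs_div, abs_mul, abs_mul, h3, abs_sub_comm, div_mul_eq_mul_div,
    div_le_div_iff₀ (by positivity) (by positivity)]
  have h4 := mul_le_mul_of_nonneg_left h1 (mul_nonneg (abs_nonneg (X i ω - c)) hc'.le)
  nlinarith

/-- Stochastic orders are properties of the laws: they may be checked on the image space. -/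
theorem AsympSure.comp {Ω' : ι → Type*} [∀ i, MeasurableSpace (Ω' i)] {T : ∀ i, Ω' i → Ω i}
    {Pr' : ∀ i, Measure (Ω' i)} (hp : AsympSure l Pr p) (hT : ∀ i, Measurable (T i))
    (hlaw : ∀ i, (Pr' i).map (T i) = Pr i) : AsympSure l Pr' fun i ω => p i (T i ω) := by
  refine tendsto_of_tendsto_of_tendsto_of_le_of_le tendsto_const_nhds hp
    (fun _ => zero_le) fun i => ?_
  simp only [← hlaw i]
  exact Measure.le_map_apply (hT i).aemeasurable _

theorem IsBigOP.comp {Ω' : ι → Type*} [∀ i, MeasurableSpace (Ω' i)] {T : ∀ i, Ω' i → Ω i}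
    {Pr' : ∀ i, Measure (Ω' i)} (hX : IsBigOP l Pr X) (hT : ∀ i, Measurable (T i))
    (hlaw : ∀ i, (Pr' i).map (T i) = Pr i) : IsBigOP l Pr' fun i ω => X i (T i ω) := by
  intro ε hε
  obtain ⟨B, hB⟩ := hX ε hε
  refine ⟨B, ?_⟩
  filter_upwards [hB] with i hi
  rw [← hlaw i] at hi
  exact (Measure.le_map_apply (hT i).aemeasurable {ω | B < |X i ω|}).trans hi

/-- Markov's inequality, in the form used throughout. -/
theorem isLittleOP_of_lintegral (hX : ∀ i, AEMeasurable (X i) (Pr i))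
    (h : Tendsto (fun i => ∫⁻ ω, ENNReal.ofReal |X i ω| ∂Pr i) l (𝓝 0)) :
    IsLittleOP l Pr X := by
  intro ε hε
  have hε' : ENNReal.ofReal ε ≠ 0 := by simpa using hε
  have h2 := ENNReal.Tendsto.div_const h (b := ENNReal.ofReal ε) (Or.inr hε')
  rw [ENNReal.zero_div] at h2
  refine tendsto_of_tendsto_of_tendsto_of_le_of_le tendsto_const_nhds h2
    (fun _ => zero_le) fun i => ?_
  refine le_trans (measure_mono ?_)
    (meas_ge_le_lintegral_div (f := fun ω => ENNReal.ofReal |X i ω|) ?_ hε' ENNReal.ofReal_ne_top)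
  · intro ω hω
    exact ENNReal.ofReal_le_ofReal hω
  · exact (hX i).abs.ennreal_ofReal

end StochasticOrder

/-! ### Weak convergence to normal laws along varying probability spaces -/

section WeakConvergence

variable {Ω : ℕ → Type*} [∀ n, MeasurableSpace (Ω n)] {Pr : ∀ n, Measure (Ω n)}
  [∀ n, IsProbabilityMeasure (Pr n)]

/-- Bounded convergence for convergence in probability. -/
theorem tendsto_integral_zero_of_isLittleOP {D : ∀ n, Ω n → ℂ} {K : ℝ} (hK : ∀ n ω, ‖D n ω‖ ≤ K)
    (hD : IsLittleOP atTop Pr fun n ω => ‖D n ω‖) :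
    Tendsto (fun n => ∫ ω, D n ω ∂Pr n) atTop (𝓝 0) := by
  rw [tendsto_zero_iff_norm_tendsto_zero]
  have hb : ∀ n, ∀ ε : ℝ, 0 < ε → ENNReal.ofReal ‖∫ ω, D n ω ∂Pr n‖ ≤
      ENNReal.ofReal ε + ENNReal.ofReal K * Pr n {ω | ε ≤ |‖D n ω‖|} := by
    intro n ε hε
    rw [ofReal_norm]
    refine (enorm_integral_le_lintegral_enorm _).trans ?_
    set T := toMeasurable (Pr n) {ω | ε ≤ |‖D n ω‖|}
    calc ∫⁻ ω, ‖D n ω‖ₑ ∂Pr n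
        ≤ ∫⁻ ω, (ENNReal.ofReal ε + T.indicator (fun _ => ENNReal.ofReal K) ω) ∂Pr n := by
          refine lintegral_mono fun ω => ?_
          rw [← ofReal_norm]
          by_cases hω : ε ≤ |‖D n ω‖|
          · rw [Set.indicator_of_mem (show ω ∈ T from subset_toMeasurable _ _ hω)]
            exact (ENNReal.ofReal_le_ofReal (hK n ω)).trans le_add_self
          · rw [abs_norm] at hω
            exact (ENNReal.ofReal_le_ofReal (not_le.1 hω).le).trans le_self_add
      _ = _ := by
          rw [lintegral_add_left measurable_const, lintegral_const, measure_univ, mul_one,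
            lintegral_indicator_const (measurableSet_toMeasurable _ _), measure_toMeasurable]
  refine (ENNReal.tendsto_toReal_zero_iff (f := fun n => ENNReal.ofReal ‖∫ ω, D n ω ∂Pr n‖)
    fun n => ENNReal.ofReal_ne_top).2 ?_ |>.congr fun n => ENNReal.toReal_ofReal (norm_nonneg _)
  refine ENNReal.tendsto_nhds_zero.2 fun η hη => ?_
  obtain ⟨ε, hε, hεη⟩ : ∃ ε : ℝ, 0 < ε ∧ ENNReal.ofReal ε ≤ η / 2 := by
    rcases eq_or_ne η ⊤ with rfl | htop
    · exact ⟨1, one_pos, by simp [ENNReal.top_div_of_ne_top]⟩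
    · refine ⟨(η / 2).toReal, ENNReal.toReal_pos (ENNReal.half_pos hη.ne').ne'
        (ENNReal.div_ne_top htop two_ne_zero), ?_⟩
      rw [ENNReal.ofReal_toReal (ENNReal.div_ne_top htop two_ne_zero)]
  have h2 := ENNReal.Tendsto.const_mul (hD ε hε) (a := ENNReal.ofReal K)
    (Or.inr ENNReal.ofReal_ne_top)
  rw [mul_zero] at h2
  filter_upwards [ENNReal.tendsto_nhds_zero.1 h2 (η / 2) (ENNReal.half_pos hη.ne')] with n hn
  calc _ ≤ η / 2 + η / 2 := (hb n ε hε).trans (add_le_add hεη hn)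
    _ = η := ENNReal.add_halves η

/-- Lévy's theorem for random vectors with a limit of i.i.d. centred normal coordinates. -/
theorem tendstoInDistribution_pi_gaussian_iff {κ : Type*} [Fintype κ] {X : ∀ n, Ω n → κ → ℝ}
    (hX : ∀ n, AEMeasurable (X n) (Pr n)) (v : ℝ≥0) :
    TendstoInDistribution X atTop (fun z : κ → ℝ => z) Pr
        (Measure.pi fun _ : κ => gaussianReal 0 v) ↔
      ∀ u : κ → ℝ, Tendsto (fun n => ∫ ω, Complex.exp ((∑ j, u j * X n ω j : ℝ) * Complex.I) ∂Pr n)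
        atTop (𝓝 (Complex.exp (-(v * ∑ j, u j ^ 2 / 2 : ℝ)))) := by
  have hc : Continuous (WithLp.toLp 2 : (κ → ℝ) → EuclideanSpace ℝ κ) :=
    PiLp.continuous_toLp 2 _
  have hd : Continuous (WithLp.ofLp : EuclideanSpace ℝ κ → (κ → ℝ)) :=
    PiLp.continuous_ofLp 2 _
  have hXt : ∀ n, AEMeasurable (fun ω => WithLp.toLp 2 (X n ω)) (Pr n) :=
    fun n => hc.measurable.comp_aemeasurable (hX n)
  have hlim : ∀ t : EuclideanSpace ℝ κ,
      charFun ((Measure.pi fun _ : κ => gaussianReal 0 v).map (WithLp.toLp 2)) t =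
        Complex.exp (-(v * ∑ j, t j ^ 2 / 2 : ℝ)) := by
    intro t
    rw [charFun_pi]
    simp only [charFun_gaussianReal]
    rw [← Complex.exp_sum]
    congr 1
    push_cast
    rw [Finset.mul_sum, ← Finset.sum_neg_distrib]
    refine Finset.sum_congr rfl fun j _ => ?_
    simp
    ring
  have hpre : ∀ n (t : EuclideanSpace ℝ κ),
      charFun ((Pr n).map fun ω => WithLp.toLp 2 (X n ω)) t =
        ∫ ω, Complex.exp ((∑ j, t j * X n ω j : ℝ) * Complex.I) ∂Pr n := by
    intro n t
    rw [charFun_apply, integral_map (hXt n) (by fun_prop)]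
    simp [PiLp.inner_apply]
  have hmain : TendstoInDistribution (fun n ω => WithLp.toLp 2 (X n ω)) atTop
      (fun z : κ → ℝ => (WithLp.toLp 2 z : EuclideanSpace ℝ κ)) Pr
        (Measure.pi fun _ : κ => gaussianReal 0 v) ↔
      ∀ u : κ → ℝ, Tendsto (fun n => ∫ ω, Complex.exp ((∑ j, u j * X n ω j : ℝ) * Complex.I) ∂Pr n)
        atTop (𝓝 (Complex.exp (-(v * ∑ j, u j ^ 2 / 2 : ℝ)))) := by
    constructor
    · intro h u
      have := ProbabilityMeasure.tendsto_iff_tendsto_charFun.1 h.tendsto (WithLp.toLp 2 u)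
      simp only [ProbabilityMeasure.coe_mk] at this
      rw [hlim] at this
      simpa only [hpre] using this
    · intro h
      refine ⟨hXt, hc.measurable.aemeasurable,
        ProbabilityMeasure.tendsto_iff_tendsto_charFun.2 fun t => ?_⟩
      simp only [ProbabilityMeasure.coe_mk]
      rw [hlim]
      simpa only [hpre] using h (fun j => t j)
  rw [← hmain]
  exact ⟨fun h => h.continuous_comp hc, fun h => h.continuous_comp hd⟩

theorem tendstoInDistribution_gaussian_iff {X : ∀ n, Ω n → ℝ}
    (hX : ∀ n, AEMeasurable (X n) (Pr n)) (v : ℝ≥0) :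
    TendstoInDistribution X atTop (fun z : ℝ => z) Pr (gaussianReal 0 v) ↔
      ∀ t : ℝ, Tendsto (fun n => ∫ ω, Complex.exp ((t * X n ω : ℝ) * Complex.I) ∂Pr n)
        atTop (𝓝 (Complex.exp (-(v * (t ^ 2 / 2) : ℝ)))) := by
  have hlim : ∀ t : ℝ, charFun ((gaussianReal 0 v).map fun z : ℝ => z) t =
      Complex.exp (-(v * (t ^ 2 / 2) : ℝ)) := by
    intro t
    rw [Measure.map_id', charFun_gaussianReal]
    congr 1
    push_cast
    ring
  have hpre : ∀ n (t : ℝ), charFun ((Pr n).map (X n)) t =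
      ∫ ω, Complex.exp ((t * X n ω : ℝ) * Complex.I) ∂Pr n := by
    intro n t
    rw [charFun_apply_real, integral_map (hX n) (by fun_prop)]
    simp
  constructor
  · intro h t
    have := ProbabilityMeasure.tendsto_iff_tendsto_charFun.1 h.tendsto t
    simp only [ProbabilityMeasure.coe_mk] at this
    rw [hlim] at this
    simpa only [hpre] using this
  · intro h
    refine ⟨hX, aemeasurable_id, ProbabilityMeasure.tendsto_iff_tendsto_charFun.2 fun t => ?_⟩
    simp only [ProbabilityMeasure.coe_mk]
    rw [hlim]
    simpa only [hpre] using h t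

theorem norm_exp_mul_I_sub_le (x y : ℝ) :
    ‖Complex.exp (x * Complex.I) - Complex.exp (y * Complex.I)‖ ≤ |x - y| := by
  have h : Complex.exp (x * Complex.I) - Complex.exp (y * Complex.I) =
      Complex.exp (y * Complex.I) * (Complex.exp (Complex.I * (x - y : ℝ)) - 1) := by
    rw [mul_sub, ← Complex.exp_add]
    push_cast
    ring_nf
  rw [h, norm_mul, Complex.norm_exp_ofReal_mul_I, one_mul]
  exact Real.norm_exp_I_mul_ofReal_sub_one_le

/-- Characteristic functions do not see perturbations that vanish in probability. -/
theorem tendsto_integral_exp_congr {X Y : ∀ n, Ω n → ℝ}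
    (hX : ∀ n, AEMeasurable (X n) (Pr n)) (hY : ∀ n, AEMeasurable (Y n) (Pr n))
    (hXY : IsLittleOP atTop Pr fun n ω => Y n ω - X n ω) {c : ℂ}
    (h : Tendsto (fun n => ∫ ω, Complex.exp ((X n ω : ℝ) * Complex.I) ∂Pr n) atTop (𝓝 c)) :
    Tendsto (fun n => ∫ ω, Complex.exp ((Y n ω : ℝ) * Complex.I) ∂Pr n) atTop (𝓝 c) := by
  have hint : ∀ {Z : ∀ n, Ω n → ℝ}, (∀ n, AEMeasurable (Z n) (Pr n)) → ∀ n,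
      Integrable (fun ω => Complex.exp ((Z n ω : ℝ) * Complex.I)) (Pr n) := by
    intro Z hZ n
    refine Integrable.of_bound (C := 1) ?_ (Eventually.of_forall fun ω => ?_)
    · have : Continuous fun x : ℝ => Complex.exp (x * Complex.I) := by fun_prop
      exact (this.measurable.comp_aemeasurable (hZ n)).aestronglyMeasurable
    · rw [Complex.norm_exp_ofReal_mul_I]
  have hD := tendsto_integral_zero_of_isLittleOP (Pr := Pr) (K := 2)
    (D := fun n ω => Complex.exp ((Y n ω : ℝ) * Complex.I) - Complex.exp ((X n ω : ℝ) * Complex.I))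
    (fun n ω => (norm_sub_le _ _).trans (by
      rw [Complex.norm_exp_ofReal_mul_I, Complex.norm_exp_ofReal_mul_I]; norm_num))
    (hXY.of_abs_le (AsympSure.of_forall (Eventually.of_forall fun n ω => by
      rw [abs_norm]; exact norm_exp_mul_I_sub_le _ _)))
  have := hD.add h
  rw [zero_add] at this
  refine this.congr fun n => ?_
  rw [integral_sub (hint hY n) (hint hX n), sub_add_cancel]

/-- Slutsky's lemma on varying probability spaces. -/
theorem tendstoInDistribution_gaussian_of_sub {X Y : ∀ n, Ω n → ℝ} {v : ℝ≥0}
    (hX : TendstoInDistribution X atTop (fun z : ℝ => z) Pr (gaussianReal 0 v))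
    (hY : ∀ n, AEMeasurable (Y n) (Pr n)) (hXY : IsLittleOP atTop Pr fun n ω => Y n ω - X n ω) :
    TendstoInDistribution Y atTop (fun z : ℝ => z) Pr (gaussianReal 0 v) := by
  refine (tendstoInDistribution_gaussian_iff hY v).2 fun t => ?_
  refine tendsto_integral_exp_congr (X := fun n ω => t * X n ω)
    (fun n => (hX.forall_aemeasurable n).const_mul t) (fun n => (hY n).const_mul t) ?_
    ((tendstoInDistribution_gaussian_iff hX.forall_aemeasurable v).1 hX t)
  simpa only [mul_sub] using hXY.const_mul t

theorem TendstoInDistribution.linearCombination_gaussian {κ : Type*} [Fintype κ]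
    {X : ∀ n, Ω n → κ → ℝ} {v : ℝ≥0}
    (hX : TendstoInDistribution X atTop (fun z : κ → ℝ => z) Pr
      (Measure.pi fun _ : κ => gaussianReal 0 v)) (a : κ → ℝ) {w : ℝ≥0}
    (hw : (w : ℝ) = v * ∑ j, a j ^ 2) :
    TendstoInDistribution (fun n ω => ∑ j, a j * X n ω j) atTop (fun z : ℝ => z) Pr
      (gaussianReal 0 w) := by
  have hm : ∀ n, AEMeasurable (fun ω => ∑ j, a j * X n ω j) (Pr n) := by
    intro n
    have : Measurable fun z : κ → ℝ => ∑ j, a j * z j := by fun_prop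
    exact this.comp_aemeasurable (hX.forall_aemeasurable n)
  refine (tendstoInDistribution_gaussian_iff hm w).2 fun t => ?_
  have h := (tendstoInDistribution_pi_gaussian_iff hX.forall_aemeasurable v).1 hX fun j => t * a j
  have e1 : ∀ n ω, t * ∑ j, a j * X n ω j = ∑ j, t * a j * X n ω j := by
    intro n ω
    rw [Finset.mul_sum]
    exact Finset.sum_congr rfl fun j _ => by ring
  have e2 : (w : ℝ) * (t ^ 2 / 2) = v * ∑ j, (t * a j) ^ 2 / 2 := by
    rw [hw, mul_assoc, Finset.sum_mul]
    congr 1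
    exact Finset.sum_congr rfl fun j _ => by ring
  simp only [e1, e2]
  exact h

/-- Weak convergence implies tightness. -/
theorem TendstoInDistribution.isBigOP {X : ∀ n, Ω n → ℝ} {v : ℝ≥0}
    (hX : TendstoInDistribution X atTop (fun z : ℝ => z) Pr (gaussianReal 0 v)) :
    IsBigOP atTop Pr X := by
  intro ε hε
  have hcl : ∀ k : ℕ, IsClosed {x : ℝ | (k : ℝ) ≤ |x|} := fun k =>
    isClosed_le continuous_const continuous_abs
  have hanti : Tendsto (fun k : ℕ => (gaussianReal 0 v) {x : ℝ | (k : ℝ) ≤ |x|}) atTop (𝓝 0) := by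
    have h0 : ⋂ k : ℕ, {x : ℝ | (k : ℝ) ≤ |x|} = ∅ := by
      refine Set.eq_empty_of_forall_notMem fun x hx => ?_
      obtain ⟨k, hk⟩ := exists_nat_gt |x|
      exact (Set.mem_iInter.1 hx k).not_gt hk
    have := tendsto_measure_iInter_atTop (μ := gaussianReal 0 v)
      (fun k => (hcl k).measurableSet.nullMeasurableSet)
      (fun i j hij x (hx : (j : ℝ) ≤ |x|) => show (i : ℝ) ≤ |x| from
        (Nat.cast_le.2 hij).trans hx) ⟨0, measure_ne_top _ _⟩
    rwa [h0, measure_empty] at this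
  obtain ⟨k, hk⟩ := (hanti.eventually (gt_mem_nhds hε)).exists
  refine ⟨k, ?_⟩
  have hlim := ProbabilityMeasure.limsup_measure_closed_le_of_tendsto hX.tendsto (hcl k)
  simp only [ProbabilityMeasure.coe_mk] at hlim
  rw [Measure.map_id'] at hlim
  filter_upwards [eventually_lt_of_limsup_lt (hlim.trans_lt hk)] with n hn
  rw [Measure.map_apply_of_aemeasurable (hX.forall_aemeasurable n) (hcl k).measurableSet] at hn
  exact (measure_mono fun ω (hω : (k : ℝ) < |X n ω|) => hω.le).trans hn.le

end WeakConvergence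

/-! ### The cubic regression in grid units -/

section CubicFit

/-- The design matrix of the cubic regression in grid units: its rows are `(1, j, j², j³)`. -/
def indexDesign (J : ℕ) : Matrix (Fin (2 * J + 1)) (Fin 4) ℝ :=
  fun j k => gridIndex J j ^ (k : ℕ)

/-- The least-squares weights in grid units, which do not depend on the sample size. -/
noncomputable def lsWeight (J : ℕ) : Matrix (Fin 4) (Fin (2 * J + 1)) ℝ :=
  ((indexDesign J).transpose * indexDesign J)⁻¹ * (indexDesign J).transpose

/-- The fitted coefficients in grid units: those of `χ, χ², χ³` in `fittedCubic`. -/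
noncomputable def unitCoeff (J : ℕ) (L : Fin (2 * J + 1) → ℝ) (k : Fin 4) : ℝ :=
  ∑ j, lsWeight J k j * L j

theorem gridScale_pos {n : ℕ} (hn : 0 < n) : 0 < gridScale n :=
  Real.rpow_pos_of_pos (by exact_mod_cast hn) _

theorem gridScale_sq (n : ℕ) : gridScale n ^ 2 = (√(n : ℝ))⁻¹ := by
  rw [gridScale, ← Real.rpow_natCast, ← Real.rpow_mul (Nat.cast_nonneg n), Real.sqrt_eq_rpow,
    ← Real.rpow_neg (Nat.cast_nonneg n)]
  norm_num

theorem designMatrix_eq (J n : ℕ) : designMatrix J n =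
    indexDesign J * Matrix.diagonal fun k : Fin 4 => gridScale n ^ (k : ℕ) := by
  ext j k
  rw [Matrix.mul_diagonal, designMatrix, indexDesign, mul_pow]

theorem gridIndex_injective (J : ℕ) : Function.Injective (gridIndex J) := by
  intro i j h
  simpa [gridIndex, Fin.ext_iff] using h

theorem indexDesign_mulVec_injective {J : ℕ} (hJ : 1 < J) :
    Function.Injective (indexDesign J).mulVec := by
  -- a cubic polynomial that vanishes at the `2 J + 1 ≥ 5` grid indices is zero
  refine (injective_iff_map_eq_zero (Matrix.mulVecLin (indexDesign J))).2 fun v hv => ?_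
  set p : Polynomial ℝ := ∑ k : Fin 4, Polynomial.C (v k) * Polynomial.X ^ (k : ℕ) with hp
  have hdeg : p.natDegree < Fintype.card (Fin (2 * J + 1)) := by
    rw [Fintype.card_fin]
    refine lt_of_le_of_lt (Polynomial.natDegree_sum_le_of_forall_le (n := 3) _ _ fun k _ => ?_)
      (by omega)
    exact (Polynomial.natDegree_C_mul_X_pow_le _ _).trans (by omega)
  have heval : ∀ j, p.eval (gridIndex J j) = 0 := by
    intro j
    have := congrFun hv j
    simp only [Matrix.mulVecLin_apply, Matrix.mulVec, dotProduct, indexDesign,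
      Pi.zero_apply] at this
    rw [hp, Polynomial.eval_finsetSum, ← this]
    refine Finset.sum_congr rfl fun k _ => ?_
    rw [Polynomial.eval_mul, Polynomial.eval_C, Polynomial.eval_pow, Polynomial.eval_X, mul_comm]
  have h0 := Polynomial.eq_zero_of_natDegree_lt_card_of_eval_eq_zero p (gridIndex_injective J)
    heval hdeg
  funext k
  have hk := congrArg (fun q => Polynomial.coeff q (k : ℕ)) h0
  simp only [hp, Polynomial.finsetSum_coeff, Polynomial.coeff_C_mul, Polynomial.coeff_X_pow,
    Polynomial.coeff_zero] at hk
  rw [Finset.sum_eq_single k] at hk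
  · simpa using hk
  · intro b _ hb
    rw [if_neg (fun h => hb (Fin.ext h.symm)), mul_zero]
  · simp

theorem posDef_gram {J : ℕ} (hJ : 1 < J) :
    ((indexDesign J).transpose * indexDesign J).PosDef := by
  have := Matrix.PosDef.conjTranspose_mul_self (indexDesign J) (indexDesign_mulVec_injective hJ)
  rwa [Matrix.conjTranspose_eq_transpose_of_trivial] at this

theorem lsWeight_mul_indexDesign {J : ℕ} (hJ : 1 < J) : lsWeight J * indexDesign J = 1 := by
  rw [lsWeight, Matrix.mul_assoc]
  exact Matrix.nonsing_inv_mul _ ((Matrix.isUnit_iff_isUnit_det _).1 (posDef_gram hJ).isUnit)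

/-- Least squares recovers the coefficients of a cubic. -/
theorem sum_lsWeight_mul_pow {J : ℕ} (hJ : 1 < J) (k l : Fin 4) :
    ∑ j, lsWeight J k j * gridIndex J j ^ (l : ℕ) = if k = l then 1 else 0 := by
  have := congrFun (congrFun (lsWeight_mul_indexDesign hJ) k) l
  rwa [Matrix.mul_apply, Matrix.one_apply] at this

/-- The variance factor `[(XᵀX)⁻¹]₂₂` in grid units. -/
noncomputable def unitVar (J : ℕ) : ℝ := ((indexDesign J).transpose * indexDesign J)⁻¹ 1 1

theorem unitVar_pos {J : ℕ} (hJ : 1 < J) : 0 < unitVar J := (posDef_gram hJ).inv.diag_pos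

/-- The weights of the linear coefficient have sum of squares `[(XᵀX)⁻¹]₂₂`, in grid units. -/
theorem sum_lsWeight_sq {J : ℕ} (hJ : 1 < J) : ∑ j, lsWeight J 1 j ^ 2 = unitVar J := by
  have h : lsWeight J * (lsWeight J).transpose =
      ((indexDesign J).transpose * indexDesign J)⁻¹ := by
    conv_lhs => rw [lsWeight, Matrix.transpose_mul, Matrix.transpose_transpose]
    rw [← Matrix.mul_assoc, Matrix.mul_assoc _ _ (indexDesign J),
      Matrix.nonsing_inv_mul _ ((Matrix.isUnit_iff_isUnit_det _).1 (posDef_gram hJ).isUnit),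
      Matrix.one_mul, Matrix.transpose_nonsing_inv, Matrix.transpose_mul,
      Matrix.transpose_transpose]
  rw [unitVar, ← h, Matrix.mul_apply]
  exact Finset.sum_congr rfl fun j _ => by rw [Matrix.transpose_apply, sq]

theorem inv_diagonal_gridScale {n : ℕ} (hn : 0 < n) :
    (Matrix.diagonal fun k : Fin 4 => gridScale n ^ (k : ℕ))⁻¹ =
      Matrix.diagonal fun k : Fin 4 => (gridScale n ^ (k : ℕ))⁻¹ := by
  refine Matrix.inv_eq_left_inv ?_
  rw [Matrix.diagonal_mul_diagonal, ← Matrix.diagonal_one]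
  congr 1
  funext k
  exact inv_mul_cancel₀ (pow_pos (gridScale_pos hn) _).ne'

theorem inv_gram_designMatrix (J : ℕ) {n : ℕ} (hn : 0 < n) :
    ((designMatrix J n).transpose * designMatrix J n)⁻¹ =
      (Matrix.diagonal fun k : Fin 4 => (gridScale n ^ (k : ℕ))⁻¹) *
        (((indexDesign J).transpose * indexDesign J)⁻¹ *
          Matrix.diagonal fun k : Fin 4 => (gridScale n ^ (k : ℕ))⁻¹) := by
  rw [designMatrix_eq, Matrix.transpose_mul, Matrix.diagonal_transpose, Matrix.mul_assoc,
    Matrix.mul_inv_rev, ← Matrix.mul_assoc _ (indexDesign J), Matrix.mul_inv_rev,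
    inv_diagonal_gridScale hn, Matrix.mul_assoc]

theorem inv_gram_designMatrix_one_one (J : ℕ) {n : ℕ} (hn : 0 < n) :
    ((designMatrix J n).transpose * designMatrix J n)⁻¹ 1 1 = unitVar J / gridScale n ^ 2 := by
  rw [inv_gram_designMatrix J hn, Matrix.diagonal_mul, Matrix.mul_diagonal, unitVar]
  simp only [Fin.val_one, pow_one]
  field_simp

/-- The coefficients of the regression in the variable `χ n^{-1/4}` are rescaled coefficients in
grid units, as the design matrix is `indexDesign` times a diagonal matrix. -/
theorem lsCoeff_mul_pow (J : ℕ) {n : ℕ} (hn : 0 < n) (L : Fin (2 * J + 1) → ℝ) (k : Fin 4) :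
    lsCoeff J n L k * gridScale n ^ (k : ℕ) = unitCoeff J L k := by
  have h : ((designMatrix J n).transpose * designMatrix J n)⁻¹ * (designMatrix J n).transpose =
      (Matrix.diagonal fun k : Fin 4 => (gridScale n ^ (k : ℕ))⁻¹) * lsWeight J := by
    rw [inv_gram_designMatrix J hn, lsWeight, Matrix.mul_assoc, Matrix.mul_assoc]
    congr 2
    rw [designMatrix_eq, Matrix.transpose_mul, Matrix.diagonal_transpose, ← Matrix.mul_assoc,
      Matrix.diagonal_mul_diagonal]
    have : (fun k : Fin 4 => (gridScale n ^ (k : ℕ))⁻¹ * gridScale n ^ (k : ℕ)) = fun _ => 1 := by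
      funext k
      exact inv_mul_cancel₀ (pow_pos (gridScale_pos hn) _).ne'
    rw [this, Matrix.diagonal_one, Matrix.one_mul]
  rw [lsCoeff, h, Matrix.mulVec, dotProduct, unitCoeff, Finset.sum_mul]
  refine Finset.sum_congr rfl fun j _ => ?_
  rw [Matrix.diagonal_mul]
  have := (pow_pos (gridScale_pos hn) (k : ℕ)).ne'
  field_simp

theorem fittedCubic_eq (J : ℕ) {n : ℕ} (hn : 0 < n) (L : Fin (2 * J + 1) → ℝ) (χ : ℝ) :
    fittedCubic J n L χ =
      unitCoeff J L 1 * χ + unitCoeff J L 2 * χ ^ 2 + unitCoeff J L 3 * χ ^ 3 := by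
  rw [← lsCoeff_mul_pow J hn, ← lsCoeff_mul_pow J hn, ← lsCoeff_mul_pow J hn, fittedCubic]
  simp only [Fin.val_one, Fin.val_two, show ((3 : Fin 4) : ℕ) = 3 from rfl]
  ring

/-- If the quadratic term dominates, the maximizer over `[-J, J]` is close to zero. -/
theorem abs_maximizer_le {b₁ b₂ b₃ J c ε χ : ℝ} (hJ : 0 ≤ J) (hc : 0 < c) (h₁ : |b₁| ≤ ε)
    (h₂ : b₂ ≤ -c) (h₃ : |b₃| ≤ ε) (hχ : χ ∈ Set.Icc (-J) J)
    (hmax : IsMaxOn (fun x => b₁ * x + b₂ * x ^ 2 + b₃ * x ^ 3) (Set.Icc (-J) J) χ) :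
    |χ| ≤ ε * (1 + J ^ 2) / c := by
  have h0 := hmax (show (0 : ℝ) ∈ Set.Icc (-J) J from ⟨by linarith, hJ⟩)
  simp only [Set.mem_ofPred_eq] at h0
  have hχJ : |χ| ≤ J := abs_le.2 hχ
  rw [le_div_iff₀ hc]
  rcases eq_or_lt_of_le (abs_nonneg χ) with h | hpos
  · rw [← h, zero_mul]
    exact mul_nonneg ((abs_nonneg _).trans h₁) (by positivity)
  have e1 : b₁ * χ ≤ ε * |χ| := (le_abs_self _).trans (by
    rw [abs_mul]; exact mul_le_mul_of_nonneg_right h₁ (abs_nonneg _))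
  have e3 : b₃ * χ ^ 3 ≤ ε * |χ| * J ^ 2 := (le_abs_self _).trans (by
    rw [abs_mul, abs_pow]
    have h4 : |χ| ^ 2 ≤ J ^ 2 := pow_le_pow_left₀ (abs_nonneg _) hχJ 2
    calc |b₃| * |χ| ^ 3 ≤ ε * |χ| ^ 3 := mul_le_mul_of_nonneg_right h₃ (by positivity)
      _ = ε * |χ| * |χ| ^ 2 := by ring
      _ ≤ ε * |χ| * J ^ 2 := mul_le_mul_of_nonneg_left h4
        (mul_nonneg ((abs_nonneg _).trans h₁) (abs_nonneg _)))
  have e2 : b₂ * χ ^ 2 ≤ -c * |χ| ^ 2 := by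
    rw [sq_abs]; exact mul_le_mul_of_nonneg_right h₂ (sq_nonneg _)
  have : |χ| * (|χ| * c) ≤ |χ| * (ε * (1 + J ^ 2)) := by nlinarith
  exact le_of_mul_le_mul_left this hpos

theorem maximizer_first_order {b₁ b₂ b₃ J χ : ℝ} (hχ : |χ| < J)
    (hmax : IsMaxOn (fun x => b₁ * x + b₂ * x ^ 2 + b₃ * x ^ 3) (Set.Icc (-J) J) χ) :
    b₁ + 2 * b₂ * χ + 3 * b₃ * χ ^ 2 = 0 := by
  have hloc := hmax.isLocalMax (Icc_mem_nhds (abs_lt.1 hχ).1 (abs_lt.1 hχ).2)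
  have hd : HasDerivAt (fun x => b₁ * x + b₂ * x ^ 2 + b₃ * x ^ 3)
      (b₁ + 2 * b₂ * χ + 3 * b₃ * χ ^ 2) χ := by
    have h1 := (hasDerivAt_id χ).const_mul b₁
    have h2 := (hasDerivAt_pow 2 χ).const_mul b₂
    have h3 := (hasDerivAt_pow 3 χ).const_mul b₃
    convert! (h1.add h2).add h3 using 1
    push_cast
    ring
  exact hloc.hasDerivAt_eq_zero hd

end CubicFit

/-! ### Quadratic mean differentiability -/

namespace ParametricModel

variable {𝒴 : Type*} [MeasurableSpace 𝒴] (M : ParametricModel 𝒴) (ds : M.Derivs)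

theorem measurable_s (θ : ℝ) : Measurable (M.s θ) := (M.measurable_p θ).sqrt

theorem s_nonneg (θ : ℝ) (y : 𝒴) : 0 ≤ M.s θ y := Real.sqrt_nonneg _

theorem s_sq (θ : ℝ) (y : 𝒴) : M.s θ y ^ 2 = M.p θ y := Real.sq_sqrt (M.nonneg_p θ y)

theorem isProbabilityMeasure_P {θ : ℝ} (hθ : θ ∈ M.Θ) : IsProbabilityMeasure (M.P θ) := by
  constructor
  rw [P, withDensity_apply _ MeasurableSet.univ, Measure.restrict_univ, M.lintegral_p θ hθ]

theorem measurable_dotI (k : Fin 4) (θ : ℝ) : Measurable (M.dotI ds k θ) :=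
  Measurable.ite (measurableSet_lt measurable_const (M.measurable_s θ))
    (((Lp.stronglyMeasurable _).measurable.div (M.measurable_s θ)).const_mul 2) measurable_const

theorem integral_P (θ : ℝ) (f : 𝒴 → ℝ) : ∫ y, f y ∂(M.P θ) = ∫ y, M.s θ y ^ 2 * f y ∂M.μ := by
  rw [P, integral_withDensity_eq_integral_toReal_smul (M.measurable_p θ).ennreal_ofReal
    (Eventually.of_forall fun _ => ENNReal.ofReal_lt_top)]
  refine integral_congr_ae (Eventually.of_forall fun y => ?_)
  simp only [smul_eq_mul]
  rw [ENNReal.toReal_ofReal (M.nonneg_p θ y), s_sq]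

theorem memLp_s {θ : ℝ} (hθ : θ ∈ M.Θ) : MemLp (M.s θ) 2 M.μ := by
  rw [memLp_two_iff_integrable_sq (M.measurable_s θ).aestronglyMeasurable]
  simp only [s_sq]
  refine ⟨(M.measurable_p θ).aestronglyMeasurable, ?_⟩
  rw [hasFiniteIntegral_iff_ofReal (Eventually.of_forall (M.nonneg_p θ)), M.lintegral_p θ hθ]
  exact ENNReal.one_lt_top

theorem integral_s_sq {θ : ℝ} (hθ : θ ∈ M.Θ) : ∫ y, M.s θ y ^ 2 ∂M.μ = 1 := by
  simp only [s_sq]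
  rw [integral_eq_lintegral_of_nonneg_ae (Eventually.of_forall (M.nonneg_p θ))
    (M.measurable_p θ).aestronglyMeasurable, M.lintegral_p θ hθ, ENNReal.toReal_one]

theorem ae_s_pos (θ : ℝ) : ∀ᵐ y ∂(M.P θ), 0 < M.s θ y := by
  rw [P, ae_withDensity_iff (M.measurable_p θ).ennreal_ofReal]
  refine Eventually.of_forall fun y hy => Real.sqrt_pos.2 ?_
  simpa using hy

/-- Membership in `L²(P_θ)` is membership of `s(θ) f` in `L²(μ)`. -/
theorem memLp_two_of_s_mul {θ : ℝ} {f g : 𝒴 → ℝ} (hf : Measurable f) (hg : MemLp g 2 M.μ)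
    (hfg : ∀ y, |M.s θ y * f y| ≤ |g y|) :
    MemLp f 2 (M.P θ) ∧ ∫ y, f y ^ 2 ∂(M.P θ) ≤ ∫ y, g y ^ 2 ∂M.μ := by
  have hsf : MemLp (fun y => M.s θ y * f y) 2 M.μ :=
    hg.mono ((M.measurable_s θ).mul hf).aestronglyMeasurable (Eventually.of_forall hfg)
  have e : ∀ y, M.s θ y ^ 2 * f y ^ 2 = (M.s θ y * f y) ^ 2 := fun y => by ring
  constructor
  · rw [memLp_two_iff_integrable_sq hf.aestronglyMeasurable, P,
      integrable_withDensity_iff_integrable_smul' (M.measurable_p θ).ennreal_ofReal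
        (Eventually.of_forall fun _ => ENNReal.ofReal_lt_top)]
    refine hsf.integrable_sq.congr (Eventually.of_forall fun y => ?_)
    simp only [smul_eq_mul]
    rw [ENNReal.toReal_ofReal (M.nonneg_p θ y), ← s_sq, e]
  · rw [integral_P]
    simp only [e]
    exact integral_mono hsf.integrable_sq hg.integrable_sq fun y => sq_le_sq.2 (hfg y)

variable {M ds} {θ₀ : ℝ}

theorem taylorRem_two (h : ℝ) (y : 𝒴) : M.taylorRem ds 2 θ₀ h y =
    M.s (θ₀ + h) y - M.s θ₀ y - h * ds 0 θ₀ y - h ^ 2 / 2 * ds 1 θ₀ y := by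
  rw [taylorRem, Fin.sum_univ_four]
  norm_num [Nat.factorial]
  ring

theorem measurable_taylorRem_two (h : ℝ) : Measurable (M.taylorRem ds 2 θ₀ h) := by
  have : M.taylorRem ds 2 θ₀ h = fun y =>
      M.s (θ₀ + h) y - M.s θ₀ y - h * ds 0 θ₀ y - h ^ 2 / 2 * ds 1 θ₀ y :=
    funext fun y => taylorRem_two h y
  rw [this]
  exact ((((M.measurable_s _).sub (M.measurable_s _)).sub
    ((Lp.stronglyMeasurable _).measurable.const_mul _)).sub
    ((Lp.stronglyMeasurable _).measurable.const_mul _))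

theorem memLp_taylorRem_two (h₀ : θ₀ ∈ M.Θ) {h : ℝ} (hh : θ₀ + h ∈ M.Θ) :
    MemLp (M.taylorRem ds 2 θ₀ h) 2 M.μ := by
  have : M.taylorRem ds 2 θ₀ h = fun y =>
      M.s (θ₀ + h) y - M.s θ₀ y - h * ds 0 θ₀ y - h ^ 2 / 2 * ds 1 θ₀ y :=
    funext fun y => taylorRem_two h y
  rw [this]
  exact ((((M.memLp_s hh).sub (M.memLp_s h₀)).sub ((Lp.memLp _).const_mul _)).sub
    ((Lp.memLp _).const_mul _))

/-- The squared `L²` norm of the second-order Taylor remainder of the square root density. -/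
noncomputable def remSq (M : ParametricModel 𝒴) (ds : M.Derivs) (θ₀ h : ℝ) : ℝ :=
  ∫ y, M.taylorRem ds 2 θ₀ h y ^ 2 ∂M.μ

theorem remSq_nonneg (h : ℝ) : 0 ≤ M.remSq ds θ₀ h := integral_nonneg fun _ => sq_nonneg _

theorem eventually_mem (h₀ : θ₀ ∈ M.Θ) : ∀ᶠ h in 𝓝 (0 : ℝ), θ₀ + h ∈ M.Θ := by
  have : Tendsto (fun h : ℝ => θ₀ + h) (𝓝 0) (𝓝 θ₀) := by
    simpa using (continuous_const.add continuous_id).tendsto (0 : ℝ) (f := fun h : ℝ => θ₀ + h)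
  exact this (M.isOpen.mem_nhds h₀)

theorem remSq_zero : M.remSq ds θ₀ 0 = 0 := by
  simp [remSq, taylorRem_two]

/-- The second-order Taylor expansion, restated with little-o notation for real increments in
place of the sequences `δ n * t n`. -/
theorem remSq_isLittleO (h₀ : θ₀ ∈ M.Θ) (hR : M.IsFourthOrderRegular ds θ₀) :
    M.remSq ds θ₀ =o[𝓝 0] fun h => h ^ 4 := by
  have hseq : ∀ x : ℕ → ℝ, Tendsto x atTop (𝓝[≠] 0) →
      Tendsto ((fun h => M.remSq ds θ₀ h / h ^ 4) ∘ x) atTop (𝓝 0) := by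
    intro x hx
    rw [tendsto_nhdsWithin_iff] at hx
    obtain ⟨hx0, hxne⟩ := hx
    -- `x n = δ n * t n` with `δ n = |x n|` and `t n` its sign; `δ n` must be positive for all `n`
    set δ : ℕ → ℝ := fun n => if x n = 0 then 1 / ((n : ℝ) + 1) else |x n| with hδ
    set t : ℕ → ℝ := fun n => if x n = 0 then 0 else x n / |x n| with ht
    have hδpos : ∀ n, 0 < δ n := by
      intro n
      by_cases h : x n = 0
      · simp only [hδ, h, if_true]; positivity
      · simp only [hδ, h, if_false]; positivity
    have hδ0 : Tendsto δ atTop (𝓝 0) := by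
      have : Tendsto (fun n => |x n|) atTop (𝓝 0) := by simpa using hx0.abs
      refine this.congr' ?_
      filter_upwards [hxne] with n hn
      simp only [hδ, show x n ≠ 0 from hn, if_false]
    have htb : ∃ B, ∀ n, |t n| ≤ B := by
      refine ⟨1, fun n => ?_⟩
      by_cases h : x n = 0
      · simp [ht, h]
      · simp [ht, h, abs_div]
    have key := hR.taylor 2 (by simp) δ t hδpos hδ0 htb
    have key2 := ((ENNReal.continuousAt_toReal ENNReal.zero_ne_top).tendsto.comp key).pow 2
    simp only [ENNReal.toReal_zero, ne_eq, OfNat.ofNat_ne_zero, not_false_eq_true, zero_pow] at key2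
    refine key2.congr' ?_
    filter_upwards [hxne, hx0.eventually (eventually_mem h₀)] with n hn hmem
    have hn' : x n ≠ 0 := hn
    have e1 : δ n = |x n| := by simp only [hδ, hn', if_false]
    have e2 : δ n * t n = x n := by
      simp only [hδ, ht, hn', if_false]
      field_simp
    simp only [Function.comp_apply]
    rw [e2, e1, sq_abs]
    have hm : MemLp (fun y => M.taylorRem ds 2 θ₀ (x n) y / x n ^ 2) 2 M.μ := by
      simpa only [div_eq_mul_inv] using (memLp_taylorRem_two h₀ hmem).mul_const (x n ^ 2)⁻¹
    have := hm.eLpNorm_eq_integral_rpow_norm (by norm_num) (by norm_num)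
    rw [this, ENNReal.toReal_ofReal (by positivity)]
    have e3 : ∀ y, ‖M.taylorRem ds 2 θ₀ (x n) y / x n ^ 2‖ ^ (2 : ℝ≥0∞).toReal =
        M.taylorRem ds 2 θ₀ (x n) y ^ 2 / x n ^ 4 := by
      intro y
      rw [ENNReal.toReal_ofNat, Real.rpow_two, Real.norm_eq_abs, sq_abs, div_pow, ← pow_mul]
    simp only [e3]
    rw [integral_div, ENNReal.toReal_ofNat, ← one_div, ← Real.sqrt_eq_rpow, Real.sq_sqrt]
    · rfl
    · exact div_nonneg (remSq_nonneg _) (by positivity)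
  have h1 : M.remSq ds θ₀ =o[𝓝[≠] 0] fun h => h ^ 4 := by
    refine (Asymptotics.isLittleO_iff_tendsto' ?_).2 (tendsto_of_seq_tendsto hseq)
    filter_upwards [self_mem_nhdsWithin] with h hh h4
    exact absurd (pow_eq_zero_iff (by norm_num) |>.1 h4) hh
  rw [← nhdsNE_sup_pure, Asymptotics.isLittleO_sup]
  refine ⟨h1, ?_⟩
  rw [Asymptotics.isLittleO_pure]
  simp [remSq_zero]

end ParametricModel

/-- The Cauchy–Schwarz inequality for integrals of real functions. -/
theorem integral_abs_mul_le_sqrt {α : Type*} [MeasurableSpace α] {ν : Measure α} {f g : α → ℝ}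
    (hf : MemLp f 2 ν) (hg : MemLp g 2 ν) :
    ∫ x, |f x * g x| ∂ν ≤ √(∫ x, f x ^ 2 ∂ν) * √(∫ x, g x ^ 2 ∂ν) := by
  have := integral_mul_le_Lp_mul_Lq_of_nonneg (μ := ν) (f := fun x => |f x|) (g := fun x => |g x|)
    Real.HolderConjugate.two_two (Eventually.of_forall fun _ => abs_nonneg _)
    (Eventually.of_forall fun _ => abs_nonneg _) (by rw [ENNReal.ofReal_ofNat]; exact hf.abs)
    (by rw [ENNReal.ofReal_ofNat]; exact hg.abs)
  simpa only [abs_mul, Real.sqrt_eq_rpow, Real.rpow_two, sq_abs] using this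

namespace ParametricModel

variable {𝒴 : Type*} [MeasurableSpace 𝒴] {M : ParametricModel 𝒴} {ds : M.Derivs} {θ₀ : ℝ}

theorem sqrt_remSq_isLittleO (h₀ : θ₀ ∈ M.Θ) (hR : M.IsFourthOrderRegular ds θ₀) :
    (fun h => √(M.remSq ds θ₀ h)) =o[𝓝 0] fun h => h ^ 2 := by
  rw [Asymptotics.isLittleO_iff]
  intro c hc
  filter_upwards [Asymptotics.isLittleO_iff.1 (remSq_isLittleO h₀ hR) (sq_pos_of_pos hc)] with h hh
  rw [Real.norm_of_nonneg (Real.sqrt_nonneg _), Real.norm_of_nonneg (sq_nonneg _)]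
  rw [Real.norm_of_nonneg (remSq_nonneg _), Real.norm_of_nonneg (by positivity)] at hh
  refine Real.sqrt_le_iff.2 ⟨by positivity, hh.trans (le_of_eq (by ring))⟩

/-- Where the density vanishes, so does the derivative of its square root: the latter is a limit
of nonnegative difference quotients from the right and of nonpositive ones from the left. -/
theorem ae_derivative_eq_zero (hR : M.IsFourthOrderRegular ds θ₀) :
    ∀ᵐ y ∂M.μ, M.s θ₀ y = 0 → ds 0 θ₀ y = 0 := by
  have main : ∀ c : ℝ, |c| = 1 → ∀ᵐ y ∂M.μ, M.s θ₀ y = 0 → 0 ≤ c * ds 0 θ₀ y := by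
    intro c hc
    set δ : ℕ → ℝ := fun n => 1 / ((n : ℝ) + 1) with hδ
    have hδpos : ∀ n, 0 < δ n := fun n => by simp only [hδ]; positivity
    have hδ0 : Tendsto δ atTop (𝓝 0) := tendsto_one_div_add_atTop_nhds_zero_nat
    have key := hR.taylor 2 (by simp) δ (fun _ => c) hδpos hδ0 ⟨1, fun _ => hc.le⟩
    have hmeas := tendstoInMeasure_of_tendsto_eLpNorm (μ := M.μ) (p := 2) two_ne_zero
      (f := fun n y => M.taylorRem ds 2 θ₀ (δ n * c) y / δ n ^ 2) (g := fun _ => 0)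
      (fun n => ((measurable_taylorRem_two _).div_const _).aestronglyMeasurable)
      aestronglyMeasurable_const (l := atTop)
      (key.congr fun n => by congr 1; funext y; simp)
    obtain ⟨ns, hns, hae⟩ := hmeas.exists_seq_tendsto_ae
    filter_upwards [hae] with y hy hs
    have hδ' : Tendsto (fun k => δ (ns k)) atTop (𝓝 0) := hδ0.comp hns.tendsto_atTop
    -- the difference quotient `s(θ₀ + c δ) / δ` minus vanishing terms
    have hlim : Tendsto (fun k => c * ds 0 θ₀ y + δ (ns k) * (c ^ 2 / 2 * ds 1 θ₀ y) +
        δ (ns k) * (M.taylorRem ds 2 θ₀ (δ (ns k) * c) y / δ (ns k) ^ 2)) atTop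
        (𝓝 (c * ds 0 θ₀ y + 0 * (c ^ 2 / 2 * ds 1 θ₀ y) + 0 * 0)) :=
      ((hδ'.mul_const _).const_add _).add (hδ'.mul hy)
    simp only [zero_mul, add_zero] at hlim
    refine ge_of_tendsto' hlim fun k => ?_
    have hpos := hδpos (ns k)
    have : c * ds 0 θ₀ y + δ (ns k) * (c ^ 2 / 2 * ds 1 θ₀ y) +
        δ (ns k) * (M.taylorRem ds 2 θ₀ (δ (ns k) * c) y / δ (ns k) ^ 2) =
        M.s (θ₀ + δ (ns k) * c) y / δ (ns k) := by
      rw [taylorRem_two, hs]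
      field_simp
      ring
    rw [this]
    exact div_nonneg (M.s_nonneg _ _) hpos.le
  filter_upwards [main 1 (by simp), main (-1) (by simp)] with y h1 h2 hs
  have := h1 hs
  have := h2 hs
  linarith

/-- The squared Hellinger distance between `P_θ₀` and `P_{θ₀ + h}`. -/
noncomputable def hellinger (M : ParametricModel 𝒴) (θ₀ h : ℝ) : ℝ :=
  ∫ y, (M.s (θ₀ + h) y - M.s θ₀ y) ^ 2 ∂M.μ

/-- Both square root densities have norm one, so `⟨s(θ₀), s(θ₀ + h) - s(θ₀)⟩` is minus half the
squared Hellinger distance. -/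
theorem integral_s_mul_sub (h₀ : θ₀ ∈ M.Θ) {h : ℝ} (hh : θ₀ + h ∈ M.Θ) :
    ∫ y, M.s θ₀ y * (M.s (θ₀ + h) y - M.s θ₀ y) ∂M.μ = -(M.hellinger θ₀ h / 2) := by
  have i1 := (M.memLp_s hh).integrable_sq
  have i2 := (M.memLp_s h₀).integrable_sq
  have i3 : Integrable (fun y => M.s θ₀ y * (M.s (θ₀ + h) y - M.s θ₀ y)) M.μ :=
    (M.memLp_s h₀).integrable_mul ((M.memLp_s hh).sub (M.memLp_s h₀))
  have e : ∀ y, (M.s (θ₀ + h) y - M.s θ₀ y) ^ 2 =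
      (M.s (θ₀ + h) y ^ 2 - M.s θ₀ y ^ 2) - 2 * (M.s θ₀ y * (M.s (θ₀ + h) y - M.s θ₀ y)) :=
    fun y => by ring
  rw [hellinger]
  simp only [e]
  have i12 : Integrable (fun y => M.s (θ₀ + h) y ^ 2 - M.s θ₀ y ^ 2) M.μ := i1.sub i2
  rw [integral_sub i12 (i3.const_mul 2), integral_sub i1 i2, integral_const_mul,
    M.integral_s_sq hh, M.integral_s_sq h₀]
  ring

/-- The third-order expansion of the squared Hellinger distance. An error `o(h³)` only takes the
second-order Taylor expansion of `s`, as the leading term of `s(θ₀ + h) - s(θ₀)` has order `h`. -/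
theorem hellinger_expansion (h₀ : θ₀ ∈ M.Θ) (hR : M.IsFourthOrderRegular ds θ₀) :
    (fun h => M.hellinger θ₀ h - ((∫ y, ds 0 θ₀ y ^ 2 ∂M.μ) * h ^ 2 +
      (∫ y, ds 0 θ₀ y * ds 1 θ₀ y ∂M.μ) * h ^ 3)) =o[𝓝 0] fun h => h ^ 3 := by
  set A := ∫ y, ds 0 θ₀ y ^ 2 ∂M.μ
  set B := ∫ y, ds 1 θ₀ y ^ 2 ∂M.μ
  have hρ := sqrt_remSq_isLittleO h₀ hR
  -- the Cauchy–Schwarz bounds for the terms beyond the third order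
  have hb : (fun h : ℝ => h ^ 4 * (B / 4) + 2 * √A * |h * √(M.remSq ds θ₀ h)| +
      √B * (h ^ 2 * √(M.remSq ds θ₀ h)) + √(M.remSq ds θ₀ h) * √(M.remSq ds θ₀ h)) =o[𝓝 0]
      fun h => h ^ 3 := by
    have p34 : (fun h : ℝ => h ^ 4) =o[𝓝 0] fun h : ℝ => h ^ 3 :=
      Asymptotics.isLittleO_pow_pow (by norm_num)
    have t1 : (fun h : ℝ => h * √(M.remSq ds θ₀ h)) =o[𝓝 0] fun h => h ^ 3 := by
      simpa only [← pow_succ'] using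
        (Asymptotics.isBigO_refl (fun h : ℝ => h) (𝓝 0)).mul_isLittleO hρ
    have t2 : (fun h : ℝ => h ^ 2 * √(M.remSq ds θ₀ h)) =o[𝓝 0] fun h => h ^ 3 := by
      refine (((Asymptotics.isBigO_refl (fun h : ℝ => h ^ 2) (𝓝 0)).mul_isLittleO hρ)).trans ?_
      simpa only [← pow_add] using p34
    have t3 : (fun h : ℝ => √(M.remSq ds θ₀ h) * √(M.remSq ds θ₀ h)) =o[𝓝 0] fun h => h ^ 3 := by
      refine (hρ.isBigO.mul_isLittleO hρ).trans ?_
      simpa only [← pow_add] using p34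
    have t4 : (fun h : ℝ => h ^ 4 * (B / 4)) =o[𝓝 0] fun h => h ^ 3 :=
      (p34.const_mul_left (B / 4)).congr_left fun h => mul_comm _ _
    exact ((t4.add (t1.abs_left.const_mul_left _)).add (t2.const_mul_left _)).add t3
  refine Asymptotics.IsBigO.trans_isLittleO (Asymptotics.IsBigO.of_bound 1 ?_) hb
  filter_upwards [eventually_mem h₀] with h hh
  have ma : MemLp (ds 0 θ₀ : 𝒴 → ℝ) 2 M.μ := Lp.memLp _
  have mb : MemLp (ds 1 θ₀ : 𝒴 → ℝ) 2 M.μ := Lp.memLp _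
  have mr := memLp_taylorRem_two (ds := ds) h₀ hh
  have e : ∀ y, (M.s (θ₀ + h) y - M.s θ₀ y) ^ 2 =
      h ^ 2 * ds 0 θ₀ y ^ 2 + h ^ 3 * (ds 0 θ₀ y * ds 1 θ₀ y) + h ^ 4 / 4 * ds 1 θ₀ y ^ 2 +
      2 * h * (ds 0 θ₀ y * M.taylorRem ds 2 θ₀ h y) + h ^ 2 * (ds 1 θ₀ y * M.taylorRem ds 2 θ₀ h y)
      + M.taylorRem ds 2 θ₀ h y ^ 2 := fun y => by rw [taylorRem_two]; ring
  have ia := ma.integrable_sq.const_mul (h ^ 2)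
  have iab : Integrable (fun y => h ^ 3 * (ds 0 θ₀ y * ds 1 θ₀ y)) M.μ :=
    (ma.integrable_mul mb).const_mul _
  have ib := mb.integrable_sq.const_mul (h ^ 4 / 4)
  have iar : Integrable (fun y => 2 * h * (ds 0 θ₀ y * M.taylorRem ds 2 θ₀ h y)) M.μ :=
    (ma.integrable_mul mr).const_mul _
  have ibr : Integrable (fun y => h ^ 2 * (ds 1 θ₀ y * M.taylorRem ds 2 θ₀ h y)) M.μ :=
    (mb.integrable_mul mr).const_mul _
  have c1 := (abs_integral_le_integral_abs (μ := M.μ)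
    (f := fun y => ds 0 θ₀ y * M.taylorRem ds 2 θ₀ h y)).trans (integral_abs_mul_le_sqrt ma mr)
  have c2 := (abs_integral_le_integral_abs (μ := M.μ)
    (f := fun y => ds 1 θ₀ y * M.taylorRem ds 2 θ₀ h y)).trans (integral_abs_mul_le_sqrt mb mr)
  have j1 : Integrable (fun y => h ^ 2 * ds 0 θ₀ y ^ 2 + h ^ 3 * (ds 0 θ₀ y * ds 1 θ₀ y)) M.μ :=
    ia.add iab
  have j2 : Integrable (fun y => h ^ 2 * ds 0 θ₀ y ^ 2 + h ^ 3 * (ds 0 θ₀ y * ds 1 θ₀ y) +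
      h ^ 4 / 4 * ds 1 θ₀ y ^ 2) M.μ := j1.add ib
  have j3 : Integrable (fun y => h ^ 2 * ds 0 θ₀ y ^ 2 + h ^ 3 * (ds 0 θ₀ y * ds 1 θ₀ y) +
      h ^ 4 / 4 * ds 1 θ₀ y ^ 2 + 2 * h * (ds 0 θ₀ y * M.taylorRem ds 2 θ₀ h y)) M.μ := j2.add iar
  have j4 : Integrable (fun y => h ^ 2 * ds 0 θ₀ y ^ 2 + h ^ 3 * (ds 0 θ₀ y * ds 1 θ₀ y) +
      h ^ 4 / 4 * ds 1 θ₀ y ^ 2 + 2 * h * (ds 0 θ₀ y * M.taylorRem ds 2 θ₀ h y) +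
      h ^ 2 * (ds 1 θ₀ y * M.taylorRem ds 2 θ₀ h y)) M.μ := j3.add ibr
  have hQ : M.hellinger θ₀ h = h ^ 2 * A + h ^ 3 * (∫ y, ds 0 θ₀ y * ds 1 θ₀ y ∂M.μ) +
      h ^ 4 / 4 * B + 2 * h * (∫ y, ds 0 θ₀ y * M.taylorRem ds 2 θ₀ h y ∂M.μ) +
      h ^ 2 * (∫ y, ds 1 θ₀ y * M.taylorRem ds 2 θ₀ h y ∂M.μ) + M.remSq ds θ₀ h := by
    rw [hellinger]
    simp only [e]
    rw [integral_add j4 mr.integrable_sq, integral_add j3 ibr, integral_add j2 iar,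
      integral_add j1 ib, integral_add ia iab, integral_const_mul, integral_const_mul,
      integral_const_mul, integral_const_mul, integral_const_mul, remSq]
  change |∫ y, ds 0 θ₀ y * M.taylorRem ds 2 θ₀ h y ∂M.μ| ≤ √A * √(M.remSq ds θ₀ h) at c1
  change |∫ y, ds 1 θ₀ y * M.taylorRem ds 2 θ₀ h y ∂M.μ| ≤ √B * √(M.remSq ds θ₀ h) at c2
  set U := ∫ y, ds 0 θ₀ y * M.taylorRem ds 2 θ₀ h y ∂M.μ
  set V := ∫ y, ds 1 θ₀ y * M.taylorRem ds 2 θ₀ h y ∂M.μ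
  set ρ := √(M.remSq ds θ₀ h) with hρdef
  have hρsq : M.remSq ds θ₀ h = ρ * ρ := (Real.mul_self_sqrt (remSq_nonneg h)).symm
  rw [hQ, one_mul, hρsq, Real.norm_eq_abs, Real.norm_eq_abs]
  have hB : 0 ≤ B := integral_nonneg fun _ => sq_nonneg _
  have hρ0 : 0 ≤ ρ := Real.sqrt_nonneg _
  have d1 : |2 * h * U| ≤ 2 * √A * |h * ρ| := by
    rw [abs_mul, abs_mul, abs_mul, abs_two, abs_of_nonneg hρ0]
    nlinarith [mul_le_mul_of_nonneg_left c1 (abs_nonneg h)]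
  have d2 : |h ^ 2 * V| ≤ √B * (h ^ 2 * ρ) := by
    rw [abs_mul, abs_of_nonneg (sq_nonneg h)]
    nlinarith [mul_le_mul_of_nonneg_left c2 (sq_nonneg h)]
  refine le_trans ?_ (le_abs_self _)
  have hB4 : 0 ≤ h ^ 4 * B := by positivity
  have hρρ : 0 ≤ ρ * ρ := by positivity
  rw [abs_le] at d1 d2 ⊢
  constructor <;> nlinarith [d1.1, d1.2, d2.1, d2.2]

theorem s_sq_mul_dotI (k : Fin 4) (y : 𝒴) :
    M.s θ₀ y ^ 2 * M.dotI ds k θ₀ y = 2 * (M.s θ₀ y * ds k θ₀ y) := by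
  rw [dotI]
  split_ifs with h
  · field_simp
  · rw [le_antisymm (not_lt.1 h) (M.s_nonneg _ _)]
    ring

/-- The score is centred. -/
theorem integral_dotI_zero (h₀ : θ₀ ∈ M.Θ) (hR : M.IsFourthOrderRegular ds θ₀) :
    ∫ y, M.dotI ds 0 θ₀ y ∂(M.P θ₀) = 0 := by
  have ms := M.memLp_s h₀
  have ma : MemLp (ds 0 θ₀ : 𝒴 → ℝ) 2 M.μ := Lp.memLp _
  have mb : MemLp (ds 1 θ₀ : 𝒴 → ℝ) 2 M.μ := Lp.memLp _
  rw [integral_P]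
  simp only [s_sq_mul_dotI]
  rw [integral_const_mul]
  set a := ∫ y, M.s θ₀ y * ds 0 θ₀ y ∂M.μ with ha
  set b := ∫ y, M.s θ₀ y * ds 1 θ₀ y ∂M.μ with hb
  -- `h a` is the linear part of `⟨s(θ₀), s(θ₀ + h) - s(θ₀)⟩`, which is of second order
  have hO : (fun h : ℝ => h * a) =o[𝓝 0] fun h => h := by
    have p21 : (fun h : ℝ => h ^ 2) =o[𝓝 0] fun h : ℝ => h := by
      simpa using Asymptotics.isLittleO_pow_pow (𝕜 := ℝ) (m := 1) (n := 2) (by norm_num)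
    have p31 : (fun h : ℝ => h ^ 3) =o[𝓝 0] fun h : ℝ => h := by
      simpa using Asymptotics.isLittleO_pow_pow (𝕜 := ℝ) (m := 1) (n := 3) (by norm_num)
    have hH : (M.hellinger θ₀) =o[𝓝 0] fun h => h := by
      have h1 := (hellinger_expansion h₀ hR).trans p31
      have h2 := (p21.const_mul_left (∫ y, ds 0 θ₀ y ^ 2 ∂M.μ)).add
        (p31.const_mul_left (∫ y, ds 0 θ₀ y * ds 1 θ₀ y ∂M.μ))
      exact (h1.add h2).congr_left fun h => by ring
    have hsum := ((hH.const_mul_left (1 / 2)).add (p21.norm_left.const_mul_left (|b| / 2))).add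
      ((sqrt_remSq_isLittleO h₀ hR).trans p21)
    refine Asymptotics.IsBigO.trans_isLittleO (Asymptotics.IsBigO.of_bound 1 ?_) hsum
    filter_upwards [eventually_mem h₀] with h hh
    have mr := memLp_taylorRem_two (ds := ds) h₀ hh
    have i1 : Integrable (fun y => h * (M.s θ₀ y * ds 0 θ₀ y)) M.μ :=
      (ms.integrable_mul ma).const_mul _
    have i2 : Integrable (fun y => h ^ 2 / 2 * (M.s θ₀ y * ds 1 θ₀ y)) M.μ :=
      (ms.integrable_mul mb).const_mul _
    have i12 : Integrable (fun y => h * (M.s θ₀ y * ds 0 θ₀ y) +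
      h ^ 2 / 2 * (M.s θ₀ y * ds 1 θ₀ y)) M.μ := i1.add i2
    have i3 : Integrable (fun y => M.s θ₀ y * M.taylorRem ds 2 θ₀ h y) M.μ := ms.integrable_mul mr
    have e : ∀ y, M.s θ₀ y * (M.s (θ₀ + h) y - M.s θ₀ y) =
        h * (M.s θ₀ y * ds 0 θ₀ y) + h ^ 2 / 2 * (M.s θ₀ y * ds 1 θ₀ y) +
          M.s θ₀ y * M.taylorRem ds 2 θ₀ h y := fun y => by rw [taylorRem_two]; ring
    have key := integral_s_mul_sub h₀ hh
    simp only [e] at key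
    rw [integral_add i12 i3, integral_add i1 i2, integral_const_mul, integral_const_mul,
      ← ha, ← hb] at key
    have cs := (abs_integral_le_integral_abs (μ := M.μ)
      (f := fun y => M.s θ₀ y * M.taylorRem ds 2 θ₀ h y)).trans (integral_abs_mul_le_sqrt ms mr)
    rw [M.integral_s_sq h₀, Real.sqrt_one, one_mul] at cs
    change _ ≤ √(M.remSq ds θ₀ h) at cs
    have hQ : 0 ≤ M.hellinger θ₀ h := integral_nonneg fun _ => sq_nonneg _
    have hb2 : |h ^ 2 / 2 * b| ≤ |b| / 2 * ‖h ^ 2‖ := by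
      rw [abs_mul, abs_div, abs_two, Real.norm_eq_abs]
      exact le_of_eq (by ring)
    rw [one_mul, Real.norm_eq_abs, Real.norm_eq_abs]
    refine le_trans ?_ (le_abs_self _)
    rw [abs_le] at cs hb2 ⊢
    constructor <;> linarith [cs.1, cs.2, hb2.1, hb2.2]
  have hlim := (Asymptotics.isLittleO_iff_tendsto (fun h (hh : h = 0) => by simp [hh])).1 hO
  have hconst : Tendsto (fun h : ℝ => h * a / h) (𝓝[≠] 0) (𝓝 a) := by
    refine tendsto_const_nhds.congr' ?_
    filter_upwards [self_mem_nhdsWithin] with h hh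
    have : h ≠ 0 := hh
    field_simp
  rw [tendsto_nhds_unique hconst (hlim.mono_left nhdsWithin_le_nhds), mul_zero]

/-- The Fisher information is `4 ‖ṡ(θ₀)‖²`. -/
theorem fisher_eq (hR : M.IsFourthOrderRegular ds θ₀) :
    M.fisher ds θ₀ = 4 * ∫ y, ds 0 θ₀ y ^ 2 ∂M.μ := by
  rw [fisher, integral_P, ← integral_const_mul]
  refine integral_congr_ae ?_
  filter_upwards [ae_derivative_eq_zero hR] with y hy
  rw [dotI]
  split_ifs with h
  · field_simp
    ring
  · rw [hy (le_antisymm (not_lt.1 h) (M.s_nonneg _ _))]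
    ring

/-! ### The relative increment of the square root density -/

/-- The relative increment `s(θ₀ + h) / s(θ₀) - 1`, set to zero where `s(θ₀)` vanishes. -/
noncomputable def relInc (M : ParametricModel 𝒴) (θ₀ h : ℝ) (y : 𝒴) : ℝ :=
  if 0 < M.s θ₀ y then M.s (θ₀ + h) y / M.s θ₀ y - 1 else 0

/-- The second-order Taylor remainder of the relative increment. -/
noncomputable def incRem (M : ParametricModel 𝒴) (ds : M.Derivs) (θ₀ h : ℝ) (y : 𝒴) : ℝ :=
  M.relInc θ₀ h y - h / 2 * M.dotI ds 0 θ₀ y - h ^ 2 / 4 * M.dotI ds 1 θ₀ y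

theorem measurable_relInc (h : ℝ) : Measurable (M.relInc θ₀ h) :=
  Measurable.ite (measurableSet_lt measurable_const (M.measurable_s θ₀))
    (((M.measurable_s _).div (M.measurable_s θ₀)).sub_const 1) measurable_const

theorem measurable_incRem (h : ℝ) : Measurable (M.incRem ds θ₀ h) :=
  ((measurable_relInc h).sub ((M.measurable_dotI ds 0 θ₀).const_mul _)).sub
    ((M.measurable_dotI ds 1 θ₀).const_mul _)

/-- Passing from `L²(μ)` to `L²(P_θ₀)` divides by `s(θ₀)` and drops the set where `s(θ₀) = 0`, so
it does not increase norms. -/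
theorem memLp_incRem (h₀ : θ₀ ∈ M.Θ) {h : ℝ} (hh : θ₀ + h ∈ M.Θ) :
    MemLp (M.incRem ds θ₀ h) 2 (M.P θ₀) ∧
      ∫ y, M.incRem ds θ₀ h y ^ 2 ∂(M.P θ₀) ≤ M.remSq ds θ₀ h := by
  refine M.memLp_two_of_s_mul (measurable_incRem h) (memLp_taylorRem_two h₀ hh) fun y => ?_
  rw [incRem, relInc, dotI, dotI, taylorRem_two]
  split_ifs with hs
  · refine le_of_eq ?_
    congr 1
    field_simp
    ring
  · simp

theorem memLp_relInc (h₀ : θ₀ ∈ M.Θ) {h : ℝ} (hh : θ₀ + h ∈ M.Θ) :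
    MemLp (M.relInc θ₀ h) 2 (M.P θ₀) := by
  refine (M.memLp_two_of_s_mul (measurable_relInc h) ((M.memLp_s hh).sub (M.memLp_s h₀))
    fun y => ?_).1
  rw [relInc, Pi.sub_apply]
  split_ifs with hs
  · refine le_of_eq ?_
    congr 1
    field_simp
  · simp

/-- The mean of the relative increment. Its linear part is centred, so the Hellinger distance
gives the mean of the rest to third order. -/
theorem integral_relInc (h₀ : θ₀ ∈ M.Θ) {h : ℝ} (hh : θ₀ + h ∈ M.Θ) :
    ∫ y, M.relInc θ₀ h y ∂(M.P θ₀) = -(M.hellinger θ₀ h / 2) := by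
  rw [integral_P, ← integral_s_mul_sub h₀ hh]
  refine integral_congr_ae (Eventually.of_forall fun y => ?_)
  simp only [relInc]
  split_ifs with hs
  · field_simp
  · rw [le_antisymm (not_lt.1 hs) (M.s_nonneg _ _)]
    ring

end ParametricModel

/-! ### Sums over an i.i.d. sample -/

section SampleSums

variable {𝒴 : Type*} [MeasurableSpace 𝒴] {P : Measure 𝒴} [IsProbabilityMeasure P]

theorem memLp_sum_sample {f : 𝒴 → ℝ} (hf : MemLp f 2 P) (n : ℕ) :
    MemLp (fun y : Fin n → 𝒴 => ∑ k, f (y k)) 2 (Measure.pi fun _ : Fin n => P) :=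
  memLp_finsetSum _ fun k _ => hf.comp_measurePreserving (measurePreserving_eval _ k)

theorem integral_sum_sample {f : 𝒴 → ℝ} (hf : Integrable f P) (n : ℕ) :
    ∫ y : Fin n → 𝒴, ∑ k, f (y k) ∂(Measure.pi fun _ : Fin n => P) = n * ∫ y, f y ∂P := by
  have hk : ∀ k : Fin n, ∫ y : Fin n → 𝒴, f (y k) ∂(Measure.pi fun _ : Fin n => P) =
      ∫ y, f y ∂P := by
    intro k
    have h := measurePreserving_eval (fun _ : Fin n => P) k
    calc ∫ y : Fin n → 𝒴, f (y k) ∂(Measure.pi fun _ : Fin n => P)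
        = ∫ z, f z ∂((Measure.pi fun _ : Fin n => P).map (Function.eval k)) :=
          (integral_map h.measurable.aemeasurable
            (by rw [h.map_eq]; exact hf.aestronglyMeasurable)).symm
      _ = ∫ y, f y ∂P := by rw [h.map_eq]
  have hint : ∀ k : Fin n, Integrable (fun y : Fin n → 𝒴 => f (y k))
      (Measure.pi fun _ : Fin n => P) :=
    fun k => (measurePreserving_eval _ k).integrable_comp_of_integrable hf
  rw [integral_finsetSum _ fun k _ => hint k]
  simp [hk]

theorem variance_sum_sample {f : 𝒴 → ℝ} (hf : MemLp f 2 P) (n : ℕ) :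
    variance (fun y : Fin n → 𝒴 => ∑ k, f (y k)) (Measure.pi fun _ : Fin n => P) =
      n * variance f P := by
  have := variance_sum_pi (μ := fun _ : Fin n => P) (X := fun _ => f) fun _ => hf
  rw [Finset.sum_const, Finset.card_univ, Fintype.card_fin, nsmul_eq_mul] at this
  rw [← this]
  congr 1
  funext y
  simp

theorem ae_sample {p : 𝒴 → Prop} (hp : ∀ᵐ y ∂P, p y) (n : ℕ) :
    ∀ᵐ y ∂(Measure.pi fun _ : Fin n => P), ∀ k, p (y k) :=
  ae_all_iff.2 fun k => (Measure.quasiMeasurePreserving_eval (μ := fun _ : Fin n => P) k).ae hp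

end SampleSums

section SampleSumRates

variable {ι : Type*} {𝒴 : ι → Type*} [∀ i, MeasurableSpace (𝒴 i)] {P : ∀ i, Measure (𝒴 i)}
  [∀ i, IsProbabilityMeasure (P i)] {l : Filter ι} {n : ι → ℕ} {f : ∀ i, 𝒴 i → ℝ} {c : ι → ℝ}

/-- Chebyshev's inequality for normalized centred sums. -/
theorem isLittleOP_centred_sum (hf : ∀ᶠ i in l, MemLp (f i) 2 (P i))
    (hc : Tendsto (fun i => c i ^ 2 * (n i * ∫ y, f i y ^ 2 ∂P i)) l (𝓝 0)) :
    IsLittleOP l (fun i => Measure.pi fun _ : Fin (n i) => P i)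
      (fun i (y : Fin (n i) → 𝒴 i) => c i * (∑ k, f i (y k) - n i * ∫ y, f i y ∂P i)) := by
  intro ε hε
  have h2 := ENNReal.tendsto_ofReal (hc.div_const (ε ^ 2))
  rw [zero_div, ENNReal.ofReal_zero] at h2
  refine tendsto_of_tendsto_of_tendsto_of_le_of_le' tendsto_const_nhds h2
    (Eventually.of_forall fun _ => zero_le) ?_
  filter_upwards [hf] with i hi
  have hm := (memLp_sum_sample hi (n i)).const_mul (c i)
  have hmean : ∫ y : Fin (n i) → 𝒴 i, c i * ∑ k, f i (y k) ∂(Measure.pi fun _ : Fin (n i) => P i) =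
      c i * (n i * ∫ y, f i y ∂P i) := by
    rw [integral_const_mul, integral_sum_sample (hi.integrable (by norm_num))]
  have key := meas_ge_le_variance_div_sq hm hε
  rw [hmean, variance_const_mul, variance_sum_sample hi] at key
  simp only [← mul_sub] at key
  refine key.trans (ENNReal.ofReal_le_ofReal ?_)
  gcongr
  exact variance_le_expectation_sq hi.aestronglyMeasurable

/-- Markov's inequality for normalized sums of nonnegative terms. -/
theorem isLittleOP_nonneg_sum (hm : ∀ i, Measurable (f i)) (h0 : ∀ i y, 0 ≤ f i y)
    (hc0 : ∀ i, 0 ≤ c i) (hf : ∀ᶠ i in l, Integrable (f i) (P i))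
    (hc : Tendsto (fun i => c i * (n i * ∫ y, f i y ∂P i)) l (𝓝 0)) :
    IsLittleOP l (fun i => Measure.pi fun _ : Fin (n i) => P i)
      (fun i (y : Fin (n i) → 𝒴 i) => c i * ∑ k, f i (y k)) := by
  refine isLittleOP_of_lintegral (fun i => ?_) ?_
  · exact ((Finset.measurable_sum _ fun k _ => (hm i).comp (measurable_pi_apply k)).const_mul
      (c i)).aemeasurable
  · have h2 := ENNReal.tendsto_ofReal hc
    rw [ENNReal.ofReal_zero] at h2
    refine h2.congr' ?_
    filter_upwards [hf] with i hi
    have hpos : ∀ y : Fin (n i) → 𝒴 i, 0 ≤ c i * ∑ k, f i (y k) := fun y =>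
      mul_nonneg (hc0 i) (Finset.sum_nonneg fun k _ => h0 i (y k))
    simp only [abs_of_nonneg (hpos _)]
    rw [← integral_sum_sample hi, ← integral_const_mul, ofReal_integral_eq_lintegral_ofReal]
    · exact (integrable_finsetSum _ fun k _ =>
        (measurePreserving_eval _ k).integrable_comp_of_integrable hi).const_mul _
    · exact Eventually.of_forall hpos

/-- A maximum over a sample is bounded by the sum. -/
theorem asympSure_forall_lt_one (hm : ∀ i, Measurable (f i)) (h0 : ∀ i y, 0 ≤ f i y)
    (hf : ∀ᶠ i in l, Integrable (f i) (P i))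
    (hc : Tendsto (fun i => n i * ∫ y, f i y ∂P i) l (𝓝 0)) :
    AsympSure l (fun i => Measure.pi fun _ : Fin (n i) => P i)
      (fun i (y : Fin (n i) → 𝒴 i) => ∀ k, f i (y k) < 1) := by
  have h := isLittleOP_nonneg_sum (c := fun _ => 1) hm h0 (fun _ => zero_le_one) hf
    (by simpa only [one_mul] using hc)
  refine (h.asympSure_lt one_pos).mono (Eventually.of_forall fun i y hy k => ?_)
  rw [one_mul, abs_of_nonneg (Finset.sum_nonneg fun k _ => h0 i (y k))] at hy
  exact (Finset.single_le_sum (fun k _ => h0 i (y k)) (Finset.mem_univ k)).trans_lt hy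

end SampleSumRates

/-! ### The local expansion of the log-likelihood -/

/-- The third-order expansion of `2 log (1 + w)`; the bound on `w` keeps the argument away from
zero. -/
theorem abs_log_one_add_sub_le {w : ℝ} (hw : |w| ≤ 1 / 2) :
    |2 * Real.log (1 + w) - (2 * w - w ^ 2 + 2 / 3 * w ^ 3)| ≤ 4 * w ^ 4 := by
  have h := Real.abs_log_sub_add_sum_range_le (x := -w) (by rw [abs_neg]; linarith) 3
  rw [abs_neg, sub_neg_eq_add, Finset.sum_range_succ, Finset.sum_range_succ,
    Finset.sum_range_one] at h
  have h4 : |w| ^ (3 + 1) / (1 - |w|) ≤ 2 * w ^ 4 := by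
    rw [div_le_iff₀ (by linarith), show |w| ^ (3 + 1) = w ^ 4 by
      rw [show 3 + 1 = 2 * 2 from rfl, pow_mul, sq_abs]; ring]
    nlinarith [show 0 ≤ w ^ 4 by positivity]
  have e : 2 * Real.log (1 + w) - (2 * w - w ^ 2 + 2 / 3 * w ^ 3) =
      2 * ((-w) ^ (0 + 1) / ((0 : ℕ) + 1) + (-w) ^ (1 + 1) / ((1 : ℕ) + 1) +
        (-w) ^ (2 + 1) / ((2 : ℕ) + 1) + Real.log (1 + w)) := by
    push_cast
    ring
  rw [e, abs_mul, abs_two]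
  linarith

/-- The error of the expansion of `2 log (1 + w)` with `w = a + b + r`, in which only the terms
`2 w - a² - 2 a b + (2 / 3) a³` are kept. -/
theorem abs_log_expansion_le {a b r : ℝ} (ha : |a| ≤ 1 / 8) (hb : |b| ≤ 1 / 8) (hr : |r| ≤ 1 / 8) :
    |2 * Real.log (1 + (a + b + r)) - (2 * (a + b + r) - a ^ 2 - 2 * (a * b) + 2 / 3 * a ^ 3)| ≤
      2 * |a * r| + 40 * ((b + r) ^ 2 + a ^ 4) := by
  set v := b + r with hv
  have hv4 : |v| ≤ 1 / 4 := (abs_add_le b r).trans (by linarith)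
  have hw : a + b + r = a + v := by rw [hv]; ring
  have h1 := abs_log_one_add_sub_le (w := a + v) ((abs_add_le a v).trans (by linarith))
  rw [hw]
  have e : 2 * Real.log (1 + (a + v)) - (2 * (a + v) - a ^ 2 - 2 * (a * b) + 2 / 3 * a ^ 3) =
      (2 * Real.log (1 + (a + v)) - (2 * (a + v) - (a + v) ^ 2 + 2 / 3 * (a + v) ^ 3)) +
      (-(2 * (a * r)) + (-(v ^ 2) + 2 / 3 * (3 * a ^ 2 * v + 3 * a * v ^ 2 + v ^ 3))) := by
    rw [hv]; ring
  have h2 : 4 * (a + v) ^ 4 ≤ 32 * a ^ 4 + 32 * v ^ 4 := by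
    have q1 : (a + v) ^ 2 ≤ 2 * (a ^ 2 + v ^ 2) := by nlinarith [sq_nonneg (a - v)]
    have q2 : ((a + v) ^ 2) ^ 2 ≤ (2 * (a ^ 2 + v ^ 2)) ^ 2 :=
      pow_le_pow_left₀ (sq_nonneg _) q1 2
    nlinarith [sq_nonneg (a ^ 2 - v ^ 2)]
  have hv2 : v ^ 2 ≤ 1 / 16 := by
    rw [← sq_abs]; nlinarith [abs_nonneg v]
  have h3 : 32 * v ^ 4 ≤ 2 * v ^ 2 := by nlinarith [sq_nonneg v]
  have h4 : |2 / 3 * (3 * a ^ 2 * v + 3 * a * v ^ 2 + v ^ 3)| ≤ a ^ 4 + 2 * v ^ 2 := by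
    have u1 : |a ^ 2 * v| ≤ (a ^ 4 + v ^ 2) / 2 := by
      rw [abs_mul, abs_of_nonneg (sq_nonneg a)]
      nlinarith [sq_nonneg (a ^ 2 - |v|), sq_abs v]
    have u2 : |a * v ^ 2| ≤ 1 / 8 * v ^ 2 := by
      rw [abs_mul, abs_of_nonneg (sq_nonneg v)]
      exact mul_le_mul_of_nonneg_right ha (sq_nonneg v)
    have u3 : |v ^ 3| ≤ 1 / 4 * v ^ 2 := by
      rw [show v ^ 3 = v * v ^ 2 by ring, abs_mul, abs_of_nonneg (sq_nonneg v)]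
      exact mul_le_mul_of_nonneg_right hv4 (sq_nonneg v)
    rw [abs_le] at u1 u2 u3 ⊢
    constructor <;> linarith [u1.1, u1.2, u2.1, u2.2, u3.1, u3.2, sq_nonneg v]
  have h5 : |-(v ^ 2)| ≤ v ^ 2 := by rw [abs_neg, abs_of_nonneg (sq_nonneg v)]
  have h6 : |-(2 * (a * r))| = 2 * |a * r| := by rw [abs_neg, abs_mul, abs_two]
  rw [e]
  refine (abs_add_le _ _).trans ((add_le_add h1 ((abs_add_le _ _).trans (add_le_add h6.le
    ((abs_add_le _ _).trans (add_le_add h5 h4))))).trans ?_)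
  have : 0 ≤ a ^ 4 := by positivity
  linarith [sq_nonneg v]

theorem tendsto_gridScale : Tendsto gridScale atTop (𝓝 0) :=
  (tendsto_rpow_neg_atTop (by norm_num : (0 : ℝ) < 1 / 4)).comp tendsto_natCast_atTop_atTop

theorem gridScale_nonneg (n : ℕ) : 0 ≤ gridScale n := Real.rpow_nonneg (Nat.cast_nonneg n) _

theorem natCast_mul_gridScale_pow {n : ℕ} (hn : 0 < n) : (n : ℝ) * gridScale n ^ 4 = 1 := by
  have hn' : (0 : ℝ) < n := by exact_mod_cast hn
  rw [show gridScale n ^ 4 = (gridScale n ^ 2) ^ 2 by ring, gridScale_sq, inv_pow,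
    Real.sq_sqrt hn'.le, mul_inv_cancel₀ hn'.ne']

section Rates

variable {ι : Type*} {l : Filter ι} {n : ι → ℕ} {h : ι → ℝ} {T : ℝ} {φ : ℝ → ℝ}

theorem tendsto_zero_of_le_gridScale (hn : Tendsto n l atTop)
    (hT : ∀ᶠ i in l, |h i| ≤ T * gridScale (n i)) : Tendsto h l (𝓝 0) := by
  have := (tendsto_gridScale.comp hn).const_mul T
  rw [mul_zero] at this
  exact squeeze_zero_norm' hT this

theorem isBigO_pow_gridScale (hT : ∀ᶠ i in l, |h i| ≤ T * gridScale (n i)) (k : ℕ) :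
    (fun i => h i ^ k) =O[l] fun i => gridScale (n i) ^ k := by
  refine Asymptotics.IsBigO.pow (Asymptotics.IsBigO.of_bound T ?_) k
  filter_upwards [hT] with i hi
  rwa [Real.norm_eq_abs, Real.norm_of_nonneg (gridScale_nonneg _)]

/-- Increments are of order `n^{-1/4}`, so `n o(h⁴) = o(1)`. -/
theorem tendsto_natCast_mul_of_isLittleO_four (hn : Tendsto n l atTop)
    (hT : ∀ᶠ i in l, |h i| ≤ T * gridScale (n i)) (hφ : φ =o[𝓝 0] fun h => h ^ 4) :
    Tendsto (fun i => n i * φ (h i)) l (𝓝 0) := by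
  have h1 := (hφ.comp_tendsto (tendsto_zero_of_le_gridScale hn hT)).trans_isBigO
    (isBigO_pow_gridScale hT 4)
  have h2 := (Asymptotics.isBigO_refl (fun i => (n i : ℝ)) l).mul_isLittleO h1
  refine (Asymptotics.isLittleO_one_iff ℝ).1 (h2.congr' (Eventually.of_forall fun i => rfl) ?_)
  filter_upwards [hn.eventually (eventually_gt_atTop 0)] with i hi
  exact natCast_mul_gridScale_pow hi

/-- Increments are of order `n^{-1/4}`, so `n^{-1/4} n o(h³) = o(1)`. -/
theorem tendsto_gridScale_mul_of_isLittleO_three (hn : Tendsto n l atTop)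
    (hT : ∀ᶠ i in l, |h i| ≤ T * gridScale (n i)) (hφ : φ =o[𝓝 0] fun h => h ^ 3) :
    Tendsto (fun i => gridScale (n i) * (n i * φ (h i))) l (𝓝 0) := by
  have h1 := (hφ.comp_tendsto (tendsto_zero_of_le_gridScale hn hT)).trans_isBigO
    (isBigO_pow_gridScale hT 3)
  have h2 := (Asymptotics.isBigO_refl (fun i => gridScale (n i) * (n i : ℝ)) l).mul_isLittleO h1
  refine (Asymptotics.isLittleO_one_iff ℝ).1
    (h2.congr' (Eventually.of_forall fun i => mul_assoc _ _ _) ?_)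
  filter_upwards [hn.eventually (eventually_gt_atTop 0)] with i hi
  rw [← natCast_mul_gridScale_pow hi]
  ring

theorem tendsto_gridScale_sq_mul_of_isLittleO_three (hn : Tendsto n l atTop)
    (hT : ∀ᶠ i in l, |h i| ≤ T * gridScale (n i)) (hφ : φ =o[𝓝 0] fun h => h ^ 3) :
    Tendsto (fun i => gridScale (n i) ^ 2 * (n i * φ (h i))) l (𝓝 0) := by
  have := (tendsto_gridScale.comp hn).mul (tendsto_gridScale_mul_of_isLittleO_three hn hT hφ)
  rw [mul_zero] at this
  exact this.congr fun i => by simp only [Function.comp_apply]; ring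

end Rates

theorem isLittleO_const_mul_pow (K : ℝ) {a b : ℕ} (hab : b < a) :
    (fun h : ℝ => K * h ^ a) =o[𝓝 0] fun h => h ^ b :=
  (Asymptotics.isLittleO_pow_pow hab).const_mul_left K

namespace ParametricModel

variable {𝒴 : Type*} [MeasurableSpace 𝒴] {M : ParametricModel 𝒴} {ds : M.Derivs} {θ₀ : ℝ}

/-- The coefficient of the cubic term in the expansion of the log-likelihood. Its first part comes
from the Hellinger distance, the others from the second and third powers of the relative
increment. -/
noncomputable def cubicCoeff (M : ParametricModel 𝒴) (ds : M.Derivs) (θ₀ : ℝ) : ℝ :=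
  -(∫ y, ds 0 θ₀ y * ds 1 θ₀ y ∂M.μ)
    - (∫ y, M.dotI ds 0 θ₀ y * M.dotI ds 1 θ₀ y ∂(M.P θ₀)) / 4
    + (∫ y, M.dotI ds 0 θ₀ y ^ 3 ∂(M.P θ₀)) / 12

theorem integrable_dotI_pow (hM : M.IsRegular ds) (h₀ : θ₀ ∈ M.Θ) {k : ℕ} (hk : k ≤ 6) :
    Integrable (fun y => M.dotI ds 0 θ₀ y ^ k) (M.P θ₀) := by
  have := M.isProbabilityMeasure_P h₀
  have h1 : MemLp (M.dotI ds 0 θ₀) k (M.P θ₀) :=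
    (hM.moment_one θ₀ h₀).mono_exponent (by exact_mod_cast hk)
  have h2 := h1.integrable_norm_pow'
  refine h2.mono' ((M.measurable_dotI ds 0 θ₀).pow_const k).aestronglyMeasurable
    (Eventually.of_forall fun y => ?_)
  rw [norm_pow]

theorem memLp_dotI_pow (hM : M.IsRegular ds) (h₀ : θ₀ ∈ M.Θ) {k : ℕ} (hk : k ≤ 3) :
    MemLp (fun y => M.dotI ds 0 θ₀ y ^ k) 2 (M.P θ₀) := by
  rw [memLp_two_iff_integrable_sq
    ((M.measurable_dotI ds 0 θ₀).pow_const k).aestronglyMeasurable]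
  simp only [← pow_mul]
  exact integrable_dotI_pow hM h₀ (by omega)

theorem memLp_dotI_mul (hM : M.IsRegular ds) (h₀ : θ₀ ∈ M.Θ) :
    MemLp (fun y => M.dotI ds 0 θ₀ y * M.dotI ds 1 θ₀ y) 2 (M.P θ₀) := by
  have : ENNReal.HolderTriple 6 3 2 := by
    constructor
    rw [← ENNReal.toReal_eq_toReal_iff' (by simp) (by simp),
      ENNReal.toReal_add (by simp) (by simp)]
    simp only [ENNReal.toReal_inv, ENNReal.toReal_ofNat]
    norm_num
  exact (hM.moment_two θ₀ h₀).mul (hM.moment_one θ₀ h₀)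

/-- The linear part of the relative increment. -/
noncomputable def incLin (M : ParametricModel 𝒴) (ds : M.Derivs) (θ₀ h : ℝ) (y : 𝒴) : ℝ :=
  h / 2 * M.dotI ds 0 θ₀ y

/-- The quadratic part of the relative increment. -/
noncomputable def incQuad (M : ParametricModel 𝒴) (ds : M.Derivs) (θ₀ h : ℝ) (y : 𝒴) : ℝ :=
  h ^ 2 / 4 * M.dotI ds 1 θ₀ y

theorem relInc_eq (h : ℝ) (y : 𝒴) :
    M.relInc θ₀ h y = M.incLin ds θ₀ h y + M.incQuad ds θ₀ h y + M.incRem ds θ₀ h y := by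
  rw [incRem, incLin, incQuad]
  ring

theorem memLp_incQuad (hM : M.IsRegular ds) (h₀ : θ₀ ∈ M.Θ) (h : ℝ) :
    MemLp (M.incQuad ds θ₀ h) 2 (M.P θ₀) := by
  have := M.isProbabilityMeasure_P h₀
  exact ((hM.moment_two θ₀ h₀).mono_exponent (by norm_num)).const_mul _

theorem memLp_incLin (hM : M.IsRegular ds) (h₀ : θ₀ ∈ M.Θ) (h : ℝ) :
    MemLp (M.incLin ds θ₀ h) 2 (M.P θ₀) := by
  have := M.isProbabilityMeasure_P h₀
  exact ((hM.moment_one θ₀ h₀).mono_exponent (by norm_num)).const_mul _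

theorem integral_incRem_sq_isLittleO (hM : M.IsRegular ds) (h₀ : θ₀ ∈ M.Θ) :
    (fun h => ∫ y, M.incRem ds θ₀ h y ^ 2 ∂(M.P θ₀)) =o[𝓝 0] fun h => h ^ 4 := by
  refine Asymptotics.IsBigO.trans_isLittleO (Asymptotics.IsBigO.of_bound 1 ?_)
    (remSq_isLittleO h₀ (hM.regular θ₀ h₀))
  filter_upwards [eventually_mem h₀] with h hh
  rw [one_mul, Real.norm_of_nonneg (integral_nonneg fun _ => sq_nonneg _),
    Real.norm_of_nonneg (remSq_nonneg _)]
  exact (memLp_incRem h₀ hh).2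

theorem integral_incTail_sq_isBigO (hM : M.IsRegular ds) (h₀ : θ₀ ∈ M.Θ) :
    (fun h => ∫ y, (M.incQuad ds θ₀ h y + M.incRem ds θ₀ h y) ^ 2 ∂(M.P θ₀)) =O[𝓝 0]
      fun h => h ^ 4 := by
  have hO : (fun h : ℝ => 2 * ((∫ y, M.dotI ds 1 θ₀ y ^ 2 ∂(M.P θ₀)) / 16 * h ^ 4) +
      2 * ∫ y, M.incRem ds θ₀ h y ^ 2 ∂(M.P θ₀)) =O[𝓝 0] fun h => h ^ 4 :=
    (((Asymptotics.isBigO_refl _ _).const_mul_left _).const_mul_left _).add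
      ((integral_incRem_sq_isLittleO hM h₀).isBigO.const_mul_left _)
  refine Asymptotics.IsBigO.trans (Asymptotics.IsBigO.of_bound 1 ?_) hO
  filter_upwards [eventually_mem h₀] with h hh
  have m1 := memLp_incQuad hM h₀ h
  have m2 := (memLp_incRem (ds := ds) h₀ hh).1
  have e : ∫ y, M.incQuad ds θ₀ h y ^ 2 ∂(M.P θ₀) =
      (∫ y, M.dotI ds 1 θ₀ y ^ 2 ∂(M.P θ₀)) / 16 * h ^ 4 := by
    simp only [incQuad, mul_pow]
    rw [integral_const_mul]
    ring
  have hnn : ∀ f : 𝒴 → ℝ, 0 ≤ ∫ y, f y ^ 2 ∂(M.P θ₀) := fun f =>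
    integral_nonneg fun _ => sq_nonneg _
  rw [one_mul, Real.norm_of_nonneg (integral_nonneg fun _ => sq_nonneg _), ← e,
    Real.norm_of_nonneg (by linarith [hnn (M.incQuad ds θ₀ h), hnn (M.incRem ds θ₀ h)]),
    ← integral_const_mul, ← integral_const_mul,
    ← integral_add (m1.integrable_sq.const_mul 2) (m2.integrable_sq.const_mul 2)]
  refine integral_mono (m1.add m2).integrable_sq
    ((m1.integrable_sq.const_mul 2).add (m2.integrable_sq.const_mul 2)) fun y => ?_
  change (M.incQuad ds θ₀ h y + M.incRem ds θ₀ h y) ^ 2 ≤ _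
  nlinarith [sq_nonneg (M.incQuad ds θ₀ h y - M.incRem ds θ₀ h y)]

theorem integral_incLin_mul_incRem_isLittleO (hM : M.IsRegular ds) (h₀ : θ₀ ∈ M.Θ) :
    (fun h => ∫ y, |M.incLin ds θ₀ h y * M.incRem ds θ₀ h y| ∂(M.P θ₀)) =o[𝓝 0]
      fun h => h ^ 3 := by
  have hO : (fun h : ℝ => √(M.fisher ds θ₀) / 2 * (h * √(M.remSq ds θ₀ h))) =o[𝓝 0]
      fun h => h ^ 3 := by
    refine (Asymptotics.IsLittleO.const_mul_left ?_ _)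
    simpa only [← pow_succ'] using (Asymptotics.isBigO_refl (fun h : ℝ => h) (𝓝 0)).mul_isLittleO
      (sqrt_remSq_isLittleO h₀ (hM.regular θ₀ h₀))
  refine Asymptotics.IsBigO.trans_isLittleO (Asymptotics.IsBigO.of_bound 1 ?_) hO
  filter_upwards [eventually_mem h₀] with h hh
  have m2 := memLp_incRem (ds := ds) h₀ hh
  have cs := integral_abs_mul_le_sqrt (memLp_incLin hM h₀ h) m2.1
  have e : √(∫ y, M.incLin ds θ₀ h y ^ 2 ∂(M.P θ₀)) = |h| / 2 * √(M.fisher ds θ₀) := by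
    simp only [incLin, mul_pow]
    rw [integral_const_mul, Real.sqrt_mul (sq_nonneg _), Real.sqrt_sq_eq_abs, abs_div, abs_two]
    rfl
  rw [one_mul, Real.norm_of_nonneg (integral_nonneg fun _ => abs_nonneg _), Real.norm_eq_abs,
    abs_mul, abs_mul, abs_of_nonneg (by positivity : 0 ≤ √(M.fisher ds θ₀) / 2),
    abs_of_nonneg (Real.sqrt_nonneg (M.remSq ds θ₀ h))]
  refine cs.trans ?_
  rw [e]
  calc |h| / 2 * √(M.fisher ds θ₀) * √(∫ y, M.incRem ds θ₀ h y ^ 2 ∂(M.P θ₀))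
      ≤ |h| / 2 * √(M.fisher ds θ₀) * √(M.remSq ds θ₀ h) := by
        gcongr
        exact m2.2
    _ = _ := by ring

end ParametricModel

namespace ParametricModel

variable {𝒴 : Type*} [MeasurableSpace 𝒴] {M : ParametricModel 𝒴} {ds : M.Derivs} {θ₀ : ℝ}

/-- The local cubic approximation of `𝐥(θ₀ + h) - 𝐥(θ₀)`. -/
noncomputable def localCubic (M : ParametricModel 𝒴) (ds : M.Derivs) (θ₀ : ℝ) {n : ℕ}
    (y : Fin n → 𝒴) (h : ℝ) : ℝ :=
  h * ∑ k, M.dotI ds 0 θ₀ (y k) - n * (M.fisher ds θ₀ / 2) * h ^ 2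
    + n * M.cubicCoeff ds θ₀ * h ^ 3

/-- Since `p = s²`, a ratio of likelihoods is a product of squares of one plus the relative
increments. -/
theorem logLik_sub_eq {n : ℕ} {y : Fin n → 𝒴} {h : ℝ} (hs : ∀ k, 0 < M.s θ₀ (y k))
    (hw : ∀ k, |M.relInc θ₀ h (y k)| ≤ 1 / 2) :
    M.logLik y (θ₀ + h) - M.logLik y θ₀ = ∑ k, 2 * Real.log (1 + M.relInc θ₀ h (y k)) := by
  rw [logLik, logLik, ← Finset.sum_sub_distrib]
  refine Finset.sum_congr rfl fun k _ => ?_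
  have h1 := hw k
  have hk := hs k
  rw [relInc, if_pos hk] at h1 ⊢
  have h2 : 0 < M.s (θ₀ + h) (y k) / M.s θ₀ (y k) := by linarith [(abs_le.1 h1).1]
  have h3 : 0 < M.s (θ₀ + h) (y k) := by
    have := mul_pos h2 hk
    rwa [div_mul_cancel₀ _ hk.ne'] at this
  rw [← s_sq, ← s_sq, Real.log_pow, Real.log_pow, add_sub_cancel, Real.log_div h3.ne' hk.ne']
  push_cast
  ring

/-- With probability tending to one all densities are positive and all parts of the relative
increments are small. -/
theorem asympSure_increments_small (hM : M.IsRegular ds) (h₀ : θ₀ ∈ M.Θ) {ι : Type*}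
    {l : Filter ι} {n : ι → ℕ} {h : ι → ℝ} {T : ℝ} (hn : Tendsto n l atTop)
    (hT : ∀ᶠ i in l, |h i| ≤ T * gridScale (n i)) :
    AsympSure l (fun i => M.sampleLaw θ₀ (n i)) fun i y => ∀ k, 0 < M.s θ₀ (y k) ∧
      |M.incLin ds θ₀ (h i) (y k)| ≤ 1 / 8 ∧ |M.incQuad ds θ₀ (h i) (y k)| ≤ 1 / 8 ∧
      |M.incRem ds θ₀ (h i) (y k)| ≤ 1 / 8 := by
  have := M.isProbabilityMeasure_P h₀
  have hh0 := tendsto_zero_of_le_gridScale hn hT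
  have hmem := hh0.eventually (eventually_mem h₀)
  have i1 := integrable_dotI_pow hM h₀ (k := 6) le_rfl
  have i2 : Integrable (fun y => |M.dotI ds 1 θ₀ y| ^ 3) (M.P θ₀) :=
    (hM.moment_two θ₀ h₀).integrable_norm_pow'
  -- the linear part is small as its sixth moment is of order `h⁶`, and `n h⁶ → 0`; likewise for the
  -- third moment of the quadratic part and the second moment of the remainder
  have a1 : AsympSure l (fun i => M.sampleLaw θ₀ (n i)) fun i y => ∀ k,
      (8 * M.incLin ds θ₀ (h i) (y k)) ^ 6 < 1 := by
    refine asympSure_forall_lt_one (f := fun i y => (8 * M.incLin ds θ₀ (h i) y) ^ 6)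
      (fun i => (((M.measurable_dotI ds 0 θ₀).const_mul _).const_mul 8).pow_const 6)
      (fun i y => by positivity) (Eventually.of_forall fun i => ?_) ?_
    · simp only [incLin, mul_pow]
      exact (i1.const_mul _).const_mul _
    · have e : ∀ i, ∫ y, (8 * M.incLin ds θ₀ (h i) y) ^ 6 ∂(M.P θ₀) =
          4 ^ 6 * (∫ y, M.dotI ds 0 θ₀ y ^ 6 ∂(M.P θ₀)) * h i ^ 6 := by
        intro i
        simp only [incLin, mul_pow]
        rw [integral_const_mul, integral_const_mul]
        ring
      simp only [e]
      exact tendsto_natCast_mul_of_isLittleO_four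
        (φ := fun h => 4 ^ 6 * (∫ y, M.dotI ds 0 θ₀ y ^ 6 ∂(M.P θ₀)) * h ^ 6) hn hT
        (isLittleO_const_mul_pow _ (by norm_num))
  have a2 : AsympSure l (fun i => M.sampleLaw θ₀ (n i)) fun i y => ∀ k,
      |8 * M.incQuad ds θ₀ (h i) (y k)| ^ 3 < 1 := by
    have e' : ∀ (i : ι) (y : 𝒴), |8 * M.incQuad ds θ₀ (h i) y| ^ 3 =
        8 * h i ^ 6 * |M.dotI ds 1 θ₀ y| ^ 3 := by
      intro i y
      rw [incQuad, abs_mul, abs_mul, abs_of_nonneg (by positivity : (0 : ℝ) ≤ 8),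
        abs_of_nonneg (by positivity : 0 ≤ h i ^ 2 / 4)]
      ring
    refine asympSure_forall_lt_one (f := fun i y => |8 * M.incQuad ds θ₀ (h i) y| ^ 3)
      (fun i => (((M.measurable_dotI ds 1 θ₀).const_mul _).const_mul 8).abs.pow_const 3)
      (fun i y => by positivity) (Eventually.of_forall fun i => ?_) ?_
    · simp only [e']
      exact i2.const_mul _
    · have e : ∀ i, ∫ y, |8 * M.incQuad ds θ₀ (h i) y| ^ 3 ∂(M.P θ₀) =
          8 * (∫ y, |M.dotI ds 1 θ₀ y| ^ 3 ∂(M.P θ₀)) * h i ^ 6 := by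
        intro i
        simp only [e']
        rw [integral_const_mul]
        ring
      simp only [e]
      exact tendsto_natCast_mul_of_isLittleO_four
        (φ := fun h => 8 * (∫ y, |M.dotI ds 1 θ₀ y| ^ 3 ∂(M.P θ₀)) * h ^ 6) hn hT
        (isLittleO_const_mul_pow _ (by norm_num))
  have a3 : AsympSure l (fun i => M.sampleLaw θ₀ (n i)) fun i y => ∀ k,
      (8 * M.incRem ds θ₀ (h i) (y k)) ^ 2 < 1 := by
    refine asympSure_forall_lt_one (f := fun i y => (8 * M.incRem ds θ₀ (h i) y) ^ 2)
      (fun i => ((measurable_incRem _).const_mul 8).pow_const 2)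
      (fun i y => by positivity) ?_ ?_
    · filter_upwards [hmem] with i hi
      simp only [mul_pow]
      exact (memLp_incRem h₀ hi).1.integrable_sq.const_mul _
    · simp only [mul_pow]
      simp only [integral_const_mul]
      exact tendsto_natCast_mul_of_isLittleO_four
        (φ := fun h => 8 ^ 2 * ∫ y, M.incRem ds θ₀ h y ^ 2 ∂(M.P θ₀)) hn hT
        ((integral_incRem_sq_isLittleO hM h₀).const_mul_left _)
  have a4 : AsympSure l (fun i => M.sampleLaw θ₀ (n i)) fun i y => ∀ k, 0 < M.s θ₀ (y k) :=
    AsympSure.of_ae (Eventually.of_forall fun i => ae_sample (M.ae_s_pos θ₀) _)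
  have small : ∀ {x : ℝ} {p : ℕ}, p ≠ 0 → |8 * x| ^ p < 1 → |x| ≤ 1 / 8 := by
    intro x p hp hx
    have := (pow_lt_one_iff_of_nonneg (abs_nonneg (8 * x)) hp).1 hx
    rw [abs_mul, abs_of_nonneg (by positivity : (0 : ℝ) ≤ 8)] at this
    linarith
  refine (((a1.and a2).and a3).and a4).mono (Eventually.of_forall fun i y hy k => ?_)
  obtain ⟨⟨⟨h1, h2⟩, h3⟩, h4⟩ := hy
  refine ⟨h4 k, small (p := 6) (by norm_num) ?_, small (by norm_num) (h2 k),
    small (p := 2) (by norm_num) ?_⟩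
  · have e6 : ∀ x : ℝ, |x| ^ 6 = x ^ 6 := fun x => by
      rw [← abs_pow, abs_of_nonneg (by positivity)]
    rw [e6]
    exact h1 k
  · rw [sq_abs]
    exact h3 k

/-- The log-likelihood on the scale `n^{-1/4}` is a cubic up to `o_P(n^{1/4})`. -/
theorem isLittleOP_logLik_sub_localCubic (hM : M.IsRegular ds) (h₀ : θ₀ ∈ M.Θ) {ι : Type*}
    {l : Filter ι} {n : ι → ℕ} {h : ι → ℝ} {T : ℝ} (hn : Tendsto n l atTop)
    (hT : ∀ᶠ i in l, |h i| ≤ T * gridScale (n i)) :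
    IsLittleOP l (fun i => M.sampleLaw θ₀ (n i)) fun i y => gridScale (n i) *
      (M.logLik y (θ₀ + h i) - M.logLik y θ₀ - M.localCubic ds θ₀ y (h i)) := by
  have := M.isProbabilityMeasure_P h₀
  have hR := hM.regular θ₀ h₀
  have hh0 := tendsto_zero_of_le_gridScale hn hT
  have hmem := hh0.eventually (eventually_mem h₀)
  have i4 := integrable_dotI_pow hM h₀ (k := 4) (by norm_num)
  -- the remainder of the expansion of the logarithm
  have s1 : IsLittleOP l (fun i => M.sampleLaw θ₀ (n i)) fun i y => gridScale (n i) *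
      ∑ k, (2 * |M.incLin ds θ₀ (h i) (y k) * M.incRem ds θ₀ (h i) (y k)| +
        40 * ((M.incQuad ds θ₀ (h i) (y k) + M.incRem ds θ₀ (h i) (y k)) ^ 2 +
          M.incLin ds θ₀ (h i) (y k) ^ 4)) := by
    have mL : ∀ i, Measurable (M.incLin ds θ₀ (h i)) := fun i =>
      (M.measurable_dotI ds 0 θ₀).const_mul _
    have mQ : ∀ i, Measurable (M.incQuad ds θ₀ (h i)) := fun i =>
      (M.measurable_dotI ds 1 θ₀).const_mul _
    have mR : ∀ i, Measurable (M.incRem ds θ₀ (h i)) := fun i => measurable_incRem _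
    have e4 : ∀ h, ∀ y, M.incLin ds θ₀ h y ^ 4 = h ^ 4 / 16 * M.dotI ds 0 θ₀ y ^ 4 := by
      intro h y
      rw [incLin]
      ring
    have hint : ∀ h, θ₀ + h ∈ M.Θ →
        Integrable (fun y => 2 * |M.incLin ds θ₀ h y * M.incRem ds θ₀ h y|) (M.P θ₀) ∧
        Integrable (fun y => (M.incQuad ds θ₀ h y + M.incRem ds θ₀ h y) ^ 2) (M.P θ₀) ∧
        Integrable (fun y => M.incLin ds θ₀ h y ^ 4) (M.P θ₀) := by
      intro h hh
      have mr := (memLp_incRem (ds := ds) h₀ hh).1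
      refine ⟨((memLp_incLin hM h₀ h).integrable_mul mr).abs.const_mul 2,
        ((memLp_incQuad hM h₀ h).add mr).integrable_sq, ?_⟩
      simp only [e4]
      exact i4.const_mul _
    refine isLittleOP_nonneg_sum (f := fun i y =>
        2 * |M.incLin ds θ₀ (h i) y * M.incRem ds θ₀ (h i) y| +
        40 * ((M.incQuad ds θ₀ (h i) y + M.incRem ds θ₀ (h i) y) ^ 2 + M.incLin ds θ₀ (h i) y ^ 4))
      (c := fun i => gridScale (n i)) (fun i => ?_) (fun i y => by positivity)
      (fun i => gridScale_nonneg _) ?_ ?_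
    · exact (((mL i).mul (mR i)).abs.const_mul 2).add
        (((((mQ i).add (mR i)).pow_const 2).add ((mL i).pow_const 4)).const_mul 40)
    · filter_upwards [hmem] with i hi
      obtain ⟨j1, j2, j3⟩ := hint _ hi
      exact j1.add ((j2.add j3).const_mul 40)
    · have hφ : (fun h => 2 * (∫ y, |M.incLin ds θ₀ h y * M.incRem ds θ₀ h y| ∂(M.P θ₀)) +
          40 * ((∫ y, (M.incQuad ds θ₀ h y + M.incRem ds θ₀ h y) ^ 2 ∂(M.P θ₀)) +
            (∫ y, M.dotI ds 0 θ₀ y ^ 4 ∂(M.P θ₀)) / 16 * h ^ 4)) =o[𝓝 0] fun h => h ^ 3 :=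
        ((integral_incLin_mul_incRem_isLittleO hM h₀).const_mul_left 2).add
          ((((integral_incTail_sq_isBigO hM h₀).trans_isLittleO
            (Asymptotics.isLittleO_pow_pow (by norm_num))).add
            (isLittleO_const_mul_pow _ (by norm_num))).const_mul_left 40)
      refine (tendsto_gridScale_mul_of_isLittleO_three hn hT hφ).congr' ?_
      filter_upwards [hmem] with i hi
      obtain ⟨j1, j2, j3⟩ := hint _ hi
      have j23 : Integrable (fun y => (M.incQuad ds θ₀ (h i) y + M.incRem ds θ₀ (h i) y) ^ 2 +
        M.incLin ds θ₀ (h i) y ^ 4) (M.P θ₀) := j2.add j3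
      rw [integral_add j1 (j23.const_mul 40), integral_const_mul, integral_const_mul,
        integral_add j2 j3]
      simp only [e4]
      rw [integral_const_mul]
      ring
  -- the sums of the terms of order at least two are close to their means
  have s2 : IsLittleOP l (fun i => M.sampleLaw θ₀ (n i)) fun i y => gridScale (n i) *
      (∑ k, (M.incQuad ds θ₀ (h i) (y k) + M.incRem ds θ₀ (h i) (y k)) -
        n i * ∫ y, (M.incQuad ds θ₀ (h i) y + M.incRem ds θ₀ (h i) y) ∂(M.P θ₀)) := by
    refine isLittleOP_centred_sum (c := fun i => gridScale (n i))
      (f := fun i y => M.incQuad ds θ₀ (h i) y + M.incRem ds θ₀ (h i) y) ?_ ?_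
    · filter_upwards [hmem] with i hi
      exact (memLp_incQuad hM h₀ _).add (memLp_incRem h₀ hi).1
    · exact tendsto_gridScale_sq_mul_of_isLittleO_three hn hT
        ((integral_incTail_sq_isBigO hM h₀).trans_isLittleO
            (Asymptotics.isLittleO_pow_pow (by norm_num)))
  have fluct : ∀ {f : 𝒴 → ℝ} (K : ℝ) {p : ℕ}, 2 ≤ p → MemLp f 2 (M.P θ₀) →
      IsLittleOP l (fun i => M.sampleLaw θ₀ (n i)) fun i y => gridScale (n i) *
        (∑ k, K * h i ^ p * f (y k) - n i * ∫ y, K * h i ^ p * f y ∂(M.P θ₀)) := by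
    intro f K p hp hf
    refine isLittleOP_centred_sum (c := fun i => gridScale (n i))
      (f := fun i y => K * h i ^ p * f y) (Eventually.of_forall fun i => hf.const_mul _) ?_
    have e : ∀ i, ∫ y, (K * h i ^ p * f y) ^ 2 ∂(M.P θ₀) =
        K ^ 2 * (∫ y, f y ^ 2 ∂(M.P θ₀)) * h i ^ (p * 2) := by
      intro i
      simp only [mul_pow]
      rw [integral_const_mul, ← pow_mul]
      ring
    simp only [e]
    exact tendsto_gridScale_sq_mul_of_isLittleO_three
      (φ := fun h => K ^ 2 * (∫ y, f y ^ 2 ∂(M.P θ₀)) * h ^ (p * 2)) hn hT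
      (isLittleO_const_mul_pow _ (by omega))
  have s3 := fluct (1 / 4) le_rfl (memLp_dotI_pow hM h₀ (k := 2) (by norm_num))
  have s4 := fluct (1 / 4) (p := 3) (by norm_num) (memLp_dotI_mul hM h₀)
  have s5 := fluct (1 / 12) (p := 3) (by norm_num) (memLp_dotI_pow hM h₀ (k := 3) le_rfl)
  -- the mean of the relative increment, to third order
  have s6 : IsLittleOP l (fun i => M.sampleLaw θ₀ (n i)) fun i _ => gridScale (n i) *
      (n i * (M.hellinger θ₀ (h i) - ((∫ y, ds 0 θ₀ y ^ 2 ∂M.μ) * h i ^ 2 +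
        (∫ y, ds 0 θ₀ y * ds 1 θ₀ y ∂M.μ) * h i ^ 3))) :=
    isLittleOP_of_tendsto (tendsto_gridScale_mul_of_isLittleO_three hn hT
      (hellinger_expansion h₀ hR))
  have s0 : IsLittleOP l (fun i => M.sampleLaw θ₀ (n i)) fun i y => gridScale (n i) *
      (M.logLik y (θ₀ + h i) - M.logLik y θ₀ -
        ∑ k, (2 * M.relInc θ₀ (h i) (y k) - M.incLin ds θ₀ (h i) (y k) ^ 2
          - 2 * (M.incLin ds θ₀ (h i) (y k) * M.incQuad ds θ₀ (h i) (y k))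
          + 2 / 3 * M.incLin ds θ₀ (h i) (y k) ^ 3)) := by
    refine s1.of_abs_le ((asympSure_increments_small hM h₀ hn hT).mono
      (Eventually.of_forall fun i y hy => ?_))
    have hw : ∀ k, |M.relInc θ₀ (h i) (y k)| ≤ 1 / 2 := by
      intro k
      obtain ⟨_, h1, h2, h3⟩ := hy k
      rw [relInc_eq (ds := ds)]
      have := abs_add_le (M.incLin ds θ₀ (h i) (y k)) (M.incQuad ds θ₀ (h i) (y k))
      exact (abs_add_le _ _).trans (by linarith)
    rw [logLik_sub_eq (fun k => (hy k).1) hw, ← Finset.sum_sub_distrib, abs_mul, abs_mul]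
    refine mul_le_mul_of_nonneg_left ?_ (abs_nonneg _)
    refine (Finset.abs_sum_le_sum_abs _ _).trans ((Finset.sum_le_sum fun k _ => ?_).trans
      (le_abs_self _))
    obtain ⟨_, h1, h2, h3⟩ := hy k
    rw [relInc_eq (ds := ds)]
    exact abs_log_expansion_le h1 h2 h3
  refine (((((s0.add (s2.const_mul 2)).sub s6).sub s3).sub s4).add s5).congr_eq ?_
  filter_upwards [hmem] with i hi y
  have hmean : ∫ y, (M.incQuad ds θ₀ (h i) y + M.incRem ds θ₀ (h i) y) ∂(M.P θ₀) =
      -(M.hellinger θ₀ (h i) / 2) := by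
    have e : ∀ y, M.incQuad ds θ₀ (h i) y + M.incRem ds θ₀ (h i) y =
        M.relInc θ₀ (h i) y - h i / 2 * M.dotI ds 0 θ₀ y := fun y => by
      rw [relInc_eq (ds := ds), incLin]; ring
    simp only [e]
    have j1 : Integrable (fun y => h i / 2 * M.dotI ds 0 θ₀ y) (M.P θ₀) :=
      (memLp_incLin hM h₀ (h i)).integrable (by norm_num)
    rw [integral_sub ((memLp_relInc h₀ hi).integrable (by norm_num)) j1, integral_const_mul,
      integral_dotI_zero h₀ hR, integral_relInc h₀ hi]
    ring
  have hF : ∫ y, ds 0 θ₀ y ^ 2 ∂M.μ = M.fisher ds θ₀ / 4 := by rw [fisher_eq hR]; ring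
  have hF2 : ∫ y, M.dotI ds 0 θ₀ y ^ 2 ∂(M.P θ₀) = M.fisher ds θ₀ := rfl
  have hsum : ∑ k, (2 * M.relInc θ₀ (h i) (y k) - M.incLin ds θ₀ (h i) (y k) ^ 2
          - 2 * (M.incLin ds θ₀ (h i) (y k) * M.incQuad ds θ₀ (h i) (y k))
          + 2 / 3 * M.incLin ds θ₀ (h i) (y k) ^ 3) =
      h i * ∑ k, M.dotI ds 0 θ₀ (y k) +
      2 * ∑ k, (M.incQuad ds θ₀ (h i) (y k) + M.incRem ds θ₀ (h i) (y k)) -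
      ∑ k, 1 / 4 * h i ^ 2 * M.dotI ds 0 θ₀ (y k) ^ 2 -
      ∑ k, 1 / 4 * h i ^ 3 * (M.dotI ds 0 θ₀ (y k) * M.dotI ds 1 θ₀ (y k)) +
      ∑ k, 1 / 12 * h i ^ 3 * M.dotI ds 0 θ₀ (y k) ^ 3 := by
    rw [Finset.mul_sum, Finset.mul_sum, ← Finset.sum_add_distrib, ← Finset.sum_sub_distrib,
      ← Finset.sum_sub_distrib, ← Finset.sum_add_distrib]
    refine Finset.sum_congr rfl fun k _ => ?_
    rw [relInc_eq (ds := ds), incLin, incQuad]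
    ring
  rw [hsum, hmean, integral_const_mul, integral_const_mul, integral_const_mul, hF, hF2,
    localCubic, cubicCoeff]
  ring

end ParametricModel

/-! ### Discretized preliminary estimators -/

/-- Pairs `(n, θ)` with `n → ∞` and `θ` in the window `√n |θ - θ₀| ≤ B`. -/
def windowFilter (θ₀ B : ℝ) : Filter (ℕ × ℝ) :=
  atTop.comap Prod.fst ⊓ 𝓟 {p | √(p.1 : ℝ) * |p.2 - θ₀| ≤ B}

theorem tendsto_fst_windowFilter (θ₀ B : ℝ) : Tendsto Prod.fst (windowFilter θ₀ B) atTop :=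
  tendsto_comap.mono_left inf_le_left

theorem eventually_windowFilter {θ₀ B : ℝ} {p : ℕ × ℝ → Prop} :
    (∀ᶠ x in windowFilter θ₀ B, p x) ↔
      ∀ᶠ n : ℕ in atTop, ∀ θ : ℝ, √(n : ℝ) * |θ - θ₀| ≤ B → p (n, θ) := by
  rw [windowFilter, eventually_inf_principal, eventually_comap]
  constructor
  · intro h
    filter_upwards [h] with n hn θ hθ
    exact hn (n, θ) rfl hθ
  · intro h
    filter_upwards [h] with n hn
    rintro ⟨_, θ⟩ rfl hθ
    exact hn θ hθ

section Pilot

variable {Ω : ℕ → Type*} [∀ n, MeasurableSpace (Ω n)] {Pr : ∀ n, Measure (Ω n)}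
  {θs : ∀ n, Ω n → ℝ} {θ₀ : ℝ} {a : ℕ → ℝ}

/-- What holds asymptotically surely for deterministic points of the windows holds for a
`√n`-consistent estimator with values in a grid of spacing `n^{-1/2}`: each window has a bounded
number of grid points. -/
theorem AsympSure.of_window (hgrid : ∀ n ω, ∃ k : ℤ, θs n ω = a n + ((k : ℝ) + 1 / 2) / √(n : ℝ))
    (hθ : IsBigOP atTop Pr fun n ω => √(n : ℝ) * (θs n ω - θ₀)) {q : ∀ n, ℝ → Ω n → Prop}
    (hq : ∀ B, AsympSure (windowFilter θ₀ B) (fun p => Pr p.1)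
      fun p ω => θs p.1 ω = p.2 → q p.1 p.2 ω) :
    AsympSure atTop Pr fun n ω => q n (θs n ω) ω := by
  refine ENNReal.tendsto_nhds_zero.2 fun ε hε => ?_
  obtain ⟨B, hB⟩ := hθ (ε / 2) (ENNReal.half_pos hε.ne')
  set N : ℕ := ⌈2 * |B| + 1⌉₊ with hN
  have hη : 0 < ε / 2 / (N + 1 : ℕ) :=
    ENNReal.div_pos (ENNReal.half_pos hε.ne').ne' (ENNReal.natCast_ne_top _)
  have hw := eventually_windowFilter.1 (ENNReal.tendsto_nhds_zero.1 (hq B) _ hη)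
  filter_upwards [hB, hw, eventually_gt_atTop 0] with n hBn hwn hn
  have hsn : 0 < √(n : ℝ) := Real.sqrt_pos.2 (by exact_mod_cast hn)
  set u : ℝ := √(n : ℝ) * (θ₀ - a n) - 1 / 2 with hu
  set pt : ℤ → ℝ := fun k => a n + ((k : ℝ) + 1 / 2) / √(n : ℝ) with hpt
  have hdist : ∀ k : ℤ, √(n : ℝ) * |pt k - θ₀| = |(k : ℝ) - u| := by
    intro k
    have e : √(n : ℝ) * (pt k - θ₀) = k - u := by
      simp only [hpt, hu]
      field_simp
      ring
    rw [← e, abs_mul, abs_of_pos hsn]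
  set K : Finset ℤ := Finset.Icc ⌈u - B⌉ ⌊u + B⌋ with hK
  have hmemK : ∀ k : ℤ, √(n : ℝ) * |pt k - θ₀| ≤ B ↔ k ∈ K := by
    intro k
    rw [hdist, hK, Finset.mem_Icc, Int.ceil_le, Int.le_floor, abs_le]
    constructor <;> intro h <;> constructor <;> linarith [h.1, h.2]
  have hcard : K.card ≤ N + 1 := by
    rw [hK, Int.card_Icc, Int.toNat_le]
    have h1 : ((⌊u + B⌋ + 1 - ⌈u - B⌉ : ℤ) : ℝ) ≤ ((N + 1 : ℕ) : ℤ) := by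
      push_cast
      have := Int.floor_le (u + B)
      have := Int.le_ceil (u - B)
      have := Nat.le_ceil (2 * |B| + 1)
      have := le_abs_self B
      rw [← hN] at *
      linarith
    exact_mod_cast h1
  have hsub : {ω | ¬ q n (θs n ω) ω} ⊆ {ω | B < |√(n : ℝ) * (θs n ω - θ₀)|} ∪
      ⋃ k ∈ K, {ω | ¬ (θs n ω = pt k → q n (pt k) ω)} := by
    intro ω hω
    by_cases hlt : B < |√(n : ℝ) * (θs n ω - θ₀)|
    · exact Or.inl hlt
    · refine Or.inr ?_
      obtain ⟨k, hk⟩ := hgrid n ω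
      have hk' : θs n ω = pt k := hk
      rw [not_lt, abs_mul, abs_of_pos hsn, hk'] at hlt
      refine Set.mem_iUnion₂.2 ⟨k, (hmemK k).1 hlt, ?_⟩
      intro hcon
      have h2 := hcon hk'
      rw [← hk'] at h2
      exact hω h2
  calc Pr n {ω | ¬ q n (θs n ω) ω}
      ≤ Pr n {ω | B < |√(n : ℝ) * (θs n ω - θ₀)|} +
        ∑ k ∈ K, Pr n {ω | ¬ (θs n ω = pt k → q n (pt k) ω)} :=
        (measure_mono hsub).trans ((measure_union_le _ _).trans
          (add_le_add le_rfl (measure_biUnion_finset_le _ _)))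
    _ ≤ ε / 2 + ∑ _k ∈ K, ε / 2 / (N + 1 : ℕ) :=
        add_le_add hBn (Finset.sum_le_sum fun k hk => hwn (pt k) ((hmemK k).2 hk))
    _ ≤ ε / 2 + ε / 2 := by
        rw [Finset.sum_const, nsmul_eq_mul]
        gcongr
        calc (K.card : ℝ≥0∞) * (ε / 2 / (N + 1 : ℕ))
            ≤ (N + 1 : ℕ) * (ε / 2 / (N + 1 : ℕ)) := by gcongr
          _ ≤ ε / 2 := ENNReal.mul_div_le
    _ = ε := ENNReal.add_halves ε

theorem IsLittleOP.of_window
    (hgrid : ∀ n ω, ∃ k : ℤ, θs n ω = a n + ((k : ℝ) + 1 / 2) / √(n : ℝ))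
    (hθ : IsBigOP atTop Pr fun n ω => √(n : ℝ) * (θs n ω - θ₀)) {X : ∀ n, ℝ → Ω n → ℝ}
    (hX : ∀ B, IsLittleOP (windowFilter θ₀ B) (fun p => Pr p.1) fun p ω => X p.1 p.2 ω) :
    IsLittleOP atTop Pr fun n ω => X n (θs n ω) ω :=
  isLittleOP_iff.2 fun _ hε => AsympSure.of_window (q := fun n θ ω => |X n θ ω| < _) hgrid hθ
    fun B => ((hX B).asympSure_lt hε).mono (Eventually.of_forall fun _ _ h _ => h)

theorem exists_gridMidpoint_eq (a : ℕ → ℝ) (n : ℕ) (x : ℝ) :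
    ∃ k : ℤ, gridMidpoint (a n) n x = a n + ((k : ℝ) + 1 / 2) / √(n : ℝ) := ⟨_, rfl⟩

theorem abs_gridMidpoint_sub_le (a : ℝ) {n : ℕ} (hn : 0 < n) (x : ℝ) :
    √(n : ℝ) * |gridMidpoint a n x - x| ≤ 1 / 2 := by
  have hsn : 0 < √(n : ℝ) := Real.sqrt_pos.2 (by exact_mod_cast hn)
  have e : √(n : ℝ) * (a + ((⌊(x - a) * √(n : ℝ)⌋ : ℝ) + 1 / 2) / √(n : ℝ) - x) =
      ⌊(x - a) * √(n : ℝ)⌋ + 1 / 2 - (x - a) * √(n : ℝ) := by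
    field_simp
    ring
  rw [show √(n : ℝ) * |gridMidpoint a n x - x| = |√(n : ℝ) * (gridMidpoint a n x - x)| by
    rw [abs_mul, abs_of_pos hsn], gridMidpoint, e, abs_le]
  have h1 := Int.floor_le ((x - a) * √(n : ℝ))
  have h2 := (Int.lt_floor_add_one ((x - a) * √(n : ℝ))).le
  constructor <;> linarith

theorem isBigOP_gridMidpoint {𝒴 : Type*} [MeasurableSpace 𝒴] {M : ParametricModel 𝒴}
    {pilot : ∀ n : ℕ, (Fin n → 𝒴) → ℝ} (h : M.IsRootConsistent pilot θ₀) (a : ℕ → ℝ) :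
    IsBigOP atTop (fun n => M.sampleLaw θ₀ n)
      fun n y => √(n : ℝ) * (gridMidpoint (a n) n (pilot n y) - θ₀) := by
  intro ε hε
  obtain ⟨B, hB⟩ := h ε hε
  refine ⟨B + 1 / 2, ?_⟩
  filter_upwards [hB, eventually_gt_atTop 0] with n hn hpos
  refine (measure_mono fun y
    (hy : B + 1 / 2 < |√(n : ℝ) * (gridMidpoint (a n) n (pilot n y) - θ₀)|) => ?_).trans hn
  have h1 := abs_gridMidpoint_sub_le (a n) hpos (pilot n y)
  rw [abs_mul, abs_of_nonneg (Real.sqrt_nonneg _)] at hy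
  have h2 := mul_le_mul_of_nonneg_left (abs_sub_le (gridMidpoint (a n) n (pilot n y))
    (pilot n y) θ₀) (Real.sqrt_nonneg (n : ℝ))
  change B < √(n : ℝ) * |pilot n y - θ₀|
  linarith [mul_add (√(n : ℝ)) |gridMidpoint (a n) n (pilot n y) - pilot n y| |pilot n y - θ₀|]

end Pilot

/-- The window of width `n^{-1/2}` is negligible relative to the grid scale `n^{-1/4}`. -/
theorem abs_gridPoint_sub_le {J n : ℕ} (hn : 0 < n) {θ θ₀ B : ℝ}
    (hθ : √(n : ℝ) * |θ - θ₀| ≤ B) (j : Fin (2 * J + 1)) :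
    |gridPoint J n θ j - θ₀| ≤ (B + |gridIndex J j|) * gridScale n := by
  have hg := gridScale_pos hn
  have hsn : 0 < √(n : ℝ) := Real.sqrt_pos.2 (by exact_mod_cast hn)
  have hg1 : gridScale n ≤ 1 :=
    Real.rpow_le_one_of_one_le_of_nonpos (by exact_mod_cast hn) (by norm_num)
  have hB : 0 ≤ B := le_trans (by positivity) hθ
  have h1 : |θ - θ₀| ≤ B * gridScale n := by
    have e : gridScale n ^ 2 * √(n : ℝ) = 1 := by
      rw [gridScale_sq, inv_mul_cancel₀ hsn.ne']
    calc |θ - θ₀| = gridScale n ^ 2 * (√(n : ℝ) * |θ - θ₀|) := by rw [← mul_assoc, e, one_mul]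
      _ ≤ gridScale n ^ 2 * B := by gcongr
      _ ≤ B * gridScale n := by nlinarith [mul_nonneg hB hg.le]
  calc |gridPoint J n θ j - θ₀| = |(θ - θ₀) + gridIndex J j * gridScale n| := by
        rw [gridPoint]; ring_nf
    _ ≤ |θ - θ₀| + |gridIndex J j| * gridScale n := by
        refine (abs_add_le _ _).trans (le_of_eq ?_)
        rw [abs_mul, abs_of_pos hg]
    _ ≤ _ := by linarith

/-! ### The maximizer of a fitted cubic -/

section CubicFit

variable {Ω : ℕ → Type*} [∀ n, MeasurableSpace (Ω n)] {Pr : ∀ n, Measure (Ω n)} {J : ℕ}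
  {L L' : ∀ n, Fin (2 * J + 1) → Ω n → ℝ} {Z : ∀ n, Ω n → ℝ} {I : ℝ} {r : ℕ → ℝ}
  {χ χ' : ∀ n, Ω n → ℝ}

/-- The cubic fitted to the evaluations `L` behaves, at the scale `n^{-1/4}`, like
`Z x - I x² / 2` up to negligible terms. The coefficients are those in grid units, so that the
quadratic one has the order `n^{1/2}` and the linear one only the order `n^{1/4}`. -/
structure HasQuadraticFit (J : ℕ) (Pr : ∀ n, Measure (Ω n))
    (L : ∀ n, Fin (2 * J + 1) → Ω n → ℝ) (Z : ∀ n, Ω n → ℝ) (I : ℝ) : Prop where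
  one : IsLittleOP atTop Pr fun n ω => gridScale n * unitCoeff J (fun j => L n j ω) 1 - Z n ω
  two : IsLittleOP atTop Pr fun n ω =>
    gridScale n ^ 2 * unitCoeff J (fun j => L n j ω) 2 + I / 2
  three : IsLittleOP atTop Pr fun n ω => gridScale n ^ 2 * unitCoeff J (fun j => L n j ω) 3

theorem unitCoeff_sub (L L' : Fin (2 * J + 1) → ℝ) (k : Fin 4) :
    unitCoeff J L k - unitCoeff J L' k = ∑ j, lsWeight J k j * (L j - L' j) := by
  simp only [unitCoeff, ← Finset.sum_sub_distrib, mul_sub]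

/-- Least squares fits a locally cubic function with an accuracy of the order of the errors. -/
theorem HasQuadraticFit.of_cubic (hJ : 1 < J) {c : ℝ} {α : ∀ n, Ω n → ℝ}
    (h : ∀ j, IsLittleOP atTop Pr fun n ω => gridScale n * (L n j ω - α n ω) -
      (Z n ω * gridIndex J j - I / (2 * gridScale n) * gridIndex J j ^ 2 +
        c * gridIndex J j ^ 3)) : HasQuadraticFit J Pr L Z I := by
  have key : ∀ k, IsLittleOP atTop Pr fun n ω =>
      gridScale n * unitCoeff J (fun j => L n j ω) k -
        (gridScale n * α n ω * (if k = 0 then 1 else 0) + Z n ω * (if k = 1 then 1 else 0)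
          - I / (2 * gridScale n) * (if k = 2 then 1 else 0) + c * (if k = 3 then 1 else 0)) := by
    intro k
    refine (IsLittleOP.sum Finset.univ fun j _ => (h j).const_mul (lsWeight J k j)).congr_eq
      (Eventually.of_forall fun n ω => ?_)
    rw [← sum_lsWeight_mul_pow hJ k 0, ← sum_lsWeight_mul_pow hJ k 1,
      ← sum_lsWeight_mul_pow hJ k 2, ← sum_lsWeight_mul_pow hJ k 3, unitCoeff]
    simp only [Finset.mul_sum, ← Finset.sum_add_distrib, ← Finset.sum_sub_distrib]
    refine Finset.sum_congr rfl fun j _ => ?_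
    simp only [Fin.val_zero, Fin.val_one, Fin.val_two, show ((3 : Fin 4) : ℕ) = 3 from rfl]
    ring
  have hg := isLittleOP_of_tendsto (Pr := Pr) tendsto_gridScale
  refine ⟨(key 1).congr_eq (Eventually.of_forall fun n ω => by simp), ?_, ?_⟩
  · refine (hg.mul_isBigOP (key 2).isBigOP).congr_eq ?_
    filter_upwards [eventually_gt_atTop 0] with n hn ω
    have := (gridScale_pos hn).ne'
    simp
    field_simp
  · refine (hg.mul_isBigOP ((key 3).isBigOP.add (isBigOP_const c))).congr_eq
      (Eventually.of_forall fun n ω => ?_)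
    simp
    ring

/-- Errors in the coefficients that are of smaller order than `n^{1/4}` are harmless. -/
theorem HasQuadraticFit.congr (h : HasQuadraticFit J Pr L Z I)
    (hr : Tendsto (fun n => gridScale n * r n) atTop (𝓝 0)) (hr0 : ∀ᶠ n in atTop, r n ≠ 0)
    (hΔ : ∀ k, k ≠ 0 → IsBigOP atTop Pr fun n ω =>
      (unitCoeff J (fun j => L' n j ω) k - unitCoeff J (fun j => L n j ω) k) / r n) :
    HasQuadraticFit J Pr L' Z I := by
  have h1 : ∀ k, k ≠ 0 → IsLittleOP atTop Pr fun n ω => gridScale n *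
      (unitCoeff J (fun j => L' n j ω) k - unitCoeff J (fun j => L n j ω) k) := fun k hk => by
    refine ((isLittleOP_of_tendsto hr).mul_isBigOP (hΔ k hk)).congr_eq ?_
    filter_upwards [hr0] with n hn ω
    field_simp
  have hg := (isLittleOP_of_tendsto (Pr := Pr) tendsto_gridScale).isBigOP
  refine ⟨(h.one.add (h1 1 (by decide))).congr_eq (Eventually.of_forall fun n ω => by ring),
    (h.two.add (hg.mul_isLittleOP (h1 2 (by decide)))).congr_eq
      (Eventually.of_forall fun n ω => by ring),
    (h.three.add (hg.mul_isLittleOP (h1 3 (by decide)))).congr_eq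
      (Eventually.of_forall fun n ω => by ring)⟩

section Maximizer

variable (h : HasQuadraticFit J Pr L Z I) (hJ : 1 < J) (hI : 0 < I) (hZ : IsBigOP atTop Pr Z)
  (hχ : ∀ n ω, χ n ω ∈ Set.Icc (-(J : ℝ)) (J : ℝ))
  (hmax : ∀ n ω, IsMaxOn (fittedCubic J n fun j => L n j ω) (Set.Icc (-(J : ℝ)) (J : ℝ)) (χ n ω))
include h hJ hI hZ hχ hmax

/-- The maximizer is near the centre of the range, since the quadratic coefficient dominates the
others. -/
theorem HasQuadraticFit.isLittleOP_maximizer : IsLittleOP atTop Pr χ := by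
  refine isLittleOP_iff.2 fun ε hε => ?_
  have hg := isLittleOP_of_tendsto (Pr := Pr) tendsto_gridScale
  set η : ℝ := ε * (I / 4) / (2 * (1 + (J : ℝ) ^ 2)) with hη
  have hη0 : 0 < η := by positivity
  have h1 : IsLittleOP atTop Pr fun n ω =>
      gridScale n ^ 2 * unitCoeff J (fun j => L n j ω) 1 :=
    (hg.mul_isBigOP (h.one.isBigOP.add hZ)).congr_eq (Eventually.of_forall fun n ω => by ring)
  refine (((h1.asympSure_lt hη0).and (h.two.asympSure_lt (show 0 < I / 4 by positivity))).and
    (h.three.asympSure_lt hη0)).mono ?_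
  filter_upwards [eventually_gt_atTop 0] with n hn ω hω
  obtain ⟨⟨e1, e2⟩, e3⟩ := hω
  have hm : IsMaxOn (fun x => gridScale n ^ 2 * unitCoeff J (fun j => L n j ω) 1 * x +
      gridScale n ^ 2 * unitCoeff J (fun j => L n j ω) 2 * x ^ 2 +
      gridScale n ^ 2 * unitCoeff J (fun j => L n j ω) 3 * x ^ 3)
      (Set.Icc (-(J : ℝ)) (J : ℝ)) (χ n ω) := by
    intro x hx
    have := mul_le_mul_of_nonneg_left (hmax n ω hx) (sq_nonneg (gridScale n))
    simp only [fittedCubic_eq J hn] at this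
    simp only [Set.mem_ofPred_eq]
    linarith
  have := abs_maximizer_le (Nat.cast_nonneg J) (show 0 < I / 4 by positivity) e1.le
    (by linarith [(abs_lt.1 e2).2]) e3.le (hχ n ω) hm
  refine this.trans_lt ?_
  rw [hη]
  have e : ε * (I / 4) / (2 * (1 + (J : ℝ) ^ 2)) * (1 + (J : ℝ) ^ 2) / (I / 4) = ε / 2 := by
    field_simp
  rw [e]
  linarith

/-- The maximizer is eventually interior and thus a critical point. -/
theorem HasQuadraticFit.asympSure_first_order : AsympSure atTop Pr fun n ω =>
    unitCoeff J (fun j => L n j ω) 1 + 2 * unitCoeff J (fun j => L n j ω) 2 * χ n ω +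
      3 * unitCoeff J (fun j => L n j ω) 3 * χ n ω ^ 2 = 0 := by
  refine ((h.isLittleOP_maximizer hJ hI hZ hχ hmax).asympSure_lt
    (show (0 : ℝ) < J by positivity)).mono ?_
  filter_upwards [eventually_gt_atTop 0] with n hn ω hω
  refine maximizer_first_order hω fun x hx => ?_
  have := hmax n ω hx
  simpa only [fittedCubic_eq J hn] using this

end Maximizer

theorem isLittleOP_mul_inv_sub {D R E : ∀ n, Ω n → ℝ} (hI : 0 < I) (hD : IsBigOP atTop Pr D)
    (hR : IsLittleOP atTop Pr R) (hE : IsLittleOP atTop Pr fun n ω => E n ω - I) :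
    IsLittleOP atTop Pr fun n ω => (D n ω + R n ω) * (E n ω)⁻¹ - D n ω / I := by
  have h1 := hE.inv hI.ne'
  have h2 : IsBigOP atTop Pr fun n ω => (E n ω)⁻¹ :=
    (h1.isBigOP.add (isBigOP_const I⁻¹)).congr (Eventually.of_forall fun n ω => by ring)
  exact ((hD.mul_isLittleOP h1).add (hR.mul_isBigOP h2)).congr_eq
    (Eventually.of_forall fun n ω => by ring)

/-- The first-order condition makes the maximizer asymptotically equal to that of
`Z x - I x² / 2`. -/
theorem HasQuadraticFit.isLittleOP_maximizer_sub (h : HasQuadraticFit J Pr L Z I) (hJ : 1 < J)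
    (hI : 0 < I) (hZ : IsBigOP atTop Pr Z) (hχ : ∀ n ω, χ n ω ∈ Set.Icc (-(J : ℝ)) (J : ℝ))
    (hmax : ∀ n ω, IsMaxOn (fittedCubic J n fun j => L n j ω) (Set.Icc (-(J : ℝ)) (J : ℝ))
      (χ n ω)) :
    IsLittleOP atTop Pr fun n ω => χ n ω / gridScale n - Z n ω / I := by
  have hχ0 := h.isLittleOP_maximizer hJ hI hZ hχ hmax
  have hfoc := h.asympSure_first_order hJ hI hZ hχ hmax
  set E : ∀ n, Ω n → ℝ := fun n ω => -(2 * (gridScale n ^ 2 * unitCoeff J (fun j => L n j ω) 2) +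
    3 * (gridScale n ^ 2 * unitCoeff J (fun j => L n j ω) 3 * χ n ω)) with hEdef
  have hE : IsLittleOP atTop Pr fun n ω => E n ω - I :=
    ((h.two.const_mul (-2)).add ((h.three.mul_isBigOP hχ0.isBigOP).const_mul (-3))).congr_eq
      (Eventually.of_forall fun n ω => by simp only [hEdef]; ring)
  refine (isLittleOP_mul_inv_sub hI hZ h.one hE).congr ?_
  refine (hfoc.and (hE.asympSure_lt hI)).mono ?_
  filter_upwards [eventually_gt_atTop 0] with n hn ω hω
  have hE0 : E n ω ≠ 0 := by
    intro h0
    have := hω.2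
    rw [h0, zero_sub, abs_neg, abs_of_pos hI] at this
    exact lt_irrefl _ this
  have hg := (gridScale_pos hn).ne'
  have e : χ n ω / gridScale n * E n ω = gridScale n * unitCoeff J (fun j => L n j ω) 1 := by
    simp only [hEdef]
    field_simp
    linear_combination (-1) * hω.1
  rw [add_sub_cancel, ← e, mul_assoc, mul_inv_cancel₀ hE0, mul_one]

/-- The effect on the maximizer of a perturbation of the evaluations is linear in that of the
linear coefficient. -/
theorem HasQuadraticFit.isLittleOP_maximizer_diff (h : HasQuadraticFit J Pr L Z I) (hJ : 1 < J)
    (hI : 0 < I) (hZ : IsBigOP atTop Pr Z)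
    (hr : Tendsto (fun n => gridScale n * r n) atTop (𝓝 0)) (hr0 : ∀ᶠ n in atTop, r n ≠ 0)
    (hΔ : ∀ k, k ≠ 0 → IsBigOP atTop Pr fun n ω =>
      (unitCoeff J (fun j => L' n j ω) k - unitCoeff J (fun j => L n j ω) k) / r n)
    (hχ : ∀ n ω, χ n ω ∈ Set.Icc (-(J : ℝ)) (J : ℝ))
    (hmax : ∀ n ω, IsMaxOn (fittedCubic J n fun j => L n j ω) (Set.Icc (-(J : ℝ)) (J : ℝ))
      (χ n ω))
    (hχ' : ∀ n ω, χ' n ω ∈ Set.Icc (-(J : ℝ)) (J : ℝ))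
    (hmax' : ∀ n ω, IsMaxOn (fittedCubic J n fun j => L' n j ω) (Set.Icc (-(J : ℝ)) (J : ℝ))
      (χ' n ω)) :
    IsLittleOP atTop Pr fun n ω => (χ' n ω - χ n ω) / (gridScale n ^ 2 * r n) -
      (unitCoeff J (fun j => L' n j ω) 1 - unitCoeff J (fun j => L n j ω) 1) / r n / I := by
  have h' := h.congr hr hr0 hΔ
  have hχ0 := h.isLittleOP_maximizer hJ hI hZ hχ hmax
  have hχ0' := h'.isLittleOP_maximizer hJ hI hZ hχ' hmax'
  have hfoc := h.asympSure_first_order hJ hI hZ hχ hmax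
  have hfoc' := h'.asympSure_first_order hJ hI hZ hχ' hmax'
  set E : ∀ n, Ω n → ℝ := fun n ω => -(2 * (gridScale n ^ 2 * unitCoeff J (fun j => L n j ω) 2) +
    3 * (gridScale n ^ 2 * unitCoeff J (fun j => L n j ω) 3 * (χ n ω + χ' n ω))) with hEdef
  have hE : IsLittleOP atTop Pr fun n ω => E n ω - I :=
    ((h.two.const_mul (-2)).add
      ((h.three.mul_isBigOP (hχ0.add hχ0').isBigOP).const_mul (-3))).congr_eq
      (Eventually.of_forall fun n ω => by simp only [hEdef]; ring)
  have hR := (((hΔ 2 (by decide)).mul_isLittleOP hχ0').const_mul 2).add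
    (((hΔ 3 (by decide)).mul_isLittleOP (hχ0'.mul_isBigOP hχ0'.isBigOP)).const_mul 3)
  refine (isLittleOP_mul_inv_sub hI (hΔ 1 (by decide)) hR hE).congr ?_
  refine ((hfoc.and hfoc').and (hE.asympSure_lt hI)).mono ?_
  filter_upwards [eventually_gt_atTop 0, hr0] with n hn hrn ω hω
  obtain ⟨⟨f, f'⟩, hE1⟩ := hω
  have hE0 : E n ω ≠ 0 := by
    intro h0
    rw [h0, zero_sub, abs_neg, abs_of_pos hI] at hE1
    exact lt_irrefl _ hE1
  have hg := (gridScale_pos hn).ne'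
  congr 1
  rw [eq_mul_inv_iff_mul_eq₀ hE0]
  simp only [hEdef]
  field_simp
  linear_combination f - f'

end CubicFit

/-! ### The cubic fit to the exact log-likelihood -/

theorem IsLittleOP.comp {ι : Type*} {l : Filter ι} {Ω Ω' : ι → Type*}
    [∀ i, MeasurableSpace (Ω i)] [∀ i, MeasurableSpace (Ω' i)] {Pr : ∀ i, Measure (Ω i)}
    {Pr' : ∀ i, Measure (Ω' i)} {X : ∀ i, Ω i → ℝ} {T : ∀ i, Ω' i → Ω i}
    (hX : IsLittleOP l Pr X) (hT : ∀ i, Measurable (T i))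
    (hlaw : ∀ i, (Pr' i).map (T i) = Pr i) : IsLittleOP l Pr' fun i ω => X i (T i ω) :=
  isLittleOP_iff.2 fun _ hε => (hX.asympSure_lt hε).comp hT hlaw

/-- The central limit theorem for samples realized as coordinates of product spaces. -/
theorem tendstoInDistribution_sum_sample {𝒴 : Type*} [MeasurableSpace 𝒴] {P : Measure 𝒴}
    [IsProbabilityMeasure P] {f : 𝒴 → ℝ} (hf : Measurable f) (h0 : ∫ y, f y ∂P = 0) {v : ℝ≥0}
    (hv : 0 < v) (h2 : ∫ y, f y ^ 2 ∂P = v) :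
    TendstoInDistribution (fun (n : ℕ) (y : Fin n → 𝒴) => (√(n : ℝ))⁻¹ * ∑ k, f (y k)) atTop
      (fun z : ℝ => z) (fun n => Measure.pi fun _ : Fin n => P) (gaussianReal 0 v) := by
  have hv' : (0 : ℝ) < v := hv
  have hσ : 0 < √(v : ℝ) := Real.sqrt_pos.2 hv'
  refine (tendstoInDistribution_gaussian_iff (fun n => (Measurable.const_mul
    (Finset.measurable_fun_sum _ fun k _ => hf.comp (measurable_pi_apply k)) _).aemeasurable) v).2
    fun t => ?_
  have h1 : P[(fun y => (√(v : ℝ))⁻¹ * f y) ^ 2] = 1 := by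
    have : ((fun y => (√(v : ℝ))⁻¹ * f y) ^ 2) = fun y => (v : ℝ)⁻¹ * f y ^ 2 := by
      funext y
      rw [Pi.pow_apply, mul_pow, inv_pow, Real.sq_sqrt hv'.le]
    rw [this, integral_const_mul, h2, inv_mul_cancel₀ hv'.ne']
  have key := tendsto_charFun_inv_sqrt_mul_pow (P := P) (X := fun y => (√(v : ℝ))⁻¹ * f y)
    (hf.const_mul _).aemeasurable (by rw [integral_const_mul, h0, mul_zero]) h1 (√(v : ℝ) * t)
  have e1 : Complex.exp (-(((√(v : ℝ) * t : ℝ) : ℂ)) ^ 2 / 2) =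
      Complex.exp (-(v * (t ^ 2 / 2) : ℝ)) := by
    congr 1
    rw [← Complex.ofReal_pow, mul_pow, Real.sq_sqrt hv'.le]
    push_cast
    ring
  rw [e1] at key
  refine key.congr fun n => ?_
  rw [charFun_apply_real, integral_map (hf.const_mul _).aemeasurable (by fun_prop),
    ← Fintype.card_fin n, ← integral_fintype_prod_eq_pow, Fintype.card_fin]
  refine integral_congr_ae (Eventually.of_forall fun y => ?_)
  simp only
  rw [← Complex.exp_sum]
  congr 1
  push_cast
  rw [← Finset.sum_mul, ← Finset.mul_sum, ← Finset.mul_sum]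
  have : (((√(v : ℝ) : ℝ)) : ℂ) ≠ 0 := by exact_mod_cast hσ.ne'
  field_simp
  rfl

namespace ParametricModel

variable {𝒴 : Type*} [MeasurableSpace 𝒴] {M : ParametricModel 𝒴} {ds : M.Derivs} {θ₀ : ℝ}

theorem fisher_pos (hM : M.IsRegular ds) (h₀ : θ₀ ∈ M.Θ) : 0 < M.fisher ds θ₀ :=
  lt_of_le_of_ne (integral_nonneg fun _ => sq_nonneg _)
    (hM.regular θ₀ h₀).second_moment_dotI.symm

theorem isProbabilityMeasure_sampleLaw (h₀ : θ₀ ∈ M.Θ) (n : ℕ) :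
    IsProbabilityMeasure (M.sampleLaw θ₀ n) := by
  have := M.isProbabilityMeasure_P h₀
  unfold sampleLaw
  infer_instance

theorem tendstoInDistribution_scoreSum [∀ n, IsProbabilityMeasure (M.sampleLaw θ₀ n)]
    (hM : M.IsRegular ds) (h₀ : θ₀ ∈ M.Θ) {c : ℝ} (hc : 0 < c)
    {w : ℝ≥0} (hw : (w : ℝ) = c ^ 2 * M.fisher ds θ₀) :
    TendstoInDistribution (fun (n : ℕ) (y : Fin n → 𝒴) => c * M.scoreSum ds θ₀ y) atTop
      (fun z : ℝ => z) (fun n => M.sampleLaw θ₀ n) (gaussianReal 0 w) := by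
  have := M.isProbabilityMeasure_P h₀
  have hI := fisher_pos hM h₀
  have hw0 : (0 : ℝ) < w := by rw [hw]; positivity
  have := tendstoInDistribution_sum_sample (P := M.P θ₀) (f := fun y => c * M.dotI ds 0 θ₀ y)
    ((M.measurable_dotI ds 0 θ₀).const_mul c)
    (by rw [integral_const_mul, integral_dotI_zero h₀ (hM.regular θ₀ h₀), mul_zero])
    (v := w) (by exact_mod_cast hw0)
    (by simp only [mul_pow]; rw [integral_const_mul, hw, fisher])
  simp only [scoreSum]
  simpa only [← Finset.mul_sum, mul_left_comm] using! this

theorem isBigOP_scoreSum (hM : M.IsRegular ds) (h₀ : θ₀ ∈ M.Θ) :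
    IsBigOP atTop (fun n => M.sampleLaw θ₀ n) fun _ y => M.scoreSum ds θ₀ y := by
  have := M.isProbabilityMeasure_sampleLaw h₀
  have h := tendstoInDistribution_scoreSum hM h₀ one_pos
    (w := (M.fisher ds θ₀).toNNReal) (by rw [Real.coe_toNNReal _ (fisher_pos hM h₀).le]; ring)
  simp only [one_mul] at h
  exact _root_.TendstoInDistribution.isBigOP h

/-- The cubic fitted to the exact log-likelihood around a discretized `√n`-consistent estimator
satisfies the local asymptotic quadratic expansion recentred at that estimator. -/
theorem hasQuadraticFit_logLik (hM : M.IsRegular ds) (h₀ : θ₀ ∈ M.Θ) {J : ℕ} (hJ : 1 < J)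
    {a : ℕ → ℝ} {θs : ∀ n, (Fin n → 𝒴) → ℝ}
    (hgrid : ∀ n y, ∃ k : ℤ, θs n y = a n + ((k : ℝ) + 1 / 2) / √(n : ℝ))
    (hθ : IsBigOP atTop (fun n => M.sampleLaw θ₀ n) fun n y => √(n : ℝ) * (θs n y - θ₀)) :
    HasQuadraticFit J (fun n => M.sampleLaw θ₀ n)
      (fun n j y => M.logLik y (gridPoint J n (θs n y) j))
      (fun n y => M.scoreSum ds θ₀ y - M.fisher ds θ₀ * (√(n : ℝ) * (θs n y - θ₀)))
      (M.fisher ds θ₀) := by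
  set c := M.cubicCoeff ds θ₀
  refine HasQuadraticFit.of_cubic hJ (c := c) (α := fun n y => M.logLik y θ₀) fun j => ?_
  have h1 : IsLittleOP atTop (fun n => M.sampleLaw θ₀ n) fun n y => gridScale n *
      (M.logLik y (θ₀ + (gridPoint J n (θs n y) j - θ₀)) - M.logLik y θ₀ -
        M.localCubic ds θ₀ y (gridPoint J n (θs n y) j - θ₀)) := by
    refine IsLittleOP.of_window (X := fun n θ y => gridScale n *
      (M.logLik y (θ₀ + (gridPoint J n θ j - θ₀)) - M.logLik y θ₀ -
        M.localCubic ds θ₀ y (gridPoint J n θ j - θ₀))) hgrid hθ fun B => ?_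
    refine isLittleOP_logLik_sub_localCubic hM h₀ (l := windowFilter θ₀ B) (n := Prod.fst)
      (h := fun p => gridPoint J p.1 p.2 j - θ₀) (T := B + |gridIndex J j|)
      (tendsto_fst_windowFilter θ₀ B) ?_
    rw [eventually_windowFilter]
    filter_upwards [eventually_gt_atTop 0] with n hn θ hθn
    exact abs_gridPoint_sub_le hn hθn j
  have hS := isBigOP_scoreSum hM h₀
  have hg := isLittleOP_of_tendsto (Pr := fun n => M.sampleLaw θ₀ n) tendsto_gridScale
  set D : ∀ n : ℕ, (Fin n → 𝒴) → ℝ := fun n y => √(n : ℝ) * (θs n y - θ₀) with hD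
  have hrem := (((((hθ.mul hS).sub ((hθ.mul hθ).const_mul (M.fisher ds θ₀ / 2))).add
    (hθ.const_mul (3 * c * gridIndex J j ^ 2))).add
    (((hg.isBigOP.mul (hθ.mul hθ))).const_mul (3 * c * gridIndex J j))).add
    (((hg.isBigOP.mul hg.isBigOP).mul (hθ.mul (hθ.mul hθ))).const_mul c))
  refine (h1.add (hg.mul_isBigOP hrem)).congr_eq ?_
  filter_upwards [eventually_gt_atTop 0] with n hn y
  have hg0 := (gridScale_pos hn).ne'
  have hsn : √(n : ℝ) ≠ 0 := (Real.sqrt_pos.2 (by exact_mod_cast hn)).ne'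
  have eg : √(n : ℝ) = (gridScale n ^ 2)⁻¹ := by rw [gridScale_sq, inv_inv]
  have en : (n : ℝ) = (gridScale n ^ 4)⁻¹ :=
    eq_inv_of_mul_eq_one_left (natCast_mul_gridScale_pow hn)
  have e1 : gridPoint J n (θs n y) j - θ₀ =
      gridScale n ^ 2 * D n y + gridIndex J j * gridScale n := by
    rw [gridScale_sq]
    simp only [hD]
    rw [inv_mul_cancel_left₀ hsn, gridPoint]
    ring
  have e2 : ∑ k, M.dotI ds 0 θ₀ (y k) = (gridScale n ^ 2)⁻¹ * M.scoreSum ds θ₀ y := by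
    rw [scoreSum, ← eg, mul_inv_cancel_left₀ hsn]
  rw [localCubic, e2, add_sub_cancel, e1]
  rw [show √(n : ℝ) * (θs n y - θ₀) = D n y from rfl]
  generalize D n y = d
  generalize M.scoreSum ds θ₀ y = s
  generalize M.logLik y _ = l₁
  generalize M.logLik y θ₀ = l₂
  rw [show M.cubicCoeff ds θ₀ = c from rfl, en]
  field_simp
  ring

end ParametricModel

/-! ### Efficiency under the Monte Carlo model -/

/-- Convergence in distribution may be checked on the image space. -/
theorem tendstoInDistribution_comp {Ω Ω' : ℕ → Type*} [∀ n, MeasurableSpace (Ω n)]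
    [∀ n, MeasurableSpace (Ω' n)] {Pr : ∀ n, Measure (Ω n)} {Pr' : ∀ n, Measure (Ω' n)}
    [∀ n, IsProbabilityMeasure (Pr n)] [∀ n, IsProbabilityMeasure (Pr' n)]
    {X : ∀ n, Ω n → ℝ} {T : ∀ n, Ω' n → Ω n} {v : ℝ≥0}
    (hX : TendstoInDistribution X atTop (fun z : ℝ => z) Pr (gaussianReal 0 v))
    (hT : ∀ n, Measurable (T n)) (hlaw : ∀ n, (Pr' n).map (T n) = Pr n) :
    TendstoInDistribution (fun n ω => X n (T n ω)) atTop (fun z : ℝ => z) Pr'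
      (gaussianReal 0 v) := by
  have hXm := hX.forall_aemeasurable
  refine (tendstoInDistribution_gaussian_iff (fun n => ?_) v).2 fun t => ?_
  · have := hXm n
    rw [← hlaw n] at this
    exact this.comp_measurable (hT n)
  · refine ((tendstoInDistribution_gaussian_iff hXm v).1 hX t).congr fun n => ?_
    have hm : AEMeasurable (fun ω => Complex.exp ((t * X n ω : ℝ) * Complex.I)) (Pr n) := by
      have := hXm n
      fun_prop
    rw [← hlaw n] at hm ⊢
    rw [integral_map (hT n).aemeasurable hm.aestronglyMeasurable]

section SampleSize

variable {m : ℕ → ℕ} (hm : Tendsto (fun n : ℕ => (m n : ℝ) / √(n : ℝ)) atTop atTop)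
include hm

theorem eventually_simulations_pos : ∀ᶠ n in atTop, 0 < m n := by
  filter_upwards [hm.eventually_gt_atTop 0] with n hn
  by_contra h
  have : m n = 0 := by omega
  simp [this] at hn

theorem tendsto_sqrt_div_simulations :
    Tendsto (fun n : ℕ => √(n : ℝ) / m n) atTop (𝓝 0) := by
  refine hm.inv_tendsto_atTop.congr fun n => ?_
  rw [Pi.inv_apply, inv_div]

theorem tendsto_gridScale_mul_biasScale :
    Tendsto (fun n : ℕ => gridScale n * ((n : ℝ) / m n * gridScale n)) atTop (𝓝 0) := by
  refine (tendsto_sqrt_div_simulations hm).congr' ?_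
  filter_upwards [eventually_gt_atTop 0] with n hn
  have hsn : √(n : ℝ) ≠ 0 := (Real.sqrt_pos.2 (by exact_mod_cast hn)).ne'
  rw [show gridScale n * ((n : ℝ) / m n * gridScale n) = n / m n * gridScale n ^ 2 by ring,
    gridScale_sq]
  nth_rewrite 2 [← Real.sq_sqrt (Nat.cast_nonneg n)]
  field_simp

theorem tendsto_gridScale_mul_noiseScale :
    Tendsto (fun n : ℕ => gridScale n * (√((m n : ℝ) / n))⁻¹) atTop (𝓝 0) := by
  have h := (Real.continuous_sqrt.tendsto 0).comp (tendsto_gridScale_mul_biasScale hm)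
  rw [Real.sqrt_zero] at h
  refine h.congr fun n => ?_
  rw [Function.comp_apply, ← Real.sqrt_inv, inv_div,
    show gridScale n * ((n : ℝ) / m n * gridScale n) = gridScale n ^ 2 * (n / m n) by ring,
    Real.sqrt_mul (sq_nonneg _), Real.sqrt_sq (gridScale_nonneg n)]

end SampleSize

/-- The squared Monte Carlo standard error, in terms of the variance factor of the regression in
grid units. -/
theorem seMC_sq {𝒴 : Type*} [MeasurableSpace 𝒴] (M : ParametricModel 𝒴) {J : ℕ} (hJ : 1 < J)
    (m : ℕ → ℕ) (ds : M.Derivs) (θ₀ τ : ℝ) {n : ℕ} (hn : 0 < n) :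
    seMC M J m ds θ₀ τ n ^ 2 =
      (n : ℝ) / m n * τ ^ 2 * (unitVar J / gridScale n ^ 2) / (n * M.fisher ds θ₀) ^ 2 := by
  have := unitVar_pos hJ
  rw [seMC, inv_gram_designMatrix_one_one J hn, Real.sq_sqrt (by positivity)]

section Efficiency

variable {𝒴 : Type*} [MeasurableSpace 𝒴] {M : ParametricModel 𝒴} {ds : M.Derivs} {θ₀ : ℝ}

/-- Under the Monte Carlo model, bias and noise change the fitted coefficients by less than
`n^{1/4}`. So all three estimators are asymptotically linear in the score, and their differences
are linear in the perturbations of the linear coefficient. -/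
theorem MonteCarloModel.isEfficientMCLE (hM : M.IsRegular ds) (hθ₀ : θ₀ ∈ M.Θ) {J : ℕ}
    (hJ : 1 < J) {m : ℕ → ℕ} (hm : Tendsto (fun n : ℕ => (m n : ℝ) / √(n : ℝ)) atTop atTop)
    {Ω : ℕ → Type*} [∀ n, MeasurableSpace (Ω n)] {Pr : ∀ n, Measure (Ω n)}
    [∀ n, IsProbabilityMeasure (Pr n)] {Y : ∀ n, Ω n → Fin n → 𝒴} (hY : ∀ n, Measurable (Y n))
    (hY_law : ∀ n, (Pr n).map (Y n) = M.sampleLaw θ₀ n)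
    {pilot : ∀ n : ℕ, (Fin n → 𝒴) → ℝ} (hpilot : M.IsRootConsistent pilot θ₀) {a : ℕ → ℝ}
    {Lbar : ∀ n, Fin (2 * J + 1) → Ω n → ℝ} {γ : ℕ → ℝ → ℝ} {C τ : ℝ}
    (hMC : MonteCarloModel M J m Pr Y (fun n ω => gridMidpoint (a n) n (pilot n (Y n ω)))
      Lbar γ C τ) :
    IsEfficientMCLE M J m Pr Y (fun n ω => gridMidpoint (a n) n (pilot n (Y n ω))) ds θ₀
      Lbar γ C τ := by
  have hprob := M.isProbabilityMeasure_sampleLaw hθ₀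
  set I := M.fisher ds θ₀ with hIdef
  have hI : 0 < I := ParametricModel.fisher_pos hM hθ₀
  have hτ := hMC.pos
  have hV := unitVar_pos hJ
  set θs : ∀ n, Ω n → ℝ := fun n ω => gridMidpoint (a n) n (pilot n (Y n ω)) with hθs
  set S : ∀ n, Ω n → ℝ := fun n ω => M.scoreSum ds θ₀ (Y n ω) with hS
  have hpil := isBigOP_gridMidpoint hpilot a
  have hSO : IsBigOP atTop Pr S := (ParametricModel.isBigOP_scoreSum hM hθ₀).comp hY hY_law
  have hDO : IsBigOP atTop Pr fun n ω => √(n : ℝ) * (θs n ω - θ₀) := hpil.comp hY hY_law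
  set Z : ∀ n, Ω n → ℝ := fun n ω => S n ω - I * (√(n : ℝ) * (θs n ω - θ₀)) with hZdef
  have hZ : IsBigOP atTop Pr Z := hSO.sub (hDO.const_mul I)
  -- the exact log-likelihood, the one with the Monte Carlo bias, and the evaluations
  set L₀ : ∀ n, Fin (2 * J + 1) → Ω n → ℝ :=
    fun n j ω => M.logLik (Y n ω) (gridPoint J n (θs n ω) j) with hL₀
  set L₁ : ∀ n, Fin (2 * J + 1) → Ω n → ℝ :=
    fun n j ω => L₀ n j ω + γ n (gridPoint J n (θs n ω) j) with hL₁
  have fit₀ : HasQuadraticFit J Pr L₀ Z I := by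
    have h := ParametricModel.hasQuadraticFit_logLik hM hθ₀ hJ
      (fun n y => exists_gridMidpoint_eq a n (pilot n y)) hpil
    exact ⟨h.one.comp hY hY_law, h.two.comp hY hY_law, h.three.comp hY hY_law⟩
  have hmpos := eventually_simulations_pos hm
  -- the sizes of the bias and the noise of the evaluations
  set r₁ : ℕ → ℝ := fun n => (n : ℝ) / m n * gridScale n with hr₁
  set r₂ : ℕ → ℝ := fun n => (√((m n : ℝ) / n))⁻¹ with hr₂
  have hr₁t : Tendsto (fun n => gridScale n * r₁ n) atTop (𝓝 0) :=
    tendsto_gridScale_mul_biasScale hm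
  have hr₂t : Tendsto (fun n => gridScale n * r₂ n) atTop (𝓝 0) :=
    tendsto_gridScale_mul_noiseScale hm
  have hr₁0 : ∀ᶠ n in atTop, 0 < r₁ n := by
    filter_upwards [hmpos, eventually_gt_atTop 0] with n h1 h2
    have := gridScale_pos h2
    simp only [hr₁]
    positivity
  have hr₂0 : ∀ᶠ n in atTop, 0 < r₂ n := by
    filter_upwards [hmpos, eventually_gt_atTop 0] with n h1 h2
    simp only [hr₂]
    positivity
  have hbias : ∀ k : Fin 4, k ≠ 0 → IsLittleOP atTop Pr fun n ω =>
      (unitCoeff J (fun j => L₁ n j ω) k - unitCoeff J (fun j => L₀ n j ω) k) / r₁ n -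
        C * (if k = 1 then 1 else 0) := by
    intro k hk
    refine (IsLittleOP.sum Finset.univ fun j _ =>
      IsLittleOP.const_mul (hMC.bias j) (lsWeight J k j)).congr_eq
        (Eventually.of_forall fun n ω => ?_)
    -- the weights of the `k`-th coefficient annihilate the constant `γ(θ*_n)`
    have h0 := sum_lsWeight_mul_pow hJ k 0
    rw [if_neg hk] at h0
    simp only [Fin.val_zero, pow_zero, mul_one] at h0
    have h1 := sum_lsWeight_mul_pow hJ k 1
    simp only [Fin.val_one, pow_one] at h1
    rw [unitCoeff_sub, ← h1]
    have e : ∀ j, L₁ n j ω - L₀ n j ω = γ n (gridPoint J n (θs n ω) j) := fun j => by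
      simp only [hL₁, add_sub_cancel_left]
    simp only [e]
    have h2 : ∑ j, lsWeight J k j * (γ n (θs n ω) / r₁ n) = 0 := by
      rw [← Finset.sum_mul, h0, zero_mul]
    rw [Finset.mul_sum, Finset.sum_div, ← sub_zero (_ - _), ← h2, ← Finset.sum_sub_distrib,
      ← Finset.sum_sub_distrib]
    refine Finset.sum_congr rfl fun j _ => ?_
    simp only [hθs, hr₁]
    ring
  have hnoise : ∀ k : Fin 4, ∀ n ω,
      (unitCoeff J (fun j => Lbar n j ω) k - unitCoeff J (fun j => L₁ n j ω) k) / r₂ n =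
        ∑ j, lsWeight J k j * (√((m n : ℝ) / n) * (Lbar n j ω -
          M.logLik (Y n ω) (gridPoint J n (θs n ω) j) - γ n (gridPoint J n (θs n ω) j))) := by
    intro k n ω
    rw [unitCoeff_sub, Finset.sum_div]
    refine Finset.sum_congr rfl fun j _ => ?_
    simp only [hr₂, hL₁, hL₀, div_inv_eq_mul]
    ring
  have hΔ₁ : ∀ k : Fin 4, k ≠ 0 → IsBigOP atTop Pr fun n ω =>
      (unitCoeff J (fun j => L₁ n j ω) k - unitCoeff J (fun j => L₀ n j ω) k) / r₁ n :=
    fun k hk => ((hbias k hk).isBigOP.add (isBigOP_const (C * (if k = 1 then 1 else 0)))).congr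
      (Eventually.of_forall fun n ω => by ring)
  have hΔ₂ : ∀ k : Fin 4, k ≠ 0 → IsBigOP atTop Pr fun n ω =>
      (unitCoeff J (fun j => Lbar n j ω) k - unitCoeff J (fun j => L₁ n j ω) k) / r₂ n := by
    intro k _
    refine (_root_.TendstoInDistribution.isBigOP
      (_root_.TendstoInDistribution.linearCombination_gaussian hMC.noise (lsWeight J k)
        (w := ⟨τ ^ 2 * ∑ j, lsWeight J k j ^ 2, by positivity⟩) ?_)).congr
        (Eventually.of_forall fun n ω => hnoise k n ω)
    rw [Real.coe_toNNReal _ (sq_nonneg τ)]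
    rfl
  have fit₁ : HasQuadraticFit J Pr L₁ Z I :=
    fit₀.congr hr₁t (hr₁0.mono fun _ h => h.ne') hΔ₁
  have fit₂ : HasQuadraticFit J Pr Lbar Z I :=
    fit₁.congr hr₂t (hr₂0.mono fun _ h => h.ne') hΔ₂
  intro est estBias estExact mest mestBias mestExact hest hestBias hestExact
  choose χ₂ hχ₂ hmax₂ hest using hest
  choose χ₁ hχ₁ hmax₁ hestBias using hestBias
  choose χ₀ hχ₀ hmax₀ hestExact using hestExact
  have heg : ∀ {n : ℕ}, 0 < n → √(n : ℝ) = (gridScale n ^ 2)⁻¹ := fun _ => by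
    rw [gridScale_sq, inv_inv]
  -- as `√n = gridScale⁻²`, the maximizer `χ` in grid units is on the scale `gridScale` in
  -- `√n (θs + gridScale χ - θ₀)`, and the part of `Z` from the centre `θs` cancels
  have linear : ∀ {L : ∀ n, Fin (2 * J + 1) → Ω n → ℝ} {χ e : ∀ n, Ω n → ℝ},
      HasQuadraticFit J Pr L Z I → (∀ n ω, χ n ω ∈ Set.Icc (-(J : ℝ)) (J : ℝ)) →
      (∀ n ω, IsMaxOn (fittedCubic J n fun j => L n j ω) (Set.Icc (-(J : ℝ)) (J : ℝ)) (χ n ω)) →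
      (∀ n ω, e n ω = θs n ω + gridScale n * χ n ω) →
      IsLittleOP atTop Pr fun n ω => √(n : ℝ) * (e n ω - θ₀) - S n ω / I := by
    intro L χ e hfit hχ hmax he
    refine (hfit.isLittleOP_maximizer_sub hJ hI hZ hχ hmax).congr_eq ?_
    filter_upwards [eventually_gt_atTop 0] with n hn ω
    have hg := (gridScale_pos hn).ne'
    simp only [hZdef, he n ω]
    rw [heg hn]
    field_simp
    ring
  have lin₂ := linear fit₂ hχ₂ hmax₂ hest
  have lin₀ := linear fit₀ hχ₀ hmax₀ hestExact
  have hd₁ : IsLittleOP atTop Pr fun n ω => m n * (estBias n ω - estExact n ω) - C / I := by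
    refine ((fit₀.isLittleOP_maximizer_diff hJ hI hZ hr₁t (hr₁0.mono fun _ h => h.ne') hΔ₁ hχ₀
      hmax₀ hχ₁ hmax₁).add ((hbias 1 (by decide)).const_mul I⁻¹)).congr_eq ?_
    filter_upwards [eventually_gt_atTop 0, hmpos] with n hn hmn ω
    have hg := (gridScale_pos hn).ne'
    have hn' : (n : ℝ) ≠ 0 := by exact_mod_cast hn.ne'
    have hmn' : (m n : ℝ) ≠ 0 := by exact_mod_cast hmn.ne'
    have en : (n : ℝ) = (gridScale n ^ 4)⁻¹ :=
      eq_inv_of_mul_eq_one_left (natCast_mul_gridScale_pow hn)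
    rw [hestBias, hestExact]
    have e1 : (χ₁ n ω - χ₀ n ω) / (gridScale n ^ 2 * r₁ n) =
        m n * (gridScale n * (χ₁ n ω - χ₀ n ω)) := by
      simp only [hr₁]
      rw [en]
      field_simp
    rw [e1]
    simp only [if_true]
    ring
  have hd₂ : IsLittleOP atTop Pr fun n ω => (est n ω - estBias n ω) / seMC M J m ds θ₀ τ n -
      ∑ j, (lsWeight J 1 j / (τ * √(unitVar J))) * (√((m n : ℝ) / n) * (Lbar n j ω -
          M.logLik (Y n ω) (gridPoint J n (θs n ω) j) - γ n (gridPoint J n (θs n ω) j))) := by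
    refine ((fit₁.isLittleOP_maximizer_diff hJ hI hZ hr₂t (hr₂0.mono fun _ h => h.ne') hΔ₂ hχ₁
      hmax₁ hχ₂ hmax₂).const_mul (I / (τ * √(unitVar J)))).congr_eq ?_
    filter_upwards [eventually_gt_atTop 0, hmpos, hr₂0] with n hn hmn hr ω
    have hg := gridScale_pos hn
    have hn' : (0 : ℝ) < n := by exact_mod_cast hn
    have hmn' : (0 : ℝ) < m n := by exact_mod_cast hmn
    have en : (n : ℝ) * gridScale n ^ 4 = 1 := natCast_mul_gridScale_pow hn
    have hVs : 0 < √(unitVar J) := Real.sqrt_pos.2 hV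
    have ese : seMC M J m ds θ₀ τ n = r₂ n * (τ * √(unitVar J)) / (gridScale n * (n * I)) := by
      rw [← Real.sqrt_sq (show 0 ≤ r₂ n * (τ * √(unitVar J)) / (gridScale n * (n * I)) by
        positivity), seMC, inv_gram_designMatrix_one_one J hn]
      congr 1
      rw [div_pow, mul_pow (r₂ n), mul_pow τ, Real.sq_sqrt hV.le]
      simp only [hr₂]
      rw [inv_pow, Real.sq_sqrt (by positivity), ← hIdef]
      field_simp
    rw [ese, hest, hestBias]
    have e2 := hnoise 1 n ω
    have e3 : ∑ j, (lsWeight J 1 j / (τ * √(unitVar J))) * (√((m n : ℝ) / n) * (Lbar n j ω -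
          M.logLik (Y n ω) (gridPoint J n (θs n ω) j) - γ n (gridPoint J n (θs n ω) j))) =
        (unitCoeff J (fun j => Lbar n j ω) 1 - unitCoeff J (fun j => L₁ n j ω) 1) / r₂ n /
          (τ * √(unitVar J)) := by
      rw [e2, Finset.sum_div]
      exact Finset.sum_congr rfl fun j _ => by ring
    rw [e3]
    generalize (unitCoeff J (fun j => Lbar n j ω) 1 - unitCoeff J (fun j => L₁ n j ω) 1) / r₂ n
      = b
    have e4 : (θs n ω + gridScale n * χ₂ n ω - (θs n ω + gridScale n * χ₁ n ω)) /
        (r₂ n * (τ * √(unitVar J)) / (gridScale n * (n * I))) =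
        I / (τ * √(unitVar J)) * ((χ₂ n ω - χ₁ n ω) / (gridScale n ^ 2 * r₂ n)) *
          (n * gridScale n ^ 4) := by
      field_simp
      ring
    rw [e4, en]
    field_simp
  refine ⟨?_, ?_, ?_, ?_, ?_, ?_, hd₁, ?_⟩
  · simpa only [TendstoInProb, sub_zero, IsLittleOP] using lin₂
  · have h := tendstoInDistribution_comp (ParametricModel.tendstoInDistribution_scoreSum hM hθ₀
      (c := I⁻¹) (by positivity) (w := Real.toNNReal (1 / I))
      (by rw [Real.coe_toNNReal _ (by positivity), ← hIdef]; field_simp)) hY hY_law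
    refine tendstoInDistribution_gaussian_of_sub h
      (fun n => ((mest n).sub_const _).const_mul _) ?_
    exact lin₂.congr_eq (Eventually.of_forall fun n ω => by simp only [hS]; ring)
  · have h := tendstoInDistribution_comp (ParametricModel.tendstoInDistribution_scoreSum hM hθ₀
      (c := (√I)⁻¹) (by positivity) (w := 1)
      (by rw [inv_pow, Real.sq_sqrt hI.le, ← hIdef, inv_mul_cancel₀ hI.ne']; rfl)) hY hY_law
    refine tendstoInDistribution_gaussian_of_sub h
      (fun n => ((mestExact n).sub_const _).div_const _) ?_
    refine (lin₀.const_mul √I).congr_eq (Eventually.of_forall fun n ω => ?_)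
    rw [seStat, Real.sqrt_div zero_le_one, Real.sqrt_one, Real.sqrt_mul (Nat.cast_nonneg n),
      ← hIdef]
    have h1 : √I ≠ 0 := (Real.sqrt_pos.2 hI).ne'
    have h2 : (√I)⁻¹ = √I / I := by
      rw [eq_div_iff hI.ne']
      nth_rewrite 2 [← Real.sq_sqrt hI.le]
      field_simp
    rw [h2]
    simp only [hS, div_div_eq_mul_div, div_one]
    ring
  · have h := _root_.TendstoInDistribution.linearCombination_gaussian hMC.noise
      (fun j => lsWeight J 1 j / (τ * √(unitVar J))) (w := 1) (by
        rw [Real.coe_toNNReal _ (sq_nonneg τ)]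
        simp only [div_pow, ← Finset.sum_div]
        rw [sum_lsWeight_sq hJ, mul_pow, Real.sq_sqrt hV.le]
        field_simp
        rfl)
    exact tendstoInDistribution_gaussian_of_sub h
      (fun n => ((mest n).sub (mestBias n)).div_const _) hd₂
  · refine ⟨τ ^ 2 * unitVar J / I ^ 2, by positivity, tendsto_const_nhds.congr' ?_⟩
    filter_upwards [eventually_gt_atTop 0, hmpos] with n hn hmn
    have hn' : (n : ℝ) ≠ 0 := by exact_mod_cast hn.ne'
    have hmn' : (m n : ℝ) ≠ 0 := by exact_mod_cast hmn.ne'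
    have hg := (gridScale_pos hn).ne'
    have en : (n : ℝ) = (gridScale n ^ 4)⁻¹ :=
      eq_inv_of_mul_eq_one_left (natCast_mul_gridScale_pow hn)
    rw [seMC_sq M hJ m ds θ₀ τ hn, heg hn, ← hIdef, en]
    field_simp
  · have h := (tendsto_sqrt_div_simulations hm).mul_const (τ ^ 2 * unitVar J / I)
    rw [zero_mul] at h
    refine h.congr' ?_
    filter_upwards [eventually_gt_atTop 0, hmpos] with n hn hmn
    have hn' : (0 : ℝ) < n := by exact_mod_cast hn
    have hmn' : (m n : ℝ) ≠ 0 := by exact_mod_cast hmn.ne'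
    have hg := (gridScale_pos hn).ne'
    have en : (n : ℝ) = (gridScale n ^ 4)⁻¹ :=
      eq_inv_of_mul_eq_one_left (natCast_mul_gridScale_pow hn)
    rw [seMC_sq M hJ m ds θ₀ τ hn, seStat, Real.sq_sqrt (by positivity), heg hn, ← hIdef, en]
    field_simp
  · have h := (tendsto_sqrt_div_simulations hm).mul_const √I
    rw [zero_mul] at h
    have h2 := (isLittleOP_of_tendsto (Pr := Pr) h).mul_isBigOP
      (hd₁.isBigOP.add (isBigOP_const (C / I)))
    have h3 : IsLittleOP atTop Pr fun n ω => (estBias n ω - estExact n ω) / seStat M ds θ₀ n := by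
      refine h2.congr_eq ?_
      filter_upwards [hmpos] with n hmn ω
      have hmn' : (m n : ℝ) ≠ 0 := by exact_mod_cast hmn.ne'
      rw [seStat, Real.sqrt_div zero_le_one, Real.sqrt_one, Real.sqrt_mul (Nat.cast_nonneg n),
        ← hIdef, div_div_eq_mul_div, div_one, sub_add_cancel]
      field_simp
    simpa only [TendstoInProb, sub_zero, IsLittleOP] using h3

end Efficiency

/-! ### Moments of conditionally centred averages -/

theorem memLp_four_iff {α : Type*} [MeasurableSpace α] {ν : Measure α} {f : α → ℝ}
    (hf : AEStronglyMeasurable f ν) : MemLp f 4 ν ↔ Integrable (fun x => f x ^ 4) ν := by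
  rw [← integrable_norm_rpow_iff hf (by norm_num) (by norm_num)]
  refine integrable_congr (Eventually.of_forall fun x => ?_)
  have h4 : ((4 : ℝ≥0∞).toReal) = ((4 : ℕ) : ℝ) := by norm_num
  simp only
  rw [h4, Real.rpow_natCast, Real.norm_eq_abs, Even.pow_abs ⟨2, rfl⟩]

theorem MemLp.integrable_pow_of_le_four {α : Type*} [MeasurableSpace α] {ν : Measure α}
    [IsFiniteMeasure ν] {f : α → ℝ} (hf : MemLp f 4 ν) {k : ℕ} (hk : k ≤ 4) :
    Integrable (fun x => f x ^ k) ν := by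
  have h1 : MemLp f k ν := hf.mono_exponent (by exact_mod_cast hk)
  refine (integrable_norm_iff (f := fun x => f x ^ k) (hf.aestronglyMeasurable.pow k)).1 ?_
  simpa only [norm_pow] using h1.integrable_norm_pow'

theorem MemLp.integrable_abs_pow_three {α : Type*} [MeasurableSpace α] {ν : Measure α}
    [IsFiniteMeasure ν] {f : α → ℝ} (hf : MemLp f 4 ν) : Integrable (fun x => |f x| ^ 3) ν := by
  have h : MemLp (fun x => ‖f x‖) 4 ν := hf.norm
  exact MemLp.integrable_pow_of_le_four h (by norm_num)

theorem sq_integral_sq_le {α : Type*} [MeasurableSpace α] {ν : Measure α}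
    [IsProbabilityMeasure ν] {f : α → ℝ} (hf : MemLp f 4 ν) :
    (∫ x, f x ^ 2 ∂ν) ^ 2 ≤ ∫ x, f x ^ 4 ∂ν := by
  have h2 : MemLp (fun x => f x ^ 2) 2 ν := by
    rw [memLp_two_iff_integrable_sq (f := fun x => f x ^ 2) (hf.aestronglyMeasurable.pow 2)]
    simpa only [← pow_mul] using (memLp_four_iff hf.aestronglyMeasurable).1 hf
  have h := variance_nonneg (fun x => f x ^ 2) ν
  rw [variance_eq_sub h2] at h
  have e : ν[(fun x => f x ^ 2) ^ 2] = ∫ x, f x ^ 4 ∂ν :=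
    integral_congr_ae (Eventually.of_forall fun x => by simp only [Pi.pow_apply]; ring)
  linarith

section CentredSums

variable {𝒳 : Type*} [MeasurableSpace 𝒳] {q : Measure 𝒳} [IsProbabilityMeasure q] {f : 𝒳 → ℝ}

theorem memLp_four_sum_sample (hf : MemLp f 4 q) (m : ℕ) :
    MemLp (fun x : Fin m → 𝒳 => ∑ l, f (x l)) 4 (Measure.pi fun _ : Fin m => q) :=
  memLp_finsetSum _ fun l _ => hf.comp_measurePreserving (measurePreserving_eval _ l)

theorem integral_sum_sq_of_centred (hf : MemLp f 4 q) (h0 : ∫ x, f x ∂q = 0) (m : ℕ) :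
    ∫ x : Fin m → 𝒳, (∑ l, f (x l)) ^ 2 ∂(Measure.pi fun _ : Fin m => q) =
      m * ∫ x, f x ^ 2 ∂q := by
  have hf2 : MemLp f 2 q := hf.mono_exponent (by norm_num)
  have h := variance_sum_sample hf2 m
  rw [variance_of_integral_eq_zero hf2.aestronglyMeasurable.aemeasurable h0,
    variance_of_integral_eq_zero (memLp_sum_sample hf2 m).aestronglyMeasurable.aemeasurable
      (by rw [integral_sum_sample (hf2.integrable (by norm_num)), h0, mul_zero])] at h
  exact h

/-- By induction on the number of terms: in the expansion of `(f + S)⁴` the odd terms vanish, and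
`6 E f² E S²` is at most `6 m E f⁴`. -/
theorem integral_sum_pow_four_le (hf : MemLp f 4 q) (h0 : ∫ x, f x ∂q = 0) (m : ℕ) :
    ∫ x : Fin m → 𝒳, (∑ l, f (x l)) ^ 4 ∂(Measure.pi fun _ : Fin m => q) ≤
      3 * m ^ 2 * ∫ x, f x ^ 4 ∂q := by
  induction m with
  | zero => simp
  | succ m ih =>
    have hS := memLp_four_sum_sample hf m
    have if_ : ∀ {k : ℕ}, k ≤ 4 → Integrable (fun x => f x ^ k) q :=
      fun hk => MemLp.integrable_pow_of_le_four hf hk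
    have iS : ∀ {k : ℕ}, k ≤ 4 → Integrable (fun x : Fin m → 𝒳 => (∑ l, f (x l)) ^ k)
      (Measure.pi fun _ : Fin m => q) := fun hk => MemLp.integrable_pow_of_le_four hS hk
    have e1 : ∫ x : Fin (m + 1) → 𝒳, (∑ l, f (x l)) ^ 4 ∂(Measure.pi fun _ : Fin (m + 1) => q) =
        ∫ z : 𝒳 × (Fin m → 𝒳), (f z.1 + ∑ l, f (z.2 l)) ^ 4
          ∂(q.prod (Measure.pi fun _ : Fin m => q)) := by
      rw [← (measurePreserving_piFinSuccAbove (fun _ : Fin (m + 1) => q) 0).integral_comp'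
        (fun z : 𝒳 × (Fin m → 𝒳) => (f z.1 + ∑ l, f (z.2 l)) ^ 4)]
      refine integral_congr_ae (Eventually.of_forall fun x => ?_)
      simp [Fin.sum_univ_succ, MeasurableEquiv.piFinSuccAbove]
      rfl
    have I : ∀ a b : ℕ, a ≤ 4 → b ≤ 4 → Integrable (fun z : 𝒳 × (Fin m → 𝒳) =>
        f z.1 ^ a * (∑ l, f (z.2 l)) ^ b) (q.prod (Measure.pi fun _ : Fin m => q)) :=
      fun a b ha hb => (if_ ha).mul_prod (iS hb)
    have V : ∀ a b : ℕ, ∫ z : 𝒳 × (Fin m → 𝒳), f z.1 ^ a * (∑ l, f (z.2 l)) ^ b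
        ∂(q.prod (Measure.pi fun _ : Fin m => q)) = (∫ x, f x ^ a ∂q) *
          ∫ x : Fin m → 𝒳, (∑ l, f (x l)) ^ b ∂(Measure.pi fun _ : Fin m => q) :=
      fun a b => integral_prod_mul (fun x => f x ^ a) fun x : Fin m → 𝒳 => (∑ l, f (x l)) ^ b
    have hS1 : ∫ x : Fin m → 𝒳, ∑ l, f (x l) ∂(Measure.pi fun _ : Fin m => q) = 0 := by
      rw [integral_sum_sample (hf.integrable (by norm_num)), h0, mul_zero]
    rw [e1]
    simp only [add_pow]
    rw [integral_finsetSum _ fun k hk =>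
      (I k (4 - k) (by simp at hk; omega) (by omega)).mul_const _]
    simp only [integral_mul_const, V, Finset.sum_range_succ, Finset.sum_range_zero]
    norm_num [Nat.choose]
    rw [h0, hS1, integral_sum_sq_of_centred hf h0]
    have h2 := sq_integral_sq_le hf
    have h4 : 0 ≤ ∫ x, f x ^ 4 ∂q := integral_nonneg fun x => by positivity
    nlinarith [mul_le_mul_of_nonneg_left h2 (Nat.cast_nonneg (α := ℝ) m)]

end CentredSums

section ConditionallyCentred

variable {𝒴 : Type*} [MeasurableSpace 𝒴] {P : Measure 𝒴} [IsProbabilityMeasure P]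
  {𝒳 : Type*} [MeasurableSpace 𝒳] {q : Measure 𝒳} [IsProbabilityMeasure q] {c : 𝒴 × 𝒳 → ℝ}

theorem memLp_four_sum_draws (hc4 : MemLp c 4 (P.prod q)) (m : ℕ) :
    MemLp (fun z : 𝒴 × (Fin m → 𝒳) => ∑ l, c (z.1, z.2 l)) 4
      (P.prod (Measure.pi fun _ : Fin m => q)) :=
  memLp_finsetSum _ fun l _ => hc4.comp_measurePreserving
    ((MeasurePreserving.id P).prod (measurePreserving_eval (fun _ : Fin m => q) l))

theorem ae_memLp_four_section (hc : Measurable c) (hc4 : MemLp c 4 (P.prod q)) :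
    ∀ᵐ y ∂P, MemLp (fun x => c (y, x)) 4 q := by
  filter_upwards [((memLp_four_iff hc.aestronglyMeasurable).1 hc4).prod_right_ae] with y hy
  exact (memLp_four_iff (hc.comp measurable_prodMk_left).aestronglyMeasurable).2 hy

theorem integral_sum_draws_sq (hc : Measurable c) (hc4 : MemLp c 4 (P.prod q))
    (h0 : ∀ᵐ y ∂P, ∫ x, c (y, x) ∂q = 0) (m : ℕ) :
    ∫ z : 𝒴 × (Fin m → 𝒳), (∑ l, c (z.1, z.2 l)) ^ 2 ∂(P.prod (Measure.pi fun _ : Fin m => q)) =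
      m * ∫ z, c z ^ 2 ∂(P.prod q) := by
  rw [integral_prod _ (MemLp.integrable_pow_of_le_four (memLp_four_sum_draws hc4 m) (by norm_num)),
    integral_prod _ (MemLp.integrable_pow_of_le_four hc4 (by norm_num)), ← integral_const_mul]
  refine integral_congr_ae ?_
  filter_upwards [ae_memLp_four_section hc hc4, h0] with y hy h0y
  exact integral_sum_sq_of_centred hy h0y m

theorem integral_sum_draws_pow_four_le (hc : Measurable c) (hc4 : MemLp c 4 (P.prod q))
    (h0 : ∀ᵐ y ∂P, ∫ x, c (y, x) ∂q = 0) (m : ℕ) :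
    ∫ z : 𝒴 × (Fin m → 𝒳), (∑ l, c (z.1, z.2 l)) ^ 4 ∂(P.prod (Measure.pi fun _ : Fin m => q)) ≤
      3 * m ^ 2 * ∫ z, c z ^ 4 ∂(P.prod q) := by
  have i1 := MemLp.integrable_pow_of_le_four (memLp_four_sum_draws hc4 m) le_rfl
  have i2 := MemLp.integrable_pow_of_le_four hc4 le_rfl
  rw [integral_prod _ i1, integral_prod _ i2, ← integral_const_mul]
  refine integral_mono_ae i1.integral_prod_left (i2.integral_prod_left.const_mul _) ?_
  filter_upwards [ae_memLp_four_section hc hc4, h0] with y hy h0y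
  exact integral_sum_pow_four_le hy h0y m

end ConditionallyCentred

/-! ### The expansion of the importance sampling log-likelihood -/

theorem abs_log_one_add_quadratic_le {w : ℝ} (hw : |w| ≤ 1 / 2) :
    |Real.log (1 + w) - w + w ^ 2 / 2| ≤ 2 * |w| ^ 3 := by
  have h := Real.abs_log_sub_add_sum_range_le (x := -w) (by rw [abs_neg]; linarith) 2
  rw [abs_neg, sub_neg_eq_add, Finset.sum_range_succ, Finset.sum_range_one] at h
  have h3 : |w| ^ (2 + 1) / (1 - |w|) ≤ 2 * |w| ^ 3 := by
    rw [div_le_iff₀ (by linarith)]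
    have := mul_nonneg (pow_nonneg (abs_nonneg w) 3) (sub_nonneg.2 hw)
    linarith [pow_succ |w| 2]
  refine le_trans (le_of_eq ?_) (h.trans h3)
  congr 1
  norm_num
  ring

section LogAverage

variable {ι : Type*} {l : Filter ι} {n m : ι → ℕ} {𝒴 : Type*} [MeasurableSpace 𝒴]
  {P : Measure 𝒴} [IsProbabilityMeasure P] {𝒳 : Type*} [MeasurableSpace 𝒳] {q : ι → Measure 𝒳}
  [∀ i, IsProbabilityMeasure (q i)] {c : ι → 𝒴 × 𝒳 → ℝ} {B : ℝ}

theorem integral_average_pow_four_le {q : Measure 𝒳} [IsProbabilityMeasure q] {c : 𝒴 × 𝒳 → ℝ}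
    (hc : Measurable c) (hc4 : MemLp c 4 (P.prod q)) (hB : ∫ z, c z ^ 4 ∂(P.prod q) ≤ B)
    (h0 : ∀ᵐ y ∂P, ∫ x, c (y, x) ∂q = 0) {m : ℕ} (hm : 0 < m) :
    ∫ z : 𝒴 × (Fin m → 𝒳), ((m : ℝ)⁻¹ * ∑ l, c (z.1, z.2 l)) ^ 4
      ∂(P.prod (Measure.pi fun _ : Fin m => q)) ≤ 3 * B / m ^ 2 := by
  have hm' : (0 : ℝ) < m := by exact_mod_cast hm
  simp only [mul_pow]
  rw [integral_const_mul]
  calc (m : ℝ)⁻¹ ^ 4 * _ ≤ (m : ℝ)⁻¹ ^ 4 * (3 * m ^ 2 * B) := by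
        gcongr
        refine (integral_sum_draws_pow_four_le hc hc4 h0 m).trans ?_
        gcongr
    _ = 3 * B / m ^ 2 := by field_simp

/-- The averages are uniformly small: `n` fourth moments of order `m⁻²` sum to `(√n / m)²`. -/
theorem asympSure_forall_abs_le_half {𝒵 : ι → Type*} [∀ i, MeasurableSpace (𝒵 i)]
    {R : ∀ i, Measure (𝒵 i)} [∀ i, IsProbabilityMeasure (R i)] {w : ∀ i, 𝒵 i → ℝ}
    (hwm : ∀ i, Measurable (w i)) (hw4 : ∀ᶠ i in l, MemLp (w i) 4 (R i))
    (hwB : ∀ᶠ i in l, ∫ z, w i z ^ 4 ∂(R i) ≤ B / (m i : ℝ) ^ 2)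
    (hnm : Tendsto (fun i => √(n i : ℝ) / m i) l (𝓝 0)) :
    AsympSure l (fun i => Measure.pi fun _ : Fin (n i) => R i)
      fun i (z : Fin (n i) → 𝒵 i) => ∀ k, |w i (z k)| ≤ 1 / 2 := by
  have hw0 : ∀ i, 0 ≤ ∫ z, w i z ^ 4 ∂(R i) :=
    fun i => integral_nonneg fun z => by positivity
  have hsmall : AsympSure l
      (fun i => Measure.pi fun _ : Fin (n i) => R i)
      fun i (z : Fin (n i) → 𝒵 i) => ∀ k, 16 * w i (z k) ^ 4 < 1 := by
    refine asympSure_forall_lt_one (fun i => ((hwm i).pow_const 4).const_mul 16)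
      (fun i z => by positivity) ?_ ?_
    · filter_upwards [hw4] with i hi
      exact (MemLp.integrable_pow_of_le_four hi le_rfl).const_mul _
    · have hlim := (hnm.pow 2).const_mul (16 * B)
      rw [zero_pow two_ne_zero, mul_zero] at hlim
      refine squeeze_zero' (Eventually.of_forall fun i => ?_) ?_ hlim
      · rw [integral_const_mul]
        have := hw0 i
        positivity
      · filter_upwards [hwB] with i hi
        rw [integral_const_mul, div_pow, Real.sq_sqrt (Nat.cast_nonneg _)]
        calc (n i : ℝ) * (16 * _) ≤ n i * (16 * (B / (m i : ℝ) ^ 2)) := by gcongr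
          _ = _ := by ring
  refine hsmall.mono (Eventually.of_forall fun i z hz k => ?_)
  by_contra hcon
  rw [not_le] at hcon
  have h1 := pow_lt_pow_left₀ hcon (by norm_num) (n := 4) (by norm_num)
  rw [Even.pow_abs ⟨2, rfl⟩] at h1
  have := hz k
  norm_num at h1
  linarith

/-- The second order expansion of the logarithms of averages over a sample: when the fourth moments
are of order `m⁻²`, the quadratic term may be replaced by its mean, a bias, and the remainder is
negligible at the scale `√(m / n)` if `√n / m → 0`. -/
theorem isLittleOP_sum_log {𝒵 : ι → Type*} [∀ i, MeasurableSpace (𝒵 i)] {R : ∀ i, Measure (𝒵 i)}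
    [∀ i, IsProbabilityMeasure (R i)] {w : ∀ i, 𝒵 i → ℝ} (hwm : ∀ i, Measurable (w i))
    (hw4 : ∀ᶠ i in l, MemLp (w i) 4 (R i))
    (hwB : ∀ᶠ i in l, ∫ z, w i z ^ 4 ∂(R i) ≤ B / (m i : ℝ) ^ 2) (hn : ∀ᶠ i in l, 0 < n i)
    (hm : Tendsto m l atTop) (hnm : Tendsto (fun i => √(n i : ℝ) / m i) l (𝓝 0)) :
    IsLittleOP l (fun i => Measure.pi fun _ : Fin (n i) => R i)
      fun i (z : Fin (n i) → 𝒵 i) => √((m i : ℝ) / n i) *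
        (∑ k, Real.log (1 + w i (z k)) + n i / 2 * ∫ z, w i z ^ 2 ∂(R i) - ∑ k, w i (z k)) := by
  have hm0 : ∀ᶠ i in l, 0 < m i := hm.eventually_gt_atTop 0
  have hw0 : ∀ i, 0 ≤ ∫ z, w i z ^ 4 ∂(R i) :=
    fun i => integral_nonneg fun z => by positivity
  have hm_inv : Tendsto (fun i => ((m i : ℝ))⁻¹) l (𝓝 0) :=
    tendsto_inv_atTop_zero.comp (tendsto_natCast_atTop_atTop.comp hm)
  have hsmall := asympSure_forall_abs_le_half hwm hw4 hwB hnm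
  have hcube : IsLittleOP l
      (fun i => Measure.pi fun _ : Fin (n i) => R i)
      fun i (z : Fin (n i) → 𝒵 i) => √((m i : ℝ) / n i) * ∑ k, |w i (z k)| ^ 3 := by
    have hint : ∀ᶠ i in l, Integrable (fun z => |w i z| ^ 3) (R i) := by
      filter_upwards [hw4] with i hi
      exact MemLp.integrable_abs_pow_three hi
    refine isLittleOP_nonneg_sum (f := fun i z => |w i z| ^ 3)
      (c := fun i => √((m i : ℝ) / n i)) (fun i => (hwm i).norm.pow_const 3)
      (fun i z => by positivity) (fun i => Real.sqrt_nonneg _) hint ?_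
    have hlim := hnm.mul_const (1 + B)
    rw [zero_mul] at hlim
    refine squeeze_zero' (Eventually.of_forall fun i => ?_) ?_ hlim
    · exact mul_nonneg (Real.sqrt_nonneg _) (mul_nonneg (Nat.cast_nonneg _)
        (integral_nonneg fun z => by positivity))
    · filter_upwards [hint, hw4, hwB, hm0, hn] with i hi h4 hBi hmi hni
      have hm' : (0 : ℝ) < m i := by exact_mod_cast hmi
      have hn' : (0 : ℝ) < n i := by exact_mod_cast hni
      have hs : 0 < √(m i : ℝ) := Real.sqrt_pos.2 hm'
      have hss : √(m i : ℝ) ^ 2 = m i := Real.sq_sqrt hm'.le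
      have hsn : √(n i : ℝ) ^ 2 = n i := Real.sq_sqrt hn'.le
      have hsn0 : 0 < √(n i : ℝ) := Real.sqrt_pos.2 hn'
      -- `t³ ≤ 1 + t⁴` for `t = √m |w|`, which is of order one
      have hle : ∀ z, |w i z| ^ 3 ≤ (√(m i : ℝ) ^ 3)⁻¹ * (1 + (m i : ℝ) ^ 2 * w i z ^ 4) := by
        intro z
        rw [← div_eq_inv_mul, le_div_iff₀ (by positivity)]
        have ht : ∀ t : ℝ, 0 ≤ t → t ^ 3 ≤ 1 + t ^ 4 := fun t ht => by
          nlinarith [sq_nonneg (t - 1), sq_nonneg (t ^ 2 - t), sq_nonneg (t ^ 2 - 1)]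
        have := ht (√(m i : ℝ) * |w i z|) (by positivity)
        rw [mul_pow, mul_pow, show √(m i : ℝ) ^ 4 = (m i : ℝ) ^ 2 by
          rw [show √(m i : ℝ) ^ 4 = (√(m i : ℝ) ^ 2) ^ 2 by ring, hss],
          show |w i z| ^ 4 = w i z ^ 4 from Even.pow_abs ⟨2, rfl⟩ _] at this
        linarith
      have hI : ∫ z, |w i z| ^ 3 ∂(R i) ≤
          (√(m i : ℝ) ^ 3)⁻¹ * (1 + B) := by
        have j : Integrable (fun z => 1 + (m i : ℝ) ^ 2 * w i z ^ 4)
            (R i) :=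
          (integrable_const 1).add
            ((MemLp.integrable_pow_of_le_four h4 le_rfl).const_mul _)
        refine (integral_mono hi (j.const_mul _) hle).trans ?_
        rw [integral_const_mul, integral_add (integrable_const 1)
          ((MemLp.integrable_pow_of_le_four h4 le_rfl).const_mul _), integral_const_mul]
        simp only [integral_const, probReal_univ, smul_eq_mul, one_mul]
        gcongr
        calc (m i : ℝ) ^ 2 * _ ≤ (m i : ℝ) ^ 2 * (B / (m i : ℝ) ^ 2) := by gcongr
          _ = B := by field_simp
      calc √((m i : ℝ) / n i) * (n i * _)
          ≤ √((m i : ℝ) / n i) * (n i * ((√(m i : ℝ) ^ 3)⁻¹ * (1 + B))) := by gcongr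
        _ = √(n i : ℝ) / m i * (1 + B) := by
            rw [Real.sqrt_div hm'.le]
            nth_rewrite 2 [← hsn]
            nth_rewrite 3 [← hss]
            field_simp
  have hsq : IsLittleOP l
      (fun i => Measure.pi fun _ : Fin (n i) => R i)
      fun i (z : Fin (n i) → 𝒵 i) => √((m i : ℝ) / n i) * (∑ k, w i (z k) ^ 2 -
        n i * ∫ z, w i z ^ 2 ∂(R i)) := by
    refine isLittleOP_centred_sum (f := fun i z => w i z ^ 2) ?_ ?_
    · filter_upwards [hw4] with i hi
      rw [memLp_two_iff_integrable_sq ((hwm i).pow_const 2).aestronglyMeasurable]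
      simp only [← pow_mul]
      exact MemLp.integrable_pow_of_le_four hi le_rfl
    · simp only [← pow_mul]
      have hlim := hm_inv.const_mul (B)
      rw [mul_zero] at hlim
      refine squeeze_zero' (Eventually.of_forall fun i => ?_) ?_ hlim
      · have := hw0 i
        positivity
      · filter_upwards [hwB, hm0, hn] with i hi hmi hni
        have hm' : (0 : ℝ) < m i := by exact_mod_cast hmi
        have hn' : (0 : ℝ) < n i := by exact_mod_cast hni
        rw [Real.sq_sqrt (by positivity)]
        calc (m i : ℝ) / n i * (n i * _) ≤ m i / n i * (n i * (B / (m i : ℝ) ^ 2)) := by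
              gcongr
          _ = B * (m i : ℝ)⁻¹ := by field_simp
  have hlog : IsLittleOP l
      (fun i => Measure.pi fun _ : Fin (n i) => R i)
      fun i (z : Fin (n i) → 𝒵 i) => √((m i : ℝ) / n i) *
        ∑ k, (Real.log (1 + w i (z k)) - w i (z k) + w i (z k) ^ 2 / 2) := by
    refine (hcube.const_mul 2).of_abs_le (hsmall.mono (Eventually.of_forall fun i z hz => ?_))
    rw [abs_mul, abs_of_nonneg (Real.sqrt_nonneg _),
      abs_of_nonneg (show 0 ≤ 2 * (√((m i : ℝ) / n i) * ∑ k, |w i (z k)| ^ 3) by positivity),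
      mul_left_comm]
    gcongr
    rw [Finset.mul_sum]
    exact (Finset.abs_sum_le_sum_abs _ _).trans
      (Finset.sum_le_sum fun k _ => abs_log_one_add_quadratic_le (hz k))
  refine (hlog.sub (hsq.const_mul (1 / 2))).congr_eq (Eventually.of_forall fun i z => ?_)
  simp only [Finset.sum_add_distrib, Finset.sum_sub_distrib, ← Finset.sum_div]
  ring

/-- The logarithms of averages of conditionally centred variables. -/
theorem isLittleOP_sum_log_average (hc : ∀ i, Measurable (c i))
    (hc4 : ∀ᶠ i in l, MemLp (c i) 4 (P.prod (q i)))
    (hB : ∀ᶠ i in l, ∫ z, c i z ^ 4 ∂(P.prod (q i)) ≤ B)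
    (h0 : ∀ᶠ i in l, ∀ᵐ y ∂P, ∫ x, c i (y, x) ∂(q i) = 0) (hn : ∀ᶠ i in l, 0 < n i)
    (hm : Tendsto m l atTop) (hnm : Tendsto (fun i => √(n i : ℝ) / m i) l (𝓝 0)) :
    IsLittleOP l
      (fun i => Measure.pi fun _ : Fin (n i) => P.prod (Measure.pi fun _ : Fin (m i) => q i))
      fun i z => √((m i : ℝ) / n i) *
        (∑ k, Real.log (1 + (m i : ℝ)⁻¹ * ∑ r, c i ((z k).1, (z k).2 r)) +
          n i / (2 * m i) * ∫ z, c i z ^ 2 ∂(P.prod (q i))) -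
        (√((n i : ℝ) * m i))⁻¹ * ∑ k, ∑ r, c i ((z k).1, (z k).2 r) := by
  set w : ∀ i, 𝒴 × (Fin (m i) → 𝒳) → ℝ := fun i z => (m i : ℝ)⁻¹ * ∑ r, c i (z.1, z.2 r) with hw
  have hwm : ∀ i, Measurable (w i) := fun i => by
    refine (Finset.measurable_sum _ fun r _ => (hc i).comp ?_).const_mul _
    fun_prop
  have hm0 : ∀ᶠ i in l, 0 < m i := hm.eventually_gt_atTop 0
  have hw4 : ∀ᶠ i in l, MemLp (w i) 4 (P.prod (Measure.pi fun _ : Fin (m i) => q i)) := by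
    filter_upwards [hc4] with i hi
    exact (memLp_four_sum_draws hi (m i)).const_mul _
  have hwB : ∀ᶠ i in l, ∫ z, w i z ^ 4 ∂(P.prod (Measure.pi fun _ : Fin (m i) => q i)) ≤
      3 * B / (m i : ℝ) ^ 2 := by
    filter_upwards [hc4, hB, h0, hm0] with i h1 h2 h3 h4
    exact integral_average_pow_four_le (hc i) h1 h2 h3 h4
  refine (isLittleOP_sum_log (w := w) hwm hw4 hwB hn hm hnm).congr_eq ?_
  filter_upwards [hc4, h0, hm0, hn] with i h4 h0i hmi hni z
  have hm' : (0 : ℝ) < m i := by exact_mod_cast hmi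
  have hn' : (0 : ℝ) < n i := by exact_mod_cast hni
  have hI2 : ∫ z, w i z ^ 2 ∂(P.prod (Measure.pi fun _ : Fin (m i) => q i)) =
      (m i : ℝ)⁻¹ * ∫ z, c i z ^ 2 ∂(P.prod (q i)) := by
    simp only [hw, mul_pow]
    rw [integral_const_mul, integral_sum_draws_sq (hc i) h4 h0i]
    field_simp
  have hlin : (√((n i : ℝ) * m i))⁻¹ * ∑ k, ∑ r, c i ((z k).1, (z k).2 r) =
      √((m i : ℝ) / n i) * ∑ k, w i (z k) := by
    simp only [hw]
    rw [← Finset.mul_sum, ← mul_assoc]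
    congr 1
    have hsm : √(m i : ℝ) ^ 2 = m i := Real.sq_sqrt hm'.le
    rw [Real.sqrt_mul hn'.le, Real.sqrt_div hm'.le]
    nth_rewrite 3 [← hsm]
    have : 0 < √(m i : ℝ) := Real.sqrt_pos.2 hm'
    field_simp
  rw [hlin, hI2]
  change √((m i : ℝ) / n i) * (∑ k, Real.log (1 + w i (z k)) + _) - _ = _
  generalize ∑ k, Real.log (1 + w i (z k)) = a
  generalize ∑ k, w i (z k) = b
  ring

end LogAverage

/-! ### Characteristic functions of conditionally centred sums -/

/-- The telescoping bound for products in the unit disc. -/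
theorem norm_prod_sub_prod_le_sum {κ : Type*} (s : Finset κ) {a b : κ → ℂ}
    (ha : ∀ k ∈ s, ‖a k‖ ≤ 1) (hb : ∀ k ∈ s, ‖b k‖ ≤ 1) :
    ‖∏ k ∈ s, a k - ∏ k ∈ s, b k‖ ≤ ∑ k ∈ s, ‖a k - b k‖ := by
  classical
  induction s using Finset.induction_on with
  | empty => simp
  | insert k s hk ih =>
    rw [Finset.prod_insert hk, Finset.prod_insert hk, Finset.sum_insert hk]
    have h1 := ih (fun j hj => ha j (Finset.mem_insert_of_mem hj))
      (fun j hj => hb j (Finset.mem_insert_of_mem hj))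
    have h2 : ‖∏ j ∈ s, b j‖ ≤ 1 := by
      rw [norm_prod]
      exact Finset.prod_le_one (fun j _ => norm_nonneg _)
        fun j hj => hb j (Finset.mem_insert_of_mem hj)
    have h3 := ha k (Finset.mem_insert_self k s)
    calc ‖a k * ∏ j ∈ s, a j - b k * ∏ j ∈ s, b j‖
        = ‖(a k - b k) * ∏ j ∈ s, b j + a k * (∏ j ∈ s, a j - ∏ j ∈ s, b j)‖ := by ring_nf
      _ ≤ ‖a k - b k‖ * ‖∏ j ∈ s, b j‖ + ‖a k‖ * ‖∏ j ∈ s, a j - ∏ j ∈ s, b j‖ :=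
          (norm_add_le _ _).trans (by rw [norm_mul, norm_mul])
      _ ≤ ‖a k - b k‖ * 1 + 1 * ∑ j ∈ s, ‖a j - b j‖ := by gcongr
      _ = _ := by ring

theorem norm_pow_sub_pow_le {a b : ℂ} (ha : ‖a‖ ≤ 1) (hb : ‖b‖ ≤ 1) (m : ℕ) :
    ‖a ^ m - b ^ m‖ ≤ m * ‖a - b‖ := by
  have := norm_prod_sub_prod_le_sum (Finset.univ : Finset (Fin m)) (a := fun _ => a)
    (b := fun _ => b) (fun _ _ => ha) fun _ _ => hb
  simpa using this

theorem norm_exp_mul_I_sub_quadratic_le (x : ℝ) :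
    ‖Complex.exp (x * Complex.I) - (1 + x * Complex.I - x ^ 2 / 2)‖ ≤ 4 * |x| ^ 3 := by
  rcases le_total |x| 1 with hx | hx
  · have h := Complex.norm_exp_sub_sum_le_norm_mul_exp (x * Complex.I) 3
    have e : ∑ k ∈ Finset.range 3, (x * Complex.I) ^ k / (Nat.factorial k : ℂ) =
        1 + x * Complex.I - x ^ 2 / 2 := by
      simp [Finset.sum_range_succ, mul_pow, Nat.factorial]
      ring
    have hn : ‖(x : ℂ) * Complex.I‖ = |x| := by simp
    rw [e, hn] at h
    refine h.trans ?_
    have h1 : Real.exp |x| ≤ 4 :=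
      (Real.exp_le_exp.2 hx).trans (by linarith [Real.exp_one_lt_d9])
    nlinarith [pow_nonneg (abs_nonneg x) 3]
  · have h1 : ‖(1 : ℂ) + x * Complex.I - x ^ 2 / 2‖ ≤ 1 + |x| + |x| ^ 2 / 2 := by
      refine (norm_sub_le _ _).trans (add_le_add ((norm_add_le _ _).trans ?_) ?_) <;> simp
    refine (norm_sub_le _ _).trans ?_
    rw [Complex.norm_exp_ofReal_mul_I]
    nlinarith [mul_le_mul hx hx zero_le_one (by positivity), sq_nonneg |x|,
      mul_nonneg (sub_nonneg.2 hx) (sq_nonneg |x|)]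

theorem abs_exp_neg_sub_le {x : ℝ} (hx : 0 ≤ x) : |Real.exp (-x) - (1 - x)| ≤ x ^ 2 := by
  rw [abs_of_nonneg (by linarith [Real.one_sub_le_exp_neg x])]
  have h1 := Real.add_one_le_exp x
  have h2 : Real.exp (-x) * Real.exp x = 1 := by rw [← Real.exp_add]; simp
  have h3 := Real.exp_pos (-x)
  nlinarith [mul_le_mul_of_nonneg_left h1 h3.le, mul_nonneg hx h3.le]

theorem abs_exp_neg_sub_exp_neg_le {x y : ℝ} (hx : 0 ≤ x) (hy : 0 ≤ y) :
    |Real.exp (-x) - Real.exp (-y)| ≤ |x - y| := by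
  have key : ∀ {a b : ℝ}, 0 ≤ a → a ≤ b → |Real.exp (-a) - Real.exp (-b)| ≤ b - a := by
    intro a b ha hab
    have h1 : Real.exp (-b) = Real.exp (-a) * Real.exp (-(b - a)) := by
      rw [← Real.exp_add]; ring_nf
    have h2 := Real.one_sub_le_exp_neg (b - a)
    have h3 : Real.exp (-a) ≤ 1 := Real.exp_le_one_iff.2 (by linarith)
    rw [abs_of_nonneg (sub_nonneg.2 (Real.exp_le_exp.2 (by linarith))), h1]
    nlinarith [Real.exp_pos (-a)]
  rcases le_total x y with h | h
  · rw [abs_sub_comm x y, abs_of_nonneg (sub_nonneg.2 h)]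
    exact key hx h
  · rw [abs_sub_comm, abs_of_nonneg (sub_nonneg.2 h)]
    exact key hy h

section CharFun

variable {𝒳 : Type*} [MeasurableSpace 𝒳] {q : Measure 𝒳} [IsProbabilityMeasure q] {f : 𝒳 → ℝ}

theorem norm_integral_exp_mul_I_le_one (f : 𝒳 → ℝ) :
    ‖∫ x, Complex.exp ((f x : ℝ) * Complex.I) ∂q‖ ≤ 1 := by
  refine (norm_integral_le_integral_norm _).trans ?_
  simp only [Complex.norm_exp_ofReal_mul_I, integral_const, probReal_univ, smul_eq_mul, mul_one,
    le_refl]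

/-- A third order bound, in terms of the fourth moment, for the comparison of a centred
characteristic function with the normal one. -/
theorem norm_integral_exp_sub_le (hf : MemLp f 4 q) (h0 : ∫ x, f x ∂q = 0) (s : ℝ) :
    ‖∫ x, Complex.exp ((s * f x : ℝ) * Complex.I) ∂q -
      Complex.exp (-(s ^ 2 / 2 * ∫ x, f x ^ 2 ∂q : ℝ))‖ ≤
      4 * |s| ^ 3 * (1 + ∫ x, f x ^ 4 ∂q) + s ^ 4 * ∫ x, f x ^ 4 ∂q := by
  have i1 : Integrable f q := hf.integrable (by norm_num)
  have i2 : Integrable (fun x => f x ^ 2) q := MemLp.integrable_pow_of_le_four hf (by norm_num)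
  have i3 : Integrable (fun x => |f x| ^ 3) q := MemLp.integrable_abs_pow_three hf
  have i4 : Integrable (fun x => f x ^ 4) q := MemLp.integrable_pow_of_le_four hf le_rfl
  have ie : Integrable (fun x => Complex.exp ((s * f x : ℝ) * Complex.I)) q := by
    refine Integrable.of_bound (C := 1) ?_ (Eventually.of_forall fun x => ?_)
    · have := hf.aestronglyMeasurable
      fun_prop
    · rw [Complex.norm_exp_ofReal_mul_I]
  have j1 : Integrable (fun x => ((s * f x : ℝ) : ℂ) * Complex.I) q :=
    ((i1.const_mul s).ofReal).mul_const _
  have j2 : Integrable (fun x => ((s ^ 2 / 2 * f x ^ 2 : ℝ) : ℂ)) q := (i2.const_mul _).ofReal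
  have j3 : Integrable (fun x => 1 + ((s * f x : ℝ) : ℂ) * Complex.I) q :=
    (integrable_const _).add j1
  have j5 : Integrable (fun x => 1 + ((s * f x : ℝ) : ℂ) * Complex.I -
      ((s ^ 2 / 2 * f x ^ 2 : ℝ) : ℂ)) q := j3.sub j2
  have hquad : ∫ x, (1 + ((s * f x : ℝ) : ℂ) * Complex.I - ((s ^ 2 / 2 * f x ^ 2 : ℝ) : ℂ)) ∂q =
      ((1 - s ^ 2 / 2 * ∫ x, f x ^ 2 ∂q : ℝ) : ℂ) := by
    rw [integral_sub j3 j2, integral_add (integrable_const _) j1, integral_mul_const,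
      integral_complex_ofReal, integral_complex_ofReal, integral_const_mul, integral_const_mul, h0]
    simp
  have h1 : ‖∫ x, Complex.exp ((s * f x : ℝ) * Complex.I) ∂q -
      ((1 - s ^ 2 / 2 * ∫ x, f x ^ 2 ∂q : ℝ) : ℂ)‖ ≤ 4 * |s| ^ 3 * (1 + ∫ x, f x ^ 4 ∂q) := by
    rw [← hquad, ← integral_sub ie j5]
    refine (norm_integral_le_integral_norm _).trans ?_
    have hb : ∀ x, ‖Complex.exp ((s * f x : ℝ) * Complex.I) -
        (1 + ((s * f x : ℝ) : ℂ) * Complex.I - ((s ^ 2 / 2 * f x ^ 2 : ℝ) : ℂ))‖ ≤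
        4 * |s| ^ 3 * (1 + f x ^ 4) := by
      intro x
      have h := norm_exp_mul_I_sub_quadratic_le (s * f x)
      rw [abs_mul, mul_pow] at h
      have e : ((s ^ 2 / 2 * f x ^ 2 : ℝ) : ℂ) = ((s * f x : ℝ) : ℂ) ^ 2 / 2 := by
        push_cast; ring
      rw [e]
      refine h.trans ?_
      have ht : ∀ t : ℝ, 0 ≤ t → t ^ 3 ≤ 1 + t ^ 4 := fun t ht => by
        nlinarith [sq_nonneg (t - 1), sq_nonneg (t ^ 2 - t), sq_nonneg (t ^ 2 - 1)]
      have := ht |f x| (abs_nonneg _)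
      rw [show |f x| ^ 4 = f x ^ 4 from Even.pow_abs ⟨2, rfl⟩ _] at this
      rw [mul_assoc 4 (|s| ^ 3)]
      gcongr
    have j4 : Integrable (fun x => 4 * |s| ^ 3 * (1 + f x ^ 4)) q :=
      ((integrable_const 1).add i4).const_mul _
    refine (integral_mono (ie.sub j5).norm j4 hb).trans (le_of_eq ?_)
    rw [integral_const_mul, integral_add (integrable_const 1) i4]
    simp
  have hV : 0 ≤ ∫ x, f x ^ 2 ∂q := integral_nonneg fun x => sq_nonneg _
  have h2 : ‖((1 - s ^ 2 / 2 * ∫ x, f x ^ 2 ∂q : ℝ) : ℂ) -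
      Complex.exp (-(s ^ 2 / 2 * ∫ x, f x ^ 2 ∂q : ℝ))‖ ≤ s ^ 4 * ∫ x, f x ^ 4 ∂q := by
    rw [← Complex.ofReal_neg, ← Complex.ofReal_exp, ← Complex.ofReal_sub, Complex.norm_real,
      Real.norm_eq_abs, abs_sub_comm]
    refine (abs_exp_neg_sub_le (by positivity)).trans ?_
    have := sq_integral_sq_le hf
    have h4 : 0 ≤ s ^ 4 := by positivity
    nlinarith [mul_le_mul_of_nonneg_left this h4, mul_nonneg h4 (sq_nonneg (∫ x, f x ^ 2 ∂q))]
  exact (norm_sub_le_norm_sub_add_norm_sub _ _ _).trans (add_le_add h1 h2)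

end CharFun

section ConditionalCharFun

variable {ι : Type*} {l : Filter ι} {n m : ι → ℕ} {𝒴 : Type*} [MeasurableSpace 𝒴]
  {P : Measure 𝒴} [IsProbabilityMeasure P] {𝒳 : Type*} [MeasurableSpace 𝒳] {q : ι → Measure 𝒳}
  [∀ i, IsProbabilityMeasure (q i)] {c : ι → 𝒴 × 𝒳 → ℝ} {B σ : ℝ}

/-- Conditionally on the `𝒴`-sample, the normalized sum of the conditionally centred variables over
all draws is asymptotically normal with variance the limiting mean conditional variance. -/
theorem isLittleOP_conditional_charFun (hc : ∀ i, Measurable (c i))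
    (hc4 : ∀ᶠ i in l, MemLp (c i) 4 (P.prod (q i)))
    (hB : ∀ᶠ i in l, ∫ z, c i z ^ 4 ∂(P.prod (q i)) ≤ B)
    (h0 : ∀ᶠ i in l, ∀ᵐ y ∂P, ∫ x, c i (y, x) ∂(q i) = 0)
    (hσ : Tendsto (fun i => ∫ z, c i z ^ 2 ∂(P.prod (q i))) l (𝓝 σ))
    (hσ0 : 0 ≤ σ) (hn : Tendsto n l atTop) (hm : Tendsto m l atTop) (u : ℝ) :
    IsLittleOP l (fun i => Measure.pi fun _ : Fin (n i) => P) fun i y =>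
      ‖∏ k, (∫ x, Complex.exp ((u * (√((n i : ℝ) * m i))⁻¹ * c i (y k, x) : ℝ) * Complex.I)
        ∂(q i)) ^ m i - Complex.exp (-(u ^ 2 / 2 * σ : ℝ))‖ := by
  set V : ι → 𝒴 → ℝ := fun i y => ∫ x, c i (y, x) ^ 2 ∂(q i) with hV
  set F : ι → 𝒴 → ℝ := fun i y => ∫ x, c i (y, x) ^ 4 ∂(q i) with hF
  set s : ι → ℝ := fun i => u * (√((n i : ℝ) * m i))⁻¹ with hs
  have hVm : ∀ i, Measurable (V i) := fun i =>
    (((hc i).pow_const 2).stronglyMeasurable.integral_prod_right').measurable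
  have hFm : ∀ i, Measurable (F i) := fun i =>
    (((hc i).pow_const 4).stronglyMeasurable.integral_prod_right').measurable
  have hV0 : ∀ i y, 0 ≤ V i y := fun i y => integral_nonneg fun x => sq_nonneg _
  have hF0 : ∀ i y, 0 ≤ F i y := fun i y => integral_nonneg fun x => by positivity
  have hFi : ∀ᶠ i in l, Integrable (F i) P ∧ ∫ y, F i y ∂P ≤ B := by
    filter_upwards [hc4, hB] with i h4 hBi
    have i4 := MemLp.integrable_pow_of_le_four h4 le_rfl
    exact ⟨i4.integral_prod_left, by rw [← integral_prod _ i4]; exact hBi⟩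
  have hVF : ∀ᶠ i in l, ∀ᵐ y ∂P, V i y ^ 2 ≤ F i y := by
    filter_upwards [hc4] with i h4
    filter_upwards [ae_memLp_four_section (hc i) h4] with y hy
    exact sq_integral_sq_le hy
  have hVi : ∀ᶠ i in l, MemLp (V i) 2 P ∧ ∫ y, V i y ^ 2 ∂P ≤ B := by
    filter_upwards [hFi, hVF] with i hFi hVF
    have h2 : Integrable (fun y => V i y ^ 2) P :=
      hFi.1.mono' ((hVm i).pow_const 2).aestronglyMeasurable (by
        filter_upwards [hVF] with y hy
        rwa [Real.norm_of_nonneg (sq_nonneg _)])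
    exact ⟨(memLp_two_iff_integrable_sq (hVm i).aestronglyMeasurable).2 h2,
      (integral_mono_ae h2 hFi.1 hVF).trans hFi.2⟩
  have hVσ : Tendsto (fun i => ∫ y, V i y ∂P) l (𝓝 σ) := by
    refine hσ.congr' ?_
    filter_upwards [hc4] with i h4
    exact integral_prod _ (MemLp.integrable_pow_of_le_four h4 (by norm_num))
  have hn_inv : Tendsto (fun i => ((n i : ℝ))⁻¹) l (𝓝 0) :=
    tendsto_inv_atTop_zero.comp (tendsto_natCast_atTop_atTop.comp hn)
  have hm_inv : Tendsto (fun i => ((m i : ℝ))⁻¹) l (𝓝 0) :=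
    tendsto_inv_atTop_zero.comp (tendsto_natCast_atTop_atTop.comp hm)
  -- the error of the normal approximation: `n m` draws, each with an error of order `(n m)^{-3/2}`
  have hlin : IsLittleOP l (fun i => Measure.pi fun _ : Fin (n i) => P) fun i y =>
      (m i : ℝ) * ∑ k, (4 * |s i| ^ 3 * (1 + F i (y k)) + s i ^ 4 * F i (y k)) := by
    refine isLittleOP_nonneg_sum
      (f := fun i y => 4 * |s i| ^ 3 * (1 + F i y) + s i ^ 4 * F i y) (c := fun i => (m i : ℝ))
      (fun i => by have := hFm i; fun_prop) (fun i y => by have := hF0 i y; positivity)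
      (fun i => Nat.cast_nonneg _) ?_ ?_
    · filter_upwards [hFi] with i hi
      exact (((integrable_const 1).add hi.1).const_mul _).add (hi.1.const_mul _)
    · have hnm : Tendsto (fun i => (√((n i : ℝ) * m i))⁻¹) l (𝓝 0) := by
        have h := (Real.continuous_sqrt.tendsto 0).comp (by simpa using hn_inv.mul hm_inv)
        rw [Real.sqrt_zero] at h
        refine h.congr fun i => ?_
        rw [Function.comp_apply, ← mul_inv, Real.sqrt_inv]
      have hlim := (hnm.const_mul (4 * |u| ^ 3 * (1 + B))).add
        ((hnm.pow 2).const_mul (u ^ 4 * B))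
      rw [mul_zero, zero_pow two_ne_zero, mul_zero, add_zero] at hlim
      refine squeeze_zero' (Eventually.of_forall fun i => ?_) ?_ hlim
      · exact mul_nonneg (Nat.cast_nonneg _) (mul_nonneg (Nat.cast_nonneg _)
          (integral_nonneg fun y => by have := hF0 i y; positivity))
      · filter_upwards [hFi, hn.eventually_gt_atTop 0, hm.eventually_gt_atTop 0]
          with i hi hni hmi
        have hm' : (0 : ℝ) < m i := by exact_mod_cast hmi
        have hn' : (0 : ℝ) < n i := by exact_mod_cast hni
        have j1 : Integrable (fun y => 4 * |s i| ^ 3 * (1 + F i y)) P :=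
          ((integrable_const 1).add hi.1).const_mul _
        rw [integral_add j1 (hi.1.const_mul _), integral_const_mul, integral_const_mul,
          integral_add (integrable_const 1) hi.1]
        simp only [integral_const, probReal_univ, smul_eq_mul, one_mul]
        have hr : 0 < √((n i : ℝ) * m i) := Real.sqrt_pos.2 (by positivity)
        have hrr : (m i : ℝ) * n i = √((n i : ℝ) * m i) ^ 2 := by
          rw [Real.sq_sqrt (by positivity), mul_comm]
        calc (m i : ℝ) * (n i * (4 * |s i| ^ 3 * (1 + ∫ y, F i y ∂P) + s i ^ 4 * ∫ y, F i y ∂P))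
            ≤ m i * (n i * (4 * |s i| ^ 3 * (1 + B) + s i ^ 4 * B)) := by
              have := hi.2
              gcongr
          _ = _ := by
              rw [← mul_assoc, hrr]
              simp only [hs]
              rw [abs_mul, abs_of_pos (inv_pos.2 hr)]
              field_simp
  -- the law of large numbers for the conditional variances
  have hlln : IsLittleOP l (fun i => Measure.pi fun _ : Fin (n i) => P) fun i y =>
      ((n i : ℝ))⁻¹ * ∑ k, V i (y k) - σ := by
    have h1 : IsLittleOP l (fun i => Measure.pi fun _ : Fin (n i) => P) fun i y =>
        ((n i : ℝ))⁻¹ * (∑ k, V i (y k) - n i * ∫ y, V i y ∂P) := by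
      refine isLittleOP_centred_sum (f := fun i y => V i y) (hVi.mono fun i hi => hi.1) ?_
      have hlim := hn_inv.mul_const B
      rw [zero_mul] at hlim
      refine squeeze_zero' (Eventually.of_forall fun i => ?_) ?_ hlim
      · exact mul_nonneg (sq_nonneg _) (mul_nonneg (Nat.cast_nonneg _)
          (integral_nonneg fun y => sq_nonneg _))
      · filter_upwards [hVi, hn.eventually_gt_atTop 0] with i hi hni
        have hn' : (0 : ℝ) < n i := by exact_mod_cast hni
        calc ((n i : ℝ))⁻¹ ^ 2 * (n i * ∫ y, V i y ^ 2 ∂P)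
            ≤ ((n i : ℝ))⁻¹ ^ 2 * (n i * B) := by
              have := hi.2
              gcongr
          _ = _ := by field_simp
    have h2 : Tendsto (fun i => ∫ y, V i y ∂P - σ) l (𝓝 0) := by
      simpa using hVσ.sub_const σ
    refine (h1.add (isLittleOP_of_tendsto h2)).congr_eq ?_
    filter_upwards [hn.eventually_gt_atTop 0] with i hni y
    have hn' : (n i : ℝ) ≠ 0 := by exact_mod_cast hni.ne'
    field_simp
    ring
  refine (hlin.add ((isBigOP_const (u ^ 2 / 2)).mul_isLittleOP (X := fun _ _ => u ^ 2 / 2)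
    (Y := fun i y => |((n i : ℝ))⁻¹ * ∑ k, V i (y k) - σ|) ?_)).of_abs_le ?_
  · exact hlln.of_abs_le (AsympSure.of_forall (Eventually.of_forall fun i y => by rw [abs_abs]))
  · refine AsympSure.of_ae ?_
    filter_upwards [hc4, h0, hn.eventually_gt_atTop 0, hm.eventually_gt_atTop 0]
      with i h4 h0i hni hmi
    have hm' : (0 : ℝ) < m i := by exact_mod_cast hmi
    have hn' : (0 : ℝ) < n i := by exact_mod_cast hni
    filter_upwards [ae_sample ((ae_memLp_four_section (hc i) h4).and h0i) (n i)] with y hy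
    have hb1 : ∀ k, ‖Complex.exp (-(s i ^ 2 / 2 * V i (y k) : ℝ))‖ ≤ 1 := by
      intro k
      rw [← Complex.ofReal_neg, Complex.norm_exp_ofReal]
      have := hV0 i (y k)
      exact Real.exp_le_one_iff.2 (neg_nonpos.2 (by positivity))
    have hprod : ∏ k, Complex.exp (-(s i ^ 2 / 2 * V i (y k) : ℝ)) ^ m i =
        Complex.exp (-(u ^ 2 / 2 * (((n i : ℝ))⁻¹ * ∑ k, V i (y k)) : ℝ)) := by
      simp only [← Complex.exp_nat_mul]
      rw [← Complex.exp_sum]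
      congr 1
      have e : s i ^ 2 = u ^ 2 * ((n i : ℝ) * m i)⁻¹ := by
        simp only [hs]
        rw [mul_pow, inv_pow, Real.sq_sqrt (by positivity)]
      rw [e]
      push_cast
      simp only [mul_neg, Finset.sum_neg_distrib, ← Finset.mul_sum]
      have : (n i : ℂ) ≠ 0 := by exact_mod_cast hn'.ne'
      have : (m i : ℂ) ≠ 0 := by exact_mod_cast hm'.ne'
      field_simp
    have hA : ‖∏ k, (∫ x, Complex.exp ((s i * c i (y k, x) : ℝ) * Complex.I) ∂(q i)) ^ m i -
        ∏ k, Complex.exp (-(s i ^ 2 / 2 * V i (y k) : ℝ)) ^ m i‖ ≤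
        (m i : ℝ) * ∑ k, (4 * |s i| ^ 3 * (1 + F i (y k)) + s i ^ 4 * F i (y k)) := by
      rw [Finset.mul_sum]
      refine (norm_prod_sub_prod_le_sum _ (fun k _ => ?_) fun k _ => ?_).trans
        (Finset.sum_le_sum fun k _ => ?_)
      · rw [norm_pow]
        exact pow_le_one₀ (norm_nonneg _) (norm_integral_exp_mul_I_le_one _)
      · rw [norm_pow]
        exact pow_le_one₀ (norm_nonneg _) (hb1 k)
      · refine (norm_pow_sub_pow_le (norm_integral_exp_mul_I_le_one _) (hb1 k) _).trans ?_
        gcongr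
        exact norm_integral_exp_sub_le (hy k).1 (hy k).2 (s i)
    have hC : ‖Complex.exp (-(u ^ 2 / 2 * (((n i : ℝ))⁻¹ * ∑ k, V i (y k)) : ℝ)) -
        Complex.exp (-(u ^ 2 / 2 * σ : ℝ))‖ ≤
        u ^ 2 / 2 * |((n i : ℝ))⁻¹ * ∑ k, V i (y k) - σ| := by
      rw [← Complex.ofReal_neg, ← Complex.ofReal_neg, ← Complex.ofReal_exp, ← Complex.ofReal_exp,
        ← Complex.ofReal_sub, Complex.norm_real, Real.norm_eq_abs]
      have hsum : 0 ≤ ∑ k, V i (y k) := Finset.sum_nonneg fun k _ => hV0 i _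
      refine (abs_exp_neg_sub_exp_neg_le (by positivity) (by positivity)).trans (le_of_eq ?_)
      rw [← mul_sub, abs_mul, abs_of_nonneg (show 0 ≤ u ^ 2 / 2 by positivity)]
    rw [abs_of_nonneg (norm_nonneg _)]
    refine le_trans ?_ (le_abs_self _)
    refine (norm_sub_le_norm_sub_add_norm_sub _ _ _).trans (add_le_add hA ?_)
    rw [hprod]
    exact hC

end ConditionalCharFun

/-! ### Draws whose law depends on a discretized statistic -/

section LatticeKernel

variable {𝒵 D : Type*} [MeasurableSpace 𝒵] [MeasurableSpace D]

/-- The kernel `y ↦ Q (g (k y))` for a measurable statistic `k` with integer values. No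
measurability of `Q` is needed, as only countably many of its values are used. -/
noncomputable def latticeKernel (Q : ℝ → Measure D) (g : ℤ → ℝ) {k : 𝒵 → ℤ} (hk : Measurable k) :
    Kernel 𝒵 D := (Kernel.ofFunOfCountable fun i => Q (g i)).comap k hk

variable {Q : ℝ → Measure D} {g : ℤ → ℝ} {k : 𝒵 → ℤ} {hk : Measurable k}

theorem latticeKernel_apply (y : 𝒵) : latticeKernel Q g hk y = Q (g (k y)) := rfl

instance isMarkovKernel_latticeKernel [∀ θ, IsProbabilityMeasure (Q θ)] :
    IsMarkovKernel (latticeKernel Q g hk) :=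
  ⟨fun y => by rw [latticeKernel_apply]; infer_instance⟩

theorem measurable_comp_lattice {E : Type*} [MeasurableSpace E] {F : ℝ → 𝒵 × D → E}
    (hF : ∀ θ, Measurable (F θ)) (hk : Measurable k) :
    Measurable fun z : 𝒵 × D => F (g (k z.1)) z := by
  have h : Measurable fun w : ℤ × (𝒵 × D) => F (g w.1) w.2 :=
    measurable_from_prod_countable_right fun i => hF (g i)
  exact h.comp ((hk.comp measurable_fst).prodMk measurable_id)

/-- On the event that the statistic has a given value, the draws are independent of the data. -/
theorem compProd_latticeKernel_le {law : Measure 𝒵} [SFinite law]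
    [∀ θ, IsProbabilityMeasure (Q θ)] (θ : ℝ) (p : 𝒵 × D → Prop) :
    (law ⊗ₘ latticeKernel Q g hk) {z | ¬ (g (k z.1) = θ → p z)} ≤ (law.prod (Q θ)) {z | ¬ p z} := by
  set E := toMeasurable (law.prod (Q θ)) {z | ¬ p z} with hE
  have hEm : MeasurableSet E := measurableSet_toMeasurable _ _
  have hF : MeasurableSet {z : 𝒵 × D | g (k z.1) = θ} :=
    (hk.comp measurable_fst) (MeasurableSet.of_discrete (s := {i : ℤ | g i = θ}))
  rw [← measure_toMeasurable (μ := law.prod (Q θ)) {z | ¬ p z}, ← hE]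
  refine (measure_mono (t := {z : 𝒵 × D | g (k z.1) = θ} ∩ E) ?_).trans ?_
  · intro z hz
    simp only [Set.mem_ofPred_eq, Classical.not_imp] at hz
    exact ⟨hz.1, subset_toMeasurable _ _ hz.2⟩
  · rw [Measure.compProd_apply (hF.inter hEm), Measure.prod_apply hEm]
    refine lintegral_mono fun y => ?_
    by_cases hy : g (k y) = θ
    · rw [latticeKernel_apply, hy]
      exact measure_mono fun x hx => hx.2
    · refine (measure_mono (t := ∅) fun x hx => hy hx.1).trans ?_
      simp

/-- Asymptotically sure events for independent data and draws, at deterministic values of the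
parameter, are so for draws that depend on the discretized statistic. -/
theorem AsympSure.of_draws {ι : Type*} {l : Filter ι} {𝒵 D Ω : ι → Type*}
    [∀ i, MeasurableSpace (𝒵 i)] [∀ i, MeasurableSpace (D i)] [∀ i, MeasurableSpace (Ω i)]
    {law : ∀ i, Measure (𝒵 i)} [∀ i, SFinite (law i)] {Pr : ∀ i, Measure (Ω i)}
    {Q : ∀ i, ℝ → Measure (D i)} [∀ i θ, IsProbabilityMeasure (Q i θ)] {g : ∀ _ : ι, ℤ → ℝ}
    {k : ∀ i, 𝒵 i → ℤ} {hk : ∀ i, Measurable (k i)} {T : ∀ i, Ω i → 𝒵 i × D i}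
    (hT : ∀ i, Measurable (T i))
    (hlaw : ∀ i, (Pr i).map (T i) = law i ⊗ₘ latticeKernel (Q i) (g i) (hk i))
    {θ : ι → ℝ} {p : ∀ i, 𝒵 i × D i → Prop}
    (hp : AsympSure l (fun i => (law i).prod (Q i (θ i))) p) :
    AsympSure l Pr fun i ω => g i (k i (T i ω).1) = θ i → p i (T i ω) := by
  have h : AsympSure l (fun i => law i ⊗ₘ latticeKernel (Q i) (g i) (hk i))
      fun i z => g i (k i z.1) = θ i → p i z :=
    tendsto_of_tendsto_of_tendsto_of_le_of_le tendsto_const_nhds hp (fun _ => zero_le)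
      fun i => compProd_latticeKernel_le (θ i) (p i)
  exact h.comp hT hlaw

end LatticeKernel

namespace ImportanceSampler

variable {𝒴 : Type*} [MeasurableSpace 𝒴] {M : ParametricModel 𝒴} {𝒳 : Type*} [MeasurableSpace 𝒳]
  (S : ImportanceSampler M 𝒳)

instance isProbabilityMeasure_proposal (θ : ℝ) : IsProbabilityMeasure (S.proposal θ) := by
  constructor
  rw [proposal, withDensity_apply _ MeasurableSet.univ, Measure.restrict_univ, S.lintegral_q θ]

/-- The law of independent draws at all points of the grid around `θ`, for all observations. -/
noncomputable def drawLaw (J n k : ℕ) (θ : ℝ) : Measure (Fin (2 * J + 1) → Fin n → Fin k → 𝒳) :=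
  Measure.pi fun j => Measure.pi fun _ => Measure.pi fun _ => S.proposal (gridPoint J n θ j)

instance isProbabilityMeasure_drawLaw (J n k : ℕ) (θ : ℝ) :
    IsProbabilityMeasure (S.drawLaw J n k θ) := by
  unfold drawLaw
  infer_instance

theorem drawLaw_box (J n k : ℕ) (θ : ℝ) (B : Fin (2 * J + 1) → Fin n → Fin k → Set 𝒳) :
    S.drawLaw J n k θ {x | ∀ j i l, x j i l ∈ B j i l} =
      ∏ j, ∏ i, ∏ l, S.proposal (gridPoint J n θ j) (B j i l) := by
  have : {x : Fin (2 * J + 1) → Fin n → Fin k → 𝒳 | ∀ j i l, x j i l ∈ B j i l} =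
      Set.pi Set.univ fun j => Set.pi Set.univ fun i => Set.pi Set.univ fun l => B j i l := by
    ext x
    simp [Set.mem_pi]
  rw [this, drawLaw, Measure.pi_pi]
  refine Finset.prod_congr rfl fun j _ => ?_
  rw [Measure.pi_pi]
  exact Finset.prod_congr rfl fun i _ => Measure.pi_pi _ _

/-- The joint law of data and draws is determined by its values on the rectangles in the definition
of `IsMonteCarloDraw`. -/
theorem IsMonteCarloDraw.map_eq {S : ImportanceSampler M 𝒳} {J n k : ℕ}
    {law : Measure (Fin n → 𝒴)} [IsProbabilityMeasure law] {θs : (Fin n → 𝒴) → ℝ} {Ω : Type*}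
    [MeasurableSpace Ω] {Pr : Measure Ω} [IsProbabilityMeasure Pr] {Y : Ω → Fin n → 𝒴}
    {X : Fin (2 * J + 1) → Fin n → Fin k → Ω → 𝒳} (h : S.IsMonteCarloDraw J n k law θs Pr Y X)
    (hY : Measurable Y) {g : ℤ → ℝ} {κ : (Fin n → 𝒴) → ℤ} (hκ : Measurable κ)
    (hθs : ∀ y, θs y = g (κ y)) :
    Pr.map (fun ω => (Y ω, fun j i l => X j i l ω)) =
      law ⊗ₘ latticeKernel (S.drawLaw J n k) g hκ := by
  have hXm : Measurable fun ω j i l => X j i l ω :=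
    measurable_pi_lambda _ fun j => measurable_pi_lambda _ fun i => measurable_pi_lambda _ fun l =>
      h.measurable j i l
  have hTm : Measurable fun ω => (Y ω, fun j i l => X j i l ω) := hY.prodMk hXm
  have : IsProbabilityMeasure (Pr.map fun ω => (Y ω, fun j i l => X j i l ω)) :=
    Measure.isProbabilityMeasure_map hTm.aemeasurable
  set C : Set (Set ((Fin n → 𝒴) × (Fin (2 * J + 1) → Fin n → Fin k → 𝒳))) :=
    {s | ∃ A, MeasurableSet A ∧ ∃ B : Fin (2 * J + 1) → Fin n → Fin k → Set 𝒳,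
      (∀ j i l, MeasurableSet (B j i l)) ∧ s = A ×ˢ {x | ∀ j i l, x j i l ∈ B j i l}} with hC
  have hbox : ∀ {B : Fin (2 * J + 1) → Fin n → Fin k → Set 𝒳}, (∀ j i l, MeasurableSet (B j i l)) →
      MeasurableSet {x : Fin (2 * J + 1) → Fin n → Fin k → 𝒳 | ∀ j i l, x j i l ∈ B j i l} := by
    intro B hB
    simp only [Set.ofPred_forall]
    refine MeasurableSet.iInter fun j => MeasurableSet.iInter fun i => MeasurableSet.iInter
      fun l => ?_
    have hm : Measurable fun x : Fin (2 * J + 1) → Fin n → Fin k → 𝒳 => x j i l := by fun_prop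
    exact hm (hB j i l)
  refine ext_of_generate_finite C ?_ ?_ ?_ ?_
  · refine le_antisymm (sup_le ?_ ?_) ?_
    · rintro _ ⟨A, hA, rfl⟩
      refine MeasurableSpace.measurableSet_generateFrom
        ⟨A, hA, fun _ _ _ => Set.univ, fun _ _ _ => MeasurableSet.univ, ?_⟩
      ext z
      simp
    · simp only [MeasurableSpace.pi, MeasurableSpace.comap_iSup, MeasurableSpace.comap_comp]
      refine iSup_le fun j => iSup_le fun i => iSup_le fun l => ?_
      rintro _ ⟨B, hB, rfl⟩
      refine MeasurableSpace.measurableSet_generateFrom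
        ⟨Set.univ, MeasurableSet.univ, fun j' i' l' => if j' = j ∧ i' = i ∧ l' = l then B
          else Set.univ, fun j' i' l' => ?_, ?_⟩
      · beta_reduce
        split_ifs
        exacts [hB, MeasurableSet.univ]
      · ext z
        simp only [Set.mem_preimage, Set.mem_prod, Set.mem_univ, true_and, Set.mem_ofPred_eq,
          Function.comp_apply]
        constructor
        · intro hz j' i' l'
          split_ifs with hcon
          · obtain ⟨rfl, rfl, rfl⟩ := hcon
            exact hz
          · exact Set.mem_univ _
        · intro hz
          simpa using hz j i l
    · refine MeasurableSpace.generateFrom_le ?_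
      rintro _ ⟨A, hA, B, hB, rfl⟩
      exact hA.prod (hbox hB)
  · rintro _ ⟨A, hA, B, hB, rfl⟩ _ ⟨A', hA', B', hB', rfl⟩ _
    refine ⟨A ∩ A', hA.inter hA', fun j i l => B j i l ∩ B' j i l,
      fun j i l => (hB j i l).inter (hB' j i l), ?_⟩
    ext z
    simp only [Set.mem_inter_iff, Set.mem_prod, Set.mem_ofPred_eq, forall_and]
    tauto
  · rintro _ ⟨A, hA, B, hB, rfl⟩
    rw [Measure.map_apply hTm (hA.prod (hbox hB)), Measure.compProd_apply_prod hA (hbox hB)]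
    simp only [latticeKernel_apply, drawLaw_box, ← hθs]
    exact h.joint A hA B hB
  · rw [measure_univ, measure_univ]

/-- Regrouping data and draws at one point of the grid by observations. -/
theorem measurePreserving_regroup (J n k : ℕ) (P : Measure 𝒴) [IsProbabilityMeasure P] (θ : ℝ)
    (j : Fin (2 * J + 1)) :
    MeasurePreserving (fun (z : (Fin n → 𝒴) × (Fin (2 * J + 1) → Fin n → Fin k → 𝒳)) (i : Fin n) =>
        (z.1 i, z.2 j i))
      ((Measure.pi fun _ : Fin n => P).prod (S.drawLaw J n k θ))
      (Measure.pi fun _ : Fin n => P.prod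
        (Measure.pi fun _ : Fin k => S.proposal (gridPoint J n θ j))) := by
  have h1 := (measurePreserving_arrowProdEquivProdArrow 𝒴 (Fin k → 𝒳) (Fin n) (fun _ => P)
    fun _ => Measure.pi fun _ : Fin k => S.proposal (gridPoint J n θ j)).symm
  have h2 := (MeasurePreserving.id (Measure.pi fun _ : Fin n => P)).prod
    (measurePreserving_eval (fun j => Measure.pi fun _ : Fin n => Measure.pi fun _ : Fin k =>
      S.proposal (gridPoint J n θ j)) j)
  exact h1.comp h2

end ImportanceSampler

/-! ### Relative errors of importance weights -/

/-- The estimated densities do not vanish, so that their logarithms are proper. -/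
theorem asympSure_average_ne {ι : Type*} {l : Filter ι} {n m : ι → ℕ} {𝒴 : Type*}
    [MeasurableSpace 𝒴] {P : Measure 𝒴} [IsProbabilityMeasure P] {𝒳 : Type*} [MeasurableSpace 𝒳]
    {q : ι → Measure 𝒳} [∀ i, IsProbabilityMeasure (q i)] {c : ι → 𝒴 × 𝒳 → ℝ} {B : ℝ}
    (hc : ∀ i, Measurable (c i)) (hc4 : ∀ᶠ i in l, MemLp (c i) 4 (P.prod (q i)))
    (hB : ∀ᶠ i in l, ∫ z, c i z ^ 4 ∂(P.prod (q i)) ≤ B)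
    (h0 : ∀ᶠ i in l, ∀ᵐ y ∂P, ∫ x, c i (y, x) ∂(q i) = 0) (hm : Tendsto m l atTop)
    (hnm : Tendsto (fun i => √(n i : ℝ) / m i) l (𝓝 0)) :
    AsympSure l
      (fun i => Measure.pi fun _ : Fin (n i) => P.prod (Measure.pi fun _ : Fin (m i) => q i))
      fun i z => ∀ k, 1 + (m i : ℝ)⁻¹ * ∑ r, c i ((z k).1, (z k).2 r) ≠ 0 := by
  refine (asympSure_forall_abs_le_half
    (R := fun i => P.prod (Measure.pi fun _ : Fin (m i) => q i)) (n := n) (m := m) (B := 3 * B)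
    (w := fun i (z : 𝒴 × (Fin (m i) → 𝒳)) => (m i : ℝ)⁻¹ * ∑ r, c i (z.1, z.2 r))
    (fun i => ?_) ?_ ?_ hnm).mono (Eventually.of_forall fun i z hz k hk => ?_)
  · refine (Finset.measurable_fun_sum _ fun r _ => (hc i).comp ?_).const_mul _
    fun_prop
  · filter_upwards [hc4] with i hi
    exact (memLp_four_sum_draws hi (m i)).const_mul _
  · filter_upwards [hc4, hB, h0, hm.eventually_gt_atTop 0] with i h1 h2 h3 h4
    exact integral_average_pow_four_le (hc i) h1 h2 h3 h4
  · have := (abs_le.1 (hz k)).1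
    linarith

namespace ImportanceSampler

variable {𝒴 : Type*} [MeasurableSpace 𝒴] {M : ParametricModel 𝒴} {𝒳 : Type*} [MeasurableSpace 𝒳]
  (S : ImportanceSampler M 𝒳)

/-- The importance weight relative to the density that it estimates. -/
noncomputable def relWeight (θ : ℝ) (z : 𝒴 × 𝒳) : ℝ := S.weight θ z.1 z.2 / M.p θ z.1

/-- The relative importance weight, centred given the observation. -/
noncomputable def relErr (θ : ℝ) (z : 𝒴 × 𝒳) : ℝ :=
  S.relWeight θ z - ∫ x, S.relWeight θ (z.1, x) ∂(S.proposal θ)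

theorem measurable_weight (θ : ℝ) : Measurable fun z : 𝒴 × 𝒳 => S.weight θ z.1 z.2 := by
  have h1 : Measurable fun z : 𝒴 × 𝒳 => S.pYX θ z.2 z.1 :=
    (S.measurable_pYX θ).comp measurable_swap
  have h2 := S.measurable_pX θ
  have h3 := S.measurable_q θ
  exact h1.mul ((h2.comp measurable_snd).div (h3.comp measurable_snd))

theorem weight_nonneg (θ : ℝ) (y : 𝒴) (x : 𝒳) : 0 ≤ S.weight θ y x :=
  mul_nonneg (S.nonneg_pYX θ x y) (div_nonneg (S.nonneg_pX θ x) (S.nonneg_q θ x))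

theorem measurable_relWeight (θ : ℝ) : Measurable (S.relWeight θ) :=
  (S.measurable_weight θ).div ((M.measurable_p θ).comp measurable_fst)

theorem measurable_relErr (θ : ℝ) : Measurable (S.relErr θ) :=
  (S.measurable_relWeight θ).sub
    (((S.measurable_relWeight θ).stronglyMeasurable.integral_prod_right').measurable.comp
      measurable_fst)

/-- The weight is unbiased for the density. -/
theorem ae_lintegral_weight {θ : ℝ} (hθ : θ ∈ M.Θ) : ∀ᵐ y ∂M.μ,
    ∫⁻ x, ENNReal.ofReal (S.weight θ y x) ∂(S.proposal θ) = ENNReal.ofReal (M.p θ y) := by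
  filter_upwards [S.marginal θ hθ, S.support θ hθ] with y h1 h2
  have hm : Measurable fun x => ENNReal.ofReal (S.weight θ y x) :=
    ((S.measurable_weight θ).comp measurable_prodMk_left).ennreal_ofReal
  rw [proposal, lintegral_withDensity_eq_lintegral_mul _ (S.measurable_q θ).ennreal_ofReal hm, ← h1]
  refine lintegral_congr_ae ?_
  filter_upwards [h2] with x hx
  rw [Pi.mul_apply, ← ENNReal.ofReal_mul (S.nonneg_q θ x)]
  congr 1
  rw [weight]
  by_cases hq : S.q θ x = 0
  · rw [hx hq, hq, zero_mul]
  · field_simp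

/-- Relative weights have conditional mean one, except where the density vanishes and so do the
weights. -/
theorem ae_weight {θ₀ θ : ℝ} (hθ : θ ∈ M.Θ) : ∀ᵐ y ∂(M.P θ₀),
    (M.p θ y ≠ 0 → ∫ x, S.relWeight θ (y, x) ∂(S.proposal θ) = 1) ∧
      (M.p θ y = 0 → ∀ᵐ x ∂(S.proposal θ), S.weight θ y x = 0) := by
  have hac : M.P θ₀ ≪ M.μ := withDensity_absolutelyContinuous _ _
  filter_upwards [hac.ae_le (S.ae_lintegral_weight hθ)] with y hy
  have hm : Measurable (S.weight θ y) := (S.measurable_weight θ).comp measurable_prodMk_left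
  constructor
  · intro hp
    simp only [relWeight]
    rw [integral_div, integral_eq_lintegral_of_nonneg_ae
      (Eventually.of_forall (S.weight_nonneg θ y)) hm.aestronglyMeasurable, hy,
      ENNReal.toReal_ofReal (M.nonneg_p θ y), div_self hp]
  · intro hp
    rw [hp, ENNReal.ofReal_zero, lintegral_eq_zero_iff hm.ennreal_ofReal] at hy
    filter_upwards [hy] with x hx
    exact le_antisymm (ENNReal.ofReal_eq_zero.1 hx) (S.weight_nonneg θ y x)

/-- The error of the estimated log-density is the logarithm of one plus the average relative error.
Where `p(y; θ) = 0` the weights vanish and both sides are zero, as `Real.log 0 = 0`. -/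
theorem ae_log_pbar_sub_log {θ₀ θ : ℝ} (hθ : θ ∈ M.Θ) {k : ℕ} (hk : 0 < k) :
    ∀ᵐ z ∂((M.P θ₀).prod (Measure.pi fun _ : Fin k => S.proposal θ)),
      1 + (k : ℝ)⁻¹ * ∑ r, S.relErr θ (z.1, z.2 r) ≠ 0 →
      Real.log (S.pbar θ z.1 z.2) - Real.log (M.p θ z.1) =
        Real.log (1 + (k : ℝ)⁻¹ * ∑ r, S.relErr θ (z.1, z.2 r)) := by
  have hk' : (k : ℝ) ≠ 0 := by exact_mod_cast hk.ne'
  have hw0 : ∀ᵐ z ∂((M.P θ₀).prod (Measure.pi fun _ : Fin k => S.proposal θ)),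
      M.p θ z.1 = 0 → ∀ r, S.weight θ z.1 (z.2 r) = 0 := by
    have hm : MeasurableSet {z : 𝒴 × (Fin k → 𝒳) | M.p θ z.1 = 0 →
        ∀ r, S.weight θ z.1 (z.2 r) = 0} := by
      have h1 : MeasurableSet {z : 𝒴 × (Fin k → 𝒳) | M.p θ z.1 = 0} :=
        measurableSet_eq_fun ((M.measurable_p θ).comp measurable_fst) measurable_const
      have h2 : MeasurableSet {z : 𝒴 × (Fin k → 𝒳) | ∀ r, S.weight θ z.1 (z.2 r) = 0} := by
        rw [Set.ofPred_forall]
        refine MeasurableSet.iInter fun r => measurableSet_eq_fun ?_ measurable_const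
        exact (S.measurable_weight θ).comp
          (measurable_fst.prodMk ((measurable_pi_apply r).comp measurable_snd))
      exact h1.imp h2
    rw [Measure.ae_prod_iff_ae_ae hm]
    filter_upwards [S.ae_weight hθ] with y hy
    by_cases hp : M.p θ y = 0
    · filter_upwards [ae_sample (hy.2 hp) k] with x hx _
      exact hx
    · exact Eventually.of_forall fun x h => absurd h hp
  have hw1 : ∀ᵐ z ∂((M.P θ₀).prod (Measure.pi fun _ : Fin k => S.proposal θ)),
      M.p θ z.1 ≠ 0 → ∫ x, S.relWeight θ (z.1, x) ∂(S.proposal θ) = 1 :=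
    (Measure.quasiMeasurePreserving_fst (μ := M.P θ₀)).ae ((S.ae_weight hθ).mono fun y hy => hy.1)
  filter_upwards [hw0, hw1] with z h0 h1 hne
  by_cases hp : M.p θ z.1 = 0
  · have hb : S.pbar θ z.1 z.2 = 0 := by
      rw [pbar, Finset.sum_eq_zero fun r _ => h0 hp r, mul_zero]
    have he : ∀ r, S.relErr θ (z.1, z.2 r) = 0 := fun r => by
      simp [relErr, relWeight, hp]
    simp [hb, hp, he]
  · have hb : 1 + (k : ℝ)⁻¹ * ∑ r, S.relErr θ (z.1, z.2 r) = S.pbar θ z.1 z.2 / M.p θ z.1 := by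
      simp only [relErr, h1 hp, Finset.sum_sub_distrib, Finset.sum_const,
        Finset.card_univ, Fintype.card_fin, nsmul_eq_mul, mul_one]
      simp only [relWeight, ← Finset.sum_div]
      rw [pbar]
      field_simp
      ring
    have hb0 : S.pbar θ z.1 z.2 ≠ 0 := by
      intro h
      rw [hb, h, zero_div] at hne
      exact hne rfl
    rw [hb, Real.log_div hb0 hp]

section Moments

variable {S} {θ₀ : ℝ} {B : ℝ≥0}

theorem memLp_relWeight {θ : ℝ}
    (hB : ∫⁻ y, ∫⁻ x, ENNReal.ofReal ((S.weight θ y x / M.p θ y) ^ 4) ∂(S.proposal θ) ∂(M.P θ₀) ≤ B)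
    (h₀ : θ₀ ∈ M.Θ) :
    MemLp (S.relWeight θ) 4 ((M.P θ₀).prod (S.proposal θ)) ∧
      ∫ z, S.relWeight θ z ^ 4 ∂((M.P θ₀).prod (S.proposal θ)) ≤ B := by
  have := M.isProbabilityMeasure_P h₀
  have hm := (S.measurable_relWeight θ).pow_const 4
  have h0 : ∀ z, 0 ≤ S.relWeight θ z ^ 4 := fun z => by positivity
  have hl : ∫⁻ z, ENNReal.ofReal (S.relWeight θ z ^ 4) ∂((M.P θ₀).prod (S.proposal θ)) ≤ B := by
    rw [lintegral_prod _ hm.ennreal_ofReal.aemeasurable]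
    exact hB
  have hi : Integrable (fun z => S.relWeight θ z ^ 4) ((M.P θ₀).prod (S.proposal θ)) :=
    ⟨hm.aestronglyMeasurable, (hasFiniteIntegral_iff_ofReal (Eventually.of_forall h0)).2
      (hl.trans_lt ENNReal.coe_lt_top)⟩
  refine ⟨(memLp_four_iff (S.measurable_relWeight θ).aestronglyMeasurable).2 hi, ?_⟩
  rw [integral_eq_lintegral_of_nonneg_ae (Eventually.of_forall h0) hm.aestronglyMeasurable]
  exact ENNReal.toReal_le_coe_of_le_coe hl

theorem integral_pow_four_le {α : Type*} [MeasurableSpace α] {ν : Measure α}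
    [IsProbabilityMeasure ν] {f : α → ℝ} (hf : MemLp f 4 ν) :
    (∫ x, f x ∂ν) ^ 4 ≤ ∫ x, f x ^ 4 ∂ν := by
  have h2 : MemLp f 2 ν := hf.mono_exponent (by norm_num)
  have h := variance_nonneg f ν
  rw [variance_eq_sub h2] at h
  have e : ν[f ^ 2] = ∫ x, f x ^ 2 ∂ν := rfl
  rw [e] at h
  have h4 := sq_integral_sq_le hf
  nlinarith [sq_nonneg (∫ x, f x ∂ν)]

/-- Centring at most multiplies the fourth moment by `16`, by convexity. -/
theorem memLp_relErr {θ : ℝ}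
    (hB : ∫⁻ y, ∫⁻ x, ENNReal.ofReal ((S.weight θ y x / M.p θ y) ^ 4) ∂(S.proposal θ) ∂(M.P θ₀) ≤ B)
    (h₀ : θ₀ ∈ M.Θ) :
    MemLp (S.relErr θ) 4 ((M.P θ₀).prod (S.proposal θ)) ∧
      ∫ z, S.relErr θ z ^ 4 ∂((M.P θ₀).prod (S.proposal θ)) ≤ 16 * B := by
  have := M.isProbabilityMeasure_P h₀
  obtain ⟨hv, hvB⟩ := memLp_relWeight hB h₀
  have iv := MemLp.integrable_pow_of_le_four hv le_rfl
  have ig := iv.integral_prod_left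
  have ig' : Integrable (fun z : 𝒴 × 𝒳 => ∫ x, S.relWeight θ (z.1, x) ^ 4 ∂(S.proposal θ))
      ((M.P θ₀).prod (S.proposal θ)) := ig.comp_fst (S.proposal θ)
  have hle : ∀ᵐ z ∂((M.P θ₀).prod (S.proposal θ)), S.relErr θ z ^ 4 ≤
      8 * (S.relWeight θ z ^ 4 + ∫ x, S.relWeight θ (z.1, x) ^ 4 ∂(S.proposal θ)) := by
    have h1 : ∀ᵐ y ∂(M.P θ₀), (∫ x, S.relWeight θ (y, x) ∂(S.proposal θ)) ^ 4 ≤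
        ∫ x, S.relWeight θ (y, x) ^ 4 ∂(S.proposal θ) := by
      filter_upwards [ae_memLp_four_section (S.measurable_relWeight θ) hv] with y hy
      exact integral_pow_four_le hy
    filter_upwards [(Measure.quasiMeasurePreserving_fst (μ := M.P θ₀)
      (ν := S.proposal θ)).ae h1] with z hz
    rw [relErr]
    have : ∀ a b : ℝ, (a - b) ^ 4 ≤ 8 * (a ^ 4 + b ^ 4) := fun a b => by
      nlinarith [sq_nonneg (a + b), sq_nonneg (a - b), sq_nonneg (a ^ 2 - b ^ 2),
        sq_nonneg ((a + b) ^ 2), mul_nonneg (sq_nonneg (a + b)) (sq_nonneg (a - b)),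
        sq_nonneg (a ^ 2 + b ^ 2 + 2 * (a * b))]
    refine (this _ _).trans ?_
    gcongr
  have jb : Integrable (fun z : 𝒴 × 𝒳 => 8 * (S.relWeight θ z ^ 4 +
      ∫ x, S.relWeight θ (z.1, x) ^ 4 ∂(S.proposal θ))) ((M.P θ₀).prod (S.proposal θ)) :=
    (iv.add ig').const_mul 8
  have ie : Integrable (fun z => S.relErr θ z ^ 4) ((M.P θ₀).prod (S.proposal θ)) :=
    jb.mono' ((S.measurable_relErr θ).pow_const 4).aestronglyMeasurable (by
      filter_upwards [hle] with z hz
      rwa [Real.norm_of_nonneg (by positivity)])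
  refine ⟨(memLp_four_iff (S.measurable_relErr θ).aestronglyMeasurable).2 ie, ?_⟩
  refine (integral_mono_ae ie jb hle).trans ?_
  have e : ∫ z : 𝒴 × 𝒳, ∫ x, S.relWeight θ (z.1, x) ^ 4 ∂(S.proposal θ)
      ∂((M.P θ₀).prod (S.proposal θ)) =
      ∫ z, S.relWeight θ z ^ 4 ∂((M.P θ₀).prod (S.proposal θ)) := by
    rw [integral_prod _ ig', integral_prod _ iv]
    simp
  rw [integral_const_mul, integral_add iv ig', e]
  linarith

theorem ae_integral_relErr {θ : ℝ}
    (hB : ∫⁻ y, ∫⁻ x, ENNReal.ofReal ((S.weight θ y x / M.p θ y) ^ 4) ∂(S.proposal θ) ∂(M.P θ₀) ≤ B)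
    (h₀ : θ₀ ∈ M.Θ) : ∀ᵐ y ∂(M.P θ₀), ∫ x, S.relErr θ (y, x) ∂(S.proposal θ) = 0 := by
  have := M.isProbabilityMeasure_P h₀
  filter_upwards [ae_memLp_four_section (S.measurable_relWeight θ) (memLp_relWeight hB h₀).1]
    with y hy
  simp only [relErr]
  rw [integral_sub (hy.integrable (by norm_num)) (integrable_const _)]
  simp

theorem integral_relErr_sq {θ : ℝ}
    (hB : ∫⁻ y, ∫⁻ x, ENNReal.ofReal ((S.weight θ y x / M.p θ y) ^ 4) ∂(S.proposal θ) ∂(M.P θ₀) ≤ B)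
    (h₀ : θ₀ ∈ M.Θ) :
    ∫ z, S.relErr θ z ^ 2 ∂((M.P θ₀).prod (S.proposal θ)) = S.relVar θ₀ θ := by
  have := M.isProbabilityMeasure_P h₀
  rw [integral_prod _ (MemLp.integrable_pow_of_le_four (memLp_relErr hB h₀).1 (by norm_num)),
    relVar]
  refine integral_congr_ae (Eventually.of_forall fun y => ?_)
  have hm : Measurable fun x => S.weight θ y x / M.p θ y :=
    (S.measurable_relWeight θ).comp measurable_prodMk_left
  simp only
  rw [variance_eq_integral hm.aemeasurable]
  rfl

end Moments

/-- The expansion of the estimated log-likelihood at parameters that converge to `θ₀`: a bias of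
order `n / m` and a linear noise term of order `√(n / m)`. -/
theorem isLittleOP_log_pbar {S : ImportanceSampler M 𝒳} {θ₀ : ℝ} (h₀ : θ₀ ∈ M.Θ)
    (hS : S.IsRegularAt θ₀) {ι : Type*} {l : Filter ι} {n m : ι → ℕ} {ϑ : ι → ℝ}
    (hϑ : Tendsto ϑ l (𝓝 θ₀)) (hn : Tendsto n l atTop) (hm : Tendsto m l atTop)
    (hnm : Tendsto (fun i => √(n i : ℝ) / m i) l (𝓝 0)) :
    IsLittleOP l
      (fun i => Measure.pi fun _ : Fin (n i) =>
        (M.P θ₀).prod (Measure.pi fun _ : Fin (m i) => S.proposal (ϑ i)))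
      fun i z => √((m i : ℝ) / n i) *
        (∑ k, (Real.log (S.pbar (ϑ i) (z k).1 (z k).2) - Real.log (M.p (ϑ i) (z k).1)) +
          n i / (2 * m i) * S.relVar θ₀ (ϑ i)) -
        (√((n i : ℝ) * m i))⁻¹ * ∑ k, ∑ r, S.relErr (ϑ i) ((z k).1, (z k).2 r) := by
  have := M.isProbabilityMeasure_P h₀
  obtain ⟨B, hB⟩ := hS.fourth_moment
  have hB' := hϑ.eventually hB
  have hΘ : ∀ᶠ i in l, ϑ i ∈ M.Θ := hϑ (M.isOpen.mem_nhds h₀)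
  have h4 : ∀ᶠ i in l, MemLp (S.relErr (ϑ i)) 4 ((M.P θ₀).prod (S.proposal (ϑ i))) :=
    hB'.mono fun i hi => (memLp_relErr hi h₀).1
  have h4B : ∀ᶠ i in l, ∫ z, S.relErr (ϑ i) z ^ 4 ∂((M.P θ₀).prod (S.proposal (ϑ i))) ≤
    16 * B := hB'.mono fun i hi => (memLp_relErr hi h₀).2
  have h0 := hB'.mono fun i hi => ae_integral_relErr hi h₀
  refine (isLittleOP_sum_log_average (fun i => S.measurable_relErr (ϑ i)) h4 h4B h0
    (hn.eventually_gt_atTop 0) hm hnm).congr ?_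
  refine ((asympSure_average_ne (fun i => S.measurable_relErr (ϑ i)) h4 h4B h0 hm hnm).and
    (AsympSure.of_ae (p := fun i z => ∀ k, 1 + (m i : ℝ)⁻¹ *
        ∑ r, S.relErr (ϑ i) ((z k).1, (z k).2 r) ≠ 0 →
      Real.log (S.pbar (ϑ i) (z k).1 (z k).2) - Real.log (M.p (ϑ i) (z k).1) =
        Real.log (1 + (m i : ℝ)⁻¹ * ∑ r, S.relErr (ϑ i) ((z k).1, (z k).2 r))) ?_)).mono ?_
  · filter_upwards [hΘ, hm.eventually_gt_atTop 0] with i hi hmi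
    exact ae_sample (S.ae_log_pbar_sub_log hi hmi) (n i)
  · filter_upwards [hB'] with i hi z hz
    rw [integral_relErr_sq hi h₀, Finset.sum_congr rfl fun k _ => hz.2 k (hz.1 k)]

end ImportanceSampler

/-! ### Importance sampling obeys the Monte Carlo model -/

theorem tendsto_gridPoint_windowFilter {J : ℕ} (θ₀ B : ℝ) (j : Fin (2 * J + 1)) :
    Tendsto (fun p : ℕ × ℝ => gridPoint J p.1 p.2 j) (windowFilter θ₀ B) (𝓝 θ₀) := by
  rw [tendsto_iff_dist_tendsto_zero]
  have h := (tendsto_gridScale.const_mul (B + |gridIndex J j|)).comp (tendsto_fst_windowFilter θ₀ B)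
  rw [mul_zero] at h
  refine squeeze_zero' (Eventually.of_forall fun p => dist_nonneg) ?_ h
  rw [eventually_windowFilter]
  filter_upwards [eventually_gt_atTop 0] with n hn θ hθ
  rw [Real.dist_eq]
  exact abs_gridPoint_sub_le hn hθ j

/-- The first-order expansion of a function differentiable at `θ₀`, at grid points. The centre of
the grid is another one, so that no derivative at nearby points is involved in comparing the two.
-/
theorem isLittleO_comp_gridPoint {J : ℕ} {θ₀ : ℝ} {Ψ : ℝ → ℝ} (hΨ : DifferentiableAt ℝ Ψ θ₀) (B : ℝ)
    (j : Fin (2 * J + 1)) :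
    (fun p : ℕ × ℝ => Ψ (gridPoint J p.1 p.2 j) - Ψ θ₀ -
      deriv Ψ θ₀ * (gridPoint J p.1 p.2 j - θ₀)) =o[windowFilter θ₀ B] fun p => gridScale p.1 := by
  have h := (hasDerivAt_iff_isLittleO.1 hΨ.hasDerivAt).comp_tendsto
    (tendsto_gridPoint_windowFilter θ₀ B j)
  have hO : (fun p : ℕ × ℝ => gridPoint J p.1 p.2 j - θ₀) =O[windowFilter θ₀ B]
      fun p => gridScale p.1 := by
    refine Asymptotics.IsBigO.of_bound (B + |gridIndex J j|) ?_
    rw [eventually_windowFilter]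
    filter_upwards [eventually_gt_atTop 0] with n hn θ hθ
    rw [Real.norm_eq_abs, Real.norm_of_nonneg (gridScale_pos hn).le]
    exact abs_gridPoint_sub_le hn hθ j
  refine (h.trans_isBigO hO).congr_left fun p => ?_
  simp only [Function.comp_apply, smul_eq_mul]
  ring

/-- A differentiable function has difference quotients along the grid that converge to its
derivative. -/
theorem tendsto_gridPoint_slope {J : ℕ} {θ₀ : ℝ} {Ψ : ℝ → ℝ} (hΨ : DifferentiableAt ℝ Ψ θ₀) (B : ℝ)
    (j : Fin (2 * J + 1)) :
    Tendsto (fun p : ℕ × ℝ => (Ψ (gridPoint J p.1 p.2 j) - Ψ p.2) / gridScale p.1)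
      (windowFilter θ₀ B) (𝓝 (deriv Ψ θ₀ * gridIndex J j)) := by
  -- the centre of the grid is its point of index `J`
  have hc : ∀ (n : ℕ) (θ : ℝ), gridPoint J n θ ⟨J, by omega⟩ = θ := by
    intro n θ
    simp [gridPoint, gridIndex]
  have h := ((isLittleO_comp_gridPoint hΨ B j).sub
    (isLittleO_comp_gridPoint (J := J) hΨ B ⟨J, by omega⟩)).tendsto_div_nhds_zero
  have h' := h.add_const (deriv Ψ θ₀ * gridIndex J j)
  rw [zero_add] at h'
  refine h'.congr' ?_
  rw [EventuallyEq, eventually_windowFilter]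
  filter_upwards [eventually_gt_atTop 0] with n hn θ _
  have hg := (gridScale_pos hn).ne'
  simp only [hc]
  rw [gridPoint]
  field_simp
  ring

theorem tendsto_comp_gridPoint {θ₀ B : ℝ} {Ψ : ℝ → ℝ} (hΨ : DifferentiableAt ℝ Ψ θ₀) {J : ℕ}
    (j : Fin (2 * J + 1)) :
    Tendsto (fun p : ℕ × ℝ => Ψ (gridPoint J p.1 p.2 j)) (windowFilter θ₀ B) (𝓝 (Ψ θ₀)) :=
  hΨ.continuousAt.tendsto.comp (tendsto_gridPoint_windowFilter θ₀ B j)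

namespace ImportanceSampler

variable {𝒴 : Type*} [MeasurableSpace 𝒴] {M : ParametricModel 𝒴} {𝒳 : Type*} [MeasurableSpace 𝒳]
  (S : ImportanceSampler M 𝒳)

/-- The linear part of the Monte Carlo noise at the `j`-th point of the grid around `θ`. -/
noncomputable def linearNoise (J n k : ℕ) (j : Fin (2 * J + 1)) (θ : ℝ)
    (z : (Fin n → 𝒴) × (Fin (2 * J + 1) → Fin n → Fin k → 𝒳)) : ℝ :=
  (√((n : ℝ) * k))⁻¹ * ∑ i, ∑ r, S.relErr (gridPoint J n θ j) (z.1 i, z.2 j i r)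

theorem measurable_linearNoise (J n k : ℕ) (j : Fin (2 * J + 1)) (θ : ℝ) :
    Measurable (S.linearNoise (𝒴 := 𝒴) J n k j θ) := by
  refine (Finset.measurable_fun_sum _ fun i _ => Finset.measurable_fun_sum _ fun r _ =>
    (S.measurable_relErr _).comp ?_).const_mul _
  fun_prop

/-- The conditional characteristic function of the linear noise factorizes. -/
theorem integral_exp_linearNoise (J n k : ℕ) (θ : ℝ) (y : Fin n → 𝒴) (u : Fin (2 * J + 1) → ℝ) :
    ∫ x, Complex.exp ((∑ j, u j * S.linearNoise J n k j θ (y, x) : ℝ) * Complex.I)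
        ∂(S.drawLaw J n k θ) =
      ∏ j, ∏ i, (∫ x, Complex.exp ((u j * (√((n : ℝ) * k))⁻¹ *
        S.relErr (gridPoint J n θ j) (y i, x) : ℝ) * Complex.I)
          ∂(S.proposal (gridPoint J n θ j))) ^ k := by
  have e : ∀ x : Fin (2 * J + 1) → Fin n → Fin k → 𝒳,
      Complex.exp ((∑ j, u j * S.linearNoise J n k j θ (y, x) : ℝ) * Complex.I) =
        ∏ j, ∏ i, ∏ r, Complex.exp ((u j * (√((n : ℝ) * k))⁻¹ *
          S.relErr (gridPoint J n θ j) (y i, x j i r) : ℝ) * Complex.I) := by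
    intro x
    simp only [← Complex.exp_sum, ← Finset.sum_mul, ← Complex.ofReal_sum, linearNoise,
      ← Finset.mul_sum, mul_assoc]
  simp only [e]
  rw [drawLaw, integral_fintype_prod_eq_prod (μ := fun j : Fin (2 * J + 1) =>
      Measure.pi fun _ : Fin n => Measure.pi fun _ : Fin k => S.proposal (gridPoint J n θ j))
    (f := fun (j : Fin (2 * J + 1)) (x : Fin n → Fin k → 𝒳) =>
      ∏ i, ∏ r, Complex.exp ((u j * (√((n : ℝ) * k))⁻¹ *
          S.relErr (gridPoint J n θ j) (y i, x i r) : ℝ) * Complex.I))]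
  refine Finset.prod_congr rfl fun j _ => ?_
  rw [integral_fintype_prod_eq_prod (μ := fun _ : Fin n =>
      Measure.pi fun _ : Fin k => S.proposal (gridPoint J n θ j))
    (f := fun (i : Fin n) (x : Fin k → 𝒳) => ∏ r, Complex.exp ((u j * (√((n : ℝ) * k))⁻¹ *
          S.relErr (gridPoint J n θ j) (y i, x r) : ℝ) * Complex.I))]
  refine Finset.prod_congr rfl fun i _ => ?_
  rw [integral_fintype_prod_eq_prod (μ := fun _ : Fin k => S.proposal (gridPoint J n θ j))
    (f := fun (_ : Fin k) (x : 𝒳) => Complex.exp ((u j * (√((n : ℝ) * k))⁻¹ *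
          S.relErr (gridPoint J n θ j) (y i, x) : ℝ) * Complex.I))]
  simp

section Sampling

variable {S} {θ₀ : ℝ} {J : ℕ} {m : ℕ → ℕ}

theorem tendsto_simulations (hm : Tendsto (fun n : ℕ => (m n : ℝ) / √(n : ℝ)) atTop atTop) :
    Tendsto m atTop atTop := by
  rw [← tendsto_natCast_atTop_iff (R := ℝ)]
  refine tendsto_atTop_mono' atTop ?_ hm
  filter_upwards [eventually_ge_atTop 1] with n hn
  refine div_le_self (Nat.cast_nonneg _) ?_
  rw [Real.one_le_sqrt]
  exact_mod_cast hn

theorem eventually_fourth_moment_le (hS : S.IsRegularAt θ₀) (B : ℝ) (j : Fin (2 * J + 1)) :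
    ∃ K : ℝ≥0, ∀ᶠ p in windowFilter θ₀ B, ∫⁻ y, ∫⁻ x, ENNReal.ofReal
      ((S.weight (gridPoint J p.1 p.2 j) y x / M.p (gridPoint J p.1 p.2 j) y) ^ 4)
      ∂(S.proposal (gridPoint J p.1 p.2 j)) ∂(M.P θ₀) ≤ K := by
  obtain ⟨K, hK⟩ := hS.fourth_moment
  exact ⟨K, (tendsto_gridPoint_windowFilter θ₀ B j).eventually hK⟩

/-- Given the data, the linear noise at points of the windows has asymptotically independent centred
normal coordinates with variance `relVar θ₀ θ₀`. -/
theorem isLittleOP_conditional_linearNoise (h₀ : θ₀ ∈ M.Θ) (hS : S.IsRegularAt θ₀)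
    (hm : Tendsto m atTop atTop) (u : Fin (2 * J + 1) → ℝ) (B : ℝ) :
    IsLittleOP (windowFilter θ₀ B) (fun p => M.sampleLaw θ₀ p.1) fun p y =>
      ‖∫ x, Complex.exp ((∑ j, u j * S.linearNoise J p.1 (m p.1) j p.2 (y, x) : ℝ) * Complex.I)
          ∂(S.drawLaw J p.1 (m p.1) p.2) -
        Complex.exp (-(S.relVar θ₀ θ₀ * ∑ j, u j ^ 2 / 2 : ℝ))‖ := by
  have := M.isProbabilityMeasure_P h₀
  have hn := tendsto_fst_windowFilter θ₀ B
  have hj : ∀ j, IsLittleOP (windowFilter θ₀ B) (fun p => M.sampleLaw θ₀ p.1) fun p y =>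
      ‖∏ i, (∫ x, Complex.exp ((u j * (√((p.1 : ℝ) * m p.1))⁻¹ *
        S.relErr (gridPoint J p.1 p.2 j) (y i, x) : ℝ) * Complex.I)
          ∂(S.proposal (gridPoint J p.1 p.2 j))) ^ m p.1 -
        Complex.exp (-(u j ^ 2 / 2 * S.relVar θ₀ θ₀ : ℝ))‖ := by
    intro j
    obtain ⟨K, hK⟩ := eventually_fourth_moment_le (J := J) hS B j
    refine isLittleOP_conditional_charFun (P := M.P θ₀) (l := windowFilter θ₀ B)
      (n := fun p => p.1) (m := fun p => m p.1) (B := 16 * K)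
      (q := fun p => S.proposal (gridPoint J p.1 p.2 j))
      (c := fun p => S.relErr (gridPoint J p.1 p.2 j)) (fun p => S.measurable_relErr _)
      (hK.mono fun p hp => (memLp_relErr hp h₀).1) (hK.mono fun p hp => (memLp_relErr hp h₀).2)
      (hK.mono fun p hp => ae_integral_relErr hp h₀) ?_ hS.relVar_pos.le hn (hm.comp hn) (u j)
    refine (tendsto_comp_gridPoint (B := B) hS.differentiableAt_relVar j).congr' ?_
    filter_upwards [hK] with p hp
    exact (integral_relErr_sq hp h₀).symm
  refine (IsLittleOP.sum Finset.univ fun j _ => hj j).of_abs_le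
    (AsympSure.of_forall (Eventually.of_forall fun p y => ?_))
  rw [abs_norm, integral_exp_linearNoise]
  refine le_trans ?_ (le_abs_self _)
  have e : Complex.exp (-(S.relVar θ₀ θ₀ * ∑ j, u j ^ 2 / 2 : ℝ)) =
      ∏ j, Complex.exp (-(u j ^ 2 / 2 * S.relVar θ₀ θ₀ : ℝ)) := by
    rw [← Complex.exp_sum, Finset.sum_neg_distrib, ← Complex.ofReal_sum, Finset.mul_sum]
    congr 4
    exact funext fun j => mul_comm _ _
  rw [e]
  refine norm_prod_sub_prod_le_sum _ (fun j _ => ?_) (fun j _ => ?_)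
  · rw [norm_prod]
    refine Finset.prod_le_one (fun i _ => norm_nonneg _) fun i _ => ?_
    rw [norm_pow]
    exact pow_le_one₀ (norm_nonneg _) (norm_integral_exp_mul_I_le_one _)
  · rw [← Complex.ofReal_neg, Complex.norm_exp_ofReal]
    refine Real.exp_le_one_iff.2 (neg_nonpos.2 ?_)
    have := hS.relVar_pos
    positivity

end Sampling

end ImportanceSampler

namespace ImportanceSampler

variable {𝒴 : Type*} [MeasurableSpace 𝒴] {M : ParametricModel 𝒴} {𝒳 : Type*} [MeasurableSpace 𝒳]
  {S : ImportanceSampler M 𝒳} {θ₀ : ℝ} {J : ℕ} {m : ℕ → ℕ}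

/-- The error of the estimated log-likelihood at the `j`-th point of the grid around `θ`, corrected
for its bias and on the scale of the Monte Carlo model. -/
noncomputable def scaledNoise (S : ImportanceSampler M 𝒳) (θ₀ : ℝ) (J n k : ℕ)
    (j : Fin (2 * J + 1)) (θ : ℝ)
    (z : (Fin n → 𝒴) × (Fin (2 * J + 1) → Fin n → Fin k → 𝒳)) : ℝ :=
  √((k : ℝ) / n) * (S.logLikBar (gridPoint J n θ j) z.1 (z.2 j) -
    M.logLik z.1 (gridPoint J n θ j) -
    -((n : ℝ) / (2 * k)) * S.relVar θ₀ (gridPoint J n θ j))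

theorem measurable_scaledNoise (n k : ℕ) (j : Fin (2 * J + 1)) (θ : ℝ) :
    Measurable (S.scaledNoise θ₀ J n k j θ) := by
  have h1 : Measurable fun z : (Fin n → 𝒴) × (Fin (2 * J + 1) → Fin n → Fin k → 𝒳) =>
      S.logLikBar (gridPoint J n θ j) z.1 (z.2 j) := by
    refine Finset.measurable_fun_sum _ fun i _ => Measurable.log ?_
    refine (Finset.measurable_fun_sum _ fun r _ => (S.measurable_weight _).comp
      (f := fun z : (Fin n → 𝒴) × (Fin (2 * J + 1) → Fin n → Fin k → 𝒳) =>
        (z.1 i, z.2 j i r)) ?_).const_mul _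
    fun_prop
  have h2 : Measurable fun z : (Fin n → 𝒴) × (Fin (2 * J + 1) → Fin n → Fin k → 𝒳) =>
      M.logLik z.1 (gridPoint J n θ j) := by
    refine Finset.measurable_fun_sum _ fun i _ => Measurable.log ((M.measurable_p _).comp ?_)
    fun_prop
  exact ((h1.sub h2).sub_const _).const_mul _

/-- For draws independent of the data, at points of the windows, the noise is asymptotically
linear. -/
theorem isLittleOP_scaledNoise_sub_linearNoise (h₀ : θ₀ ∈ M.Θ) (hS : S.IsRegularAt θ₀)
    (hm : Tendsto (fun n : ℕ => (m n : ℝ) / √(n : ℝ)) atTop atTop) (j : Fin (2 * J + 1)) (B : ℝ) :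
    IsLittleOP (windowFilter θ₀ B)
      (fun p => (M.sampleLaw θ₀ p.1).prod (S.drawLaw J p.1 (m p.1) p.2))
      fun p z => S.scaledNoise θ₀ J p.1 (m p.1) j p.2 z - S.linearNoise J p.1 (m p.1) j p.2 z := by
  have := M.isProbabilityMeasure_P h₀
  have hn := tendsto_fst_windowFilter θ₀ B
  have h := isLittleOP_log_pbar (l := windowFilter θ₀ B) (n := fun p => p.1) (m := fun p => m p.1)
    (ϑ := fun p => gridPoint J p.1 p.2 j) h₀ hS (tendsto_gridPoint_windowFilter θ₀ B j) hn
    ((tendsto_simulations hm).comp hn) ((tendsto_sqrt_div_simulations hm).comp hn)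
  have hmp := fun p : ℕ × ℝ => S.measurePreserving_regroup J p.1 (m p.1) (M.P θ₀) p.2 j
  refine (h.comp (fun p => (hmp p).measurable) fun p => (hmp p).map_eq).congr_eq
    (Eventually.of_forall fun p z => ?_)
  simp only [scaledNoise, linearNoise, logLikBar, ParametricModel.logLik, Finset.sum_sub_distrib]
  ring

variable {Ω : ℕ → Type*} [∀ n, MeasurableSpace (Ω n)] {Pr : ∀ n, Measure (Ω n)}
  [∀ n, IsProbabilityMeasure (Pr n)] {Y : ∀ n, Ω n → Fin n → 𝒴}
  {pilot : ∀ n : ℕ, (Fin n → 𝒴) → ℝ} {a : ℕ → ℝ}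

/-- The index of the grid interval that contains the preliminary estimate. -/
noncomputable def gridCell (pilot : ∀ n : ℕ, (Fin n → 𝒴) → ℝ) (a : ℕ → ℝ) (n : ℕ)
    (y : Fin n → 𝒴) : ℤ := ⌊(pilot n y - a n) * √(n : ℝ)⌋

/-- The midpoint of a grid interval. -/
noncomputable def cellMidpoint (a : ℕ → ℝ) (n : ℕ) (i : ℤ) : ℝ :=
  a n + ((i : ℝ) + 1 / 2) / √(n : ℝ)

theorem measurable_gridCell {n : ℕ} (hpilot : Measurable (pilot n)) :
    Measurable (gridCell pilot a n) :=
  ((hpilot.sub_const _).mul_const _).floor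

/-- Functions of data, draws and the discretized estimate are jointly measurable if they are so at
each fixed value of the estimate. -/
theorem measurable_comp_gridMidpoint {n : ℕ} (hpilot : Measurable (pilot n)) {D E : Type*}
    [MeasurableSpace D] [MeasurableSpace E] {F : ℝ → (Fin n → 𝒴) × D → E}
    (hF : ∀ θ, Measurable (F θ)) :
    Measurable fun z : (Fin n → 𝒴) × D => F (gridMidpoint (a n) n (pilot n z.1)) z :=
  measurable_comp_lattice (g := cellMidpoint a n) hF (measurable_gridCell hpilot)

variable {X : ∀ n, Fin (2 * J + 1) → Fin n → Fin (m n) → Ω n → 𝒳}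

/-- The characteristic functions of the linear noise converge, as the conditional ones given the
data do so in probability and are bounded. -/
theorem tendsto_integral_exp_linearNoise (h₀ : θ₀ ∈ M.Θ) (hS : S.IsRegularAt θ₀)
    (hm : Tendsto (fun n : ℕ => (m n : ℝ) / √(n : ℝ)) atTop atTop)
    (hY : ∀ n, Measurable (Y n)) (hpilot : ∀ n, Measurable (pilot n))
    (hpilot_cons : M.IsRootConsistent pilot θ₀)
    (hX : ∀ n, S.IsMonteCarloDraw J n (m n) (M.sampleLaw θ₀ n)
        (fun y => gridMidpoint (a n) n (pilot n y)) (Pr n) (Y n) (X n))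
    (u : Fin (2 * J + 1) → ℝ) :
    Tendsto (fun n => ∫ ω, Complex.exp ((∑ j, u j * S.linearNoise J n (m n) j
        (gridMidpoint (a n) n (pilot n (Y n ω))) (Y n ω, fun j i l => X n j i l ω) : ℝ) *
          Complex.I) ∂(Pr n)) atTop
      (𝓝 (Complex.exp (-(S.relVar θ₀ θ₀ * ∑ j, u j ^ 2 / 2 : ℝ)))) := by
  have := fun n => M.isProbabilityMeasure_sampleLaw h₀ n
  have hκ := fun n => measurable_gridCell (a := a) (hpilot n)
  have hTm : ∀ n, Measurable fun ω => (Y n ω, fun j i l => X n j i l ω) := fun n =>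
    (hY n).prodMk (measurable_pi_lambda _ fun j => measurable_pi_lambda _ fun i =>
      measurable_pi_lambda _ fun l => (hX n).measurable j i l)
  set c := Complex.exp (-(S.relVar θ₀ θ₀ * ∑ j, u j ^ 2 / 2 : ℝ)) with hc
  set Φ : ∀ n, ℝ → (Fin n → 𝒴) × (Fin (2 * J + 1) → Fin n → Fin (m n) → 𝒳) → ℂ := fun n θ z =>
    Complex.exp ((∑ j, u j * S.linearNoise J n (m n) j θ z : ℝ) * Complex.I) with hΦ
  have hΦm : ∀ n θ, Measurable (Φ n θ) := fun n θ => by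
    refine Complex.measurable_exp.comp ((Complex.measurable_ofReal.comp ?_).mul_const _)
    exact Finset.measurable_fun_sum _ fun j _ =>
      (S.measurable_linearNoise J n (m n) j θ).const_mul _
  have hΦn : ∀ n θ z, ‖Φ n θ z‖ = 1 := fun n θ z => Complex.norm_exp_ofReal_mul_I _
  have hGm : ∀ n, Measurable fun z => Φ n (cellMidpoint a n (gridCell pilot a n z.1)) z := fun n =>
    measurable_comp_lattice (hΦm n) (hκ n)
  set G : ∀ n, (Fin n → 𝒴) → ℂ := fun n y =>
    ∫ x, Φ n (gridMidpoint (a n) n (pilot n y)) (y, x)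
      ∂(S.drawLaw J n (m n) (gridMidpoint (a n) n (pilot n y))) with hG
  have e : ∀ n, ∫ ω, Φ n (gridMidpoint (a n) n (pilot n (Y n ω)))
      (Y n ω, fun j i l => X n j i l ω) ∂(Pr n) = ∫ y, G n y ∂(M.sampleLaw θ₀ n) := by
    intro n
    have h1 : Integrable (fun z => Φ n (cellMidpoint a n (gridCell pilot a n z.1)) z)
        (M.sampleLaw θ₀ n ⊗ₘ latticeKernel (S.drawLaw J n (m n)) (cellMidpoint a n) (hκ n)) :=
      Integrable.of_bound (hGm n).aestronglyMeasurable 1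
        (Eventually.of_forall fun z => (hΦn _ _ _).le)
    have h2 := integral_map (μ := Pr n) (hTm n).aemeasurable
      (f := fun z => Φ n (cellMidpoint a n (gridCell pilot a n z.1)) z)
      (hGm n).aestronglyMeasurable
    rw [(hX n).map_eq (hY n) (hκ n) (g := cellMidpoint a n) (fun y => rfl),
      Measure.integral_compProd h1] at h2
    exact h2.symm
  refine Tendsto.congr (fun n => (e n).symm) ?_
  have hop : IsLittleOP atTop (fun n => M.sampleLaw θ₀ n) fun n y => ‖G n y - c‖ :=
    IsLittleOP.of_window (X := fun n θ y => ‖∫ x, Φ n θ (y, x) ∂(S.drawLaw J n (m n) θ) - c‖)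
      (fun n y => exists_gridMidpoint_eq a n (pilot n y)) (isBigOP_gridMidpoint hpilot_cons a)
      fun B => isLittleOP_conditional_linearNoise h₀ hS (tendsto_simulations hm) u B
  have hGn : ∀ n y, ‖G n y‖ ≤ 1 := fun n y => norm_integral_exp_mul_I_le_one _
  have hcn : ‖c‖ ≤ 1 := by
    rw [hc, ← Complex.ofReal_neg, Complex.norm_exp_ofReal]
    refine Real.exp_le_one_iff.2 (neg_nonpos.2 ?_)
    have := hS.relVar_pos
    positivity
  have h := tendsto_integral_zero_of_isLittleOP (D := fun n y => G n y - c) (K := 2)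
    (fun n y => (norm_sub_le _ _).trans (by linarith [hGn n y])) hop
  have hGi : ∀ n, Integrable (G n) (M.sampleLaw θ₀ n) := fun n =>
    Integrable.of_bound (MeasureTheory.StronglyMeasurable.integral_kernel_prod_right'
      (κ := latticeKernel (S.drawLaw J n (m n)) (cellMidpoint a n) (hκ n))
      (hGm n).stronglyMeasurable).aestronglyMeasurable 1 (Eventually.of_forall (hGn n))
  have h' := h.add_const c
  rw [zero_add] at h'
  refine h'.congr fun n => ?_
  rw [integral_sub (hGi n) (integrable_const _)]
  simp

/-- Importance sampling obeys the Monte Carlo model: the noise is asymptotically linear, the linear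
part is asymptotically normal given the data, and the bias is proportional to `relVar θ₀`, which is
nearly linear on the grid. -/
theorem monteCarloModel (h₀ : θ₀ ∈ M.Θ) (hS : S.IsRegularAt θ₀)
    (hm : Tendsto (fun n : ℕ => (m n : ℝ) / √(n : ℝ)) atTop atTop)
    (hY : ∀ n, Measurable (Y n)) (hY_law : ∀ n, (Pr n).map (Y n) = M.sampleLaw θ₀ n)
    (hpilot : ∀ n, Measurable (pilot n)) (hpilot_cons : M.IsRootConsistent pilot θ₀)
    (hX : ∀ n, S.IsMonteCarloDraw J n (m n) (M.sampleLaw θ₀ n)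
        (fun y => gridMidpoint (a n) n (pilot n y)) (Pr n) (Y n) (X n))
    {Lbar : ∀ n, Fin (2 * J + 1) → Ω n → ℝ} {γ : ℕ → ℝ → ℝ}
    (hL : ∀ n j ω, Lbar n j ω = S.logLikBar
        (gridPoint J n (gridMidpoint (a n) n (pilot n (Y n ω))) j) (Y n ω)
        (fun i l => X n j i l ω))
    (hγ : ∀ n θ, γ n θ = -((n : ℝ) / (2 * m n)) * S.relVar θ₀ θ) :
    MonteCarloModel M J m Pr Y (fun n ω => gridMidpoint (a n) n (pilot n (Y n ω))) Lbar γ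
      (-(deriv (S.relVar θ₀) θ₀ / 2)) √(S.relVar θ₀ θ₀) := by
  have := fun n => M.isProbabilityMeasure_sampleLaw h₀ n
  have hκ := fun n => measurable_gridCell (a := a) (hpilot n)
  have hTm : ∀ n, Measurable fun ω => (Y n ω, fun j i l => X n j i l ω) := fun n =>
    (hY n).prodMk (measurable_pi_lambda _ fun j => measurable_pi_lambda _ fun i =>
      measurable_pi_lambda _ fun l => (hX n).measurable j i l)
  have hgrid : ∀ n ω, ∃ k : ℤ, gridMidpoint (a n) n (pilot n (Y n ω)) =
      a n + ((k : ℝ) + 1 / 2) / √(n : ℝ) := fun n ω => exists_gridMidpoint_eq a n _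
  have hθ : IsBigOP atTop Pr fun n ω =>
      √(n : ℝ) * (gridMidpoint (a n) n (pilot n (Y n ω)) - θ₀) :=
    (isBigOP_gridMidpoint hpilot_cons a).comp hY hY_law
  refine ⟨Real.sqrt_pos.2 hS.relVar_pos, ?_, fun j => ?_⟩
  · have hN : ∀ n ω j, √((m n : ℝ) / n) *
        (Lbar n j ω - M.logLik (Y n ω) (gridPoint J n (gridMidpoint (a n) n (pilot n (Y n ω))) j)
          - γ n (gridPoint J n (gridMidpoint (a n) n (pilot n (Y n ω))) j)) =
        S.scaledNoise θ₀ J n (m n) j (gridMidpoint (a n) n (pilot n (Y n ω)))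
          (Y n ω, fun j i l => X n j i l ω) := by
      intro n ω j
      rw [hL, hγ, scaledNoise]
    simp only [hN]
    have hNm : ∀ n j, Measurable fun ω => S.scaledNoise θ₀ J n (m n) j
        (gridMidpoint (a n) n (pilot n (Y n ω))) (Y n ω, fun j i l => X n j i l ω) := by
      intro n j
      have h1 := measurable_comp_gridMidpoint (pilot := pilot) (a := a)
        (F := S.scaledNoise θ₀ J n (m n) j) (hpilot n) (measurable_scaledNoise n (m n) j)
      have h2 := h1.comp (hTm n)
      exact h2
    have hLm : ∀ n j, Measurable fun ω => S.linearNoise J n (m n) j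
        (gridMidpoint (a n) n (pilot n (Y n ω))) (Y n ω, fun j i l => X n j i l ω) := by
      intro n j
      have h1 := measurable_comp_gridMidpoint (pilot := pilot) (a := a)
        (F := S.linearNoise J n (m n) j) (hpilot n) (S.measurable_linearNoise J n (m n) j)
      have h2 := h1.comp (hTm n)
      exact h2
    have hsub : ∀ j, IsLittleOP atTop Pr fun n ω =>
        S.scaledNoise θ₀ J n (m n) j (gridMidpoint (a n) n (pilot n (Y n ω)))
            (Y n ω, fun j i l => X n j i l ω) -
          S.linearNoise J n (m n) j (gridMidpoint (a n) n (pilot n (Y n ω)))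
            (Y n ω, fun j i l => X n j i l ω) := by
      intro j
      refine isLittleOP_iff.2 fun ε hε => AsympSure.of_window
        (q := fun n θ ω => |S.scaledNoise θ₀ J n (m n) j θ (Y n ω, fun j i l => X n j i l ω) -
          S.linearNoise J n (m n) j θ (Y n ω, fun j i l => X n j i l ω)| < ε) hgrid hθ fun B => ?_
      exact AsympSure.of_draws (l := windowFilter θ₀ B) (Pr := fun p => Pr p.1)
        (law := fun p => M.sampleLaw θ₀ p.1) (Q := fun p => S.drawLaw J p.1 (m p.1))
        (g := fun p => cellMidpoint a p.1) (k := fun p => gridCell pilot a p.1)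
        (hk := fun p => hκ p.1) (T := fun p ω => (Y p.1 ω, fun j i l => X p.1 j i l ω))
        (fun p => hTm p.1) (fun p => (hX p.1).map_eq (hY p.1) (hκ p.1) fun y => rfl)
        (θ := fun p => p.2)
        ((isLittleOP_scaledNoise_sub_linearNoise h₀ hS hm j B).asympSure_lt hε)
    rw [tendstoInDistribution_pi_gaussian_iff
      fun n => (measurable_pi_lambda _ fun j => hNm n j).aemeasurable]
    intro u
    rw [Real.sq_sqrt hS.relVar_pos.le, Real.coe_toNNReal _ hS.relVar_pos.le]
    refine tendsto_integral_exp_congr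
      (fun n => (Finset.measurable_fun_sum _ fun j _ => (hLm n j).const_mul (u j)).aemeasurable)
      (fun n => (Finset.measurable_fun_sum _ fun j _ => (hNm n j).const_mul (u j)).aemeasurable) ?_
      (tendsto_integral_exp_linearNoise h₀ hS hm hY hpilot hpilot_cons hX u)
    refine (IsLittleOP.sum Finset.univ fun j _ => (hsub j).const_mul (u j)).congr_eq
      (Eventually.of_forall fun n ω => ?_)
    rw [← Finset.sum_sub_distrib]
    exact Finset.sum_congr rfl fun j _ => (mul_sub _ _ _).symm
  · have h : IsLittleOP atTop Pr fun n ω => -(1 / 2) * ((S.relVar θ₀ (gridPoint J n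
        (gridMidpoint (a n) n (pilot n (Y n ω))) j) - S.relVar θ₀
          (gridMidpoint (a n) n (pilot n (Y n ω)))) / gridScale n -
            deriv (S.relVar θ₀) θ₀ * gridIndex J j) := by
      refine IsLittleOP.const_mul (IsLittleOP.of_window (X := fun n θ _ =>
        (S.relVar θ₀ (gridPoint J n θ j) - S.relVar θ₀ θ) / gridScale n -
          deriv (S.relVar θ₀) θ₀ * gridIndex J j) hgrid hθ fun B => ?_) _
      have ht := (tendsto_gridPoint_slope hS.differentiableAt_relVar B j).sub_const
        (deriv (S.relVar θ₀) θ₀ * gridIndex J j)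
      rw [sub_self] at ht
      exact isLittleOP_of_tendsto ht
    refine IsLittleOP.congr_eq h ?_
    filter_upwards [eventually_gt_atTop 0, eventually_simulations_pos hm] with n hn hmn ω
    have hg := (gridScale_pos hn).ne'
    have hn' : (n : ℝ) ≠ 0 := by exact_mod_cast hn.ne'
    have hm' : (m n : ℝ) ≠ 0 := by exact_mod_cast hmn.ne'
    rw [hγ, hγ]
    field_simp
    ring

end ImportanceSampler

theorem theorem2
    {𝒴 : Type*} [MeasurableSpace 𝒴] (M : ParametricModel 𝒴) (ds : M.Derivs)
    (hM : M.IsRegular ds) (θ₀ : ℝ) (hθ₀ : θ₀ ∈ M.Θ)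
    (J : ℕ) (hJ : 1 < J) (m : ℕ → ℕ)
    (hm_lower : Tendsto (fun n : ℕ => (m n : ℝ) / √(n : ℝ)) atTop atTop)
    (hm_upper : Tendsto (fun n : ℕ => (m n : ℝ) / (n : ℝ)) atTop (𝓝 0))
    {Ω : ℕ → Type*} [∀ n, MeasurableSpace (Ω n)] (Pr : ∀ n, Measure (Ω n))
    [∀ n, IsProbabilityMeasure (Pr n)]
    (Y : ∀ n, Ω n → Fin n → 𝒴) (hY : ∀ n, Measurable (Y n))
    (hY_law : ∀ n, (Pr n).map (Y n) = M.sampleLaw θ₀ n)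
    (pilot : ∀ n : ℕ, (Fin n → 𝒴) → ℝ) (hpilot : ∀ n, Measurable (pilot n))
    (hpilot_cons : M.IsRootConsistent pilot θ₀) (a : ℕ → ℝ) :
    -- every Monte Carlo evaluator that obeys the Monte Carlo model yields an efficient estimator,
    (∀ (Lbar : ∀ n, Fin (2 * J + 1) → Ω n → ℝ) (γ : ℕ → ℝ → ℝ) (C τ : ℝ),
      MonteCarloModel M J m Pr Y (fun n ω => gridMidpoint (a n) n (pilot n (Y n ω))) Lbar γ C τ →
      IsEfficientMCLE M J m Pr Y (fun n ω => gridMidpoint (a n) n (pilot n (Y n ω))) ds θ₀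
        Lbar γ C τ) ∧
    -- and importance sampling obeys that model, hence yields an efficient estimator.
    (∀ (𝒳 : Type*) [MeasurableSpace 𝒳] (S : ImportanceSampler M 𝒳), S.IsRegularAt θ₀ →
      ∀ X : ∀ n, Fin (2 * J + 1) → Fin n → Fin (m n) → Ω n → 𝒳,
      (∀ n, S.IsMonteCarloDraw J n (m n) (M.sampleLaw θ₀ n)
        (fun y => gridMidpoint (a n) n (pilot n y)) (Pr n) (Y n) (X n)) →
      ∀ (Lbar : ∀ n, Fin (2 * J + 1) → Ω n → ℝ) (γ : ℕ → ℝ → ℝ),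
      (∀ n j ω, Lbar n j ω = S.logLikBar
        (gridPoint J n (gridMidpoint (a n) n (pilot n (Y n ω))) j) (Y n ω)
        (fun i l => X n j i l ω)) →
      (∀ n θ, γ n θ = -((n : ℝ) / (2 * m n)) * S.relVar θ₀ θ) →
      MonteCarloModel M J m Pr Y (fun n ω => gridMidpoint (a n) n (pilot n (Y n ω))) Lbar γ
        (-(deriv (S.relVar θ₀) θ₀ / 2)) √(S.relVar θ₀ θ₀) ∧
      IsEfficientMCLE M J m Pr Y (fun n ω => gridMidpoint (a n) n (pilot n (Y n ω))) ds θ₀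
        Lbar γ (-(deriv (S.relVar θ₀) θ₀ / 2)) √(S.relVar θ₀ θ₀)) := by
  refine ⟨fun Lbar γ C τ h => h.isEfficientMCLE hM hθ₀ hJ (hm := hm_lower) hY hY_law hpilot_cons,
    fun 𝒳 _ S hS X hX Lbar γ hL hγ => ?_⟩
  have h := ImportanceSampler.monteCarloModel hθ₀ hS hm_lower hY hY_law hpilot hpilot_cons hX hL hγ
  exact ⟨h, h.isEfficientMCLE hM hθ₀ hJ (hm := hm_lower) hY hY_law hpilot_cons⟩
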